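/- Let $\Delta\ge 3$ be an integer. **Strings.** Let $X_\Delta$ be the set of strings $x_j\dots x_1x_0$ ($j\ge 0$) with $x_0\in\{1,2\}$ and $x_i\in\{1,\dots,\Delta,*\}$ for $i\ge1$, and let $X_\Delta^-$ be the set of those without $*$; $x_i$ is the $i$-th symbol, and a final substring of $x$ is a string $x_i\dots x_0$. A finite $Y\subseteq X_\Delta^-$ is *independent* if no element is a final substring of another one, and *clearing* if each string in $X_\Delta^-$ of length at least $\max_{y\in Y}\mathrm{len}(y)$ has a final substring in $Y$. **Construction trees.** Let $T$ be a finite rooted tree with root $r$, and let $L_i$ be the set of nodes at distance $i-1$ from $r$. $T$ is *$\Delta$-balanced* if every node has $0$, $1$ or $\Delta$ children and nodes in the same layer have equally many children. Nodes with one child are *reflect nodes*, all others *split nodes*; nonempty layers are accordingly reflect or split layers. $T$ is *well-nested* if it has as many reflect as split layers, $L_1$ is a reflect layer, the last layer $L_m$ is a split layer, and there is a (necessarily unique) bijection $\varphi$ from the indices of reflect layers to those of split layers such that $\varphi(1)=m$, $i<\varphi(i)$, and $i<j<\varphi(i)$ implies $\varphi(j)<\varphi(i)$. If $i_1<i_2<\dots$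 are the indices of the reflect layers, put $\mathcal R_j=L_{i_j}$ and $\mathcal S_j=L_{\varphi(i_j)}$. A *$\Delta$-ary construction tree* is a well-nested $\Delta$-balanced rooted tree with a labeling $\ell:V(T)\to X_\Delta$ such that: (1) $\ell(r)=1$; (2) labels of nodes in $\mathcal R_i$ have length $i$; (3) distinct reflect nodes have distinct labels; (4) labels of reflect nodes lie in $X_\Delta^-$; (5) the set of labels of reflect nodes is independent and clearing; (6) the label of a split node in $L_i$ has length $1$ plus the number of reflect layers $L_j$ with $j<i$; (7) if $v\in\mathcal S_i$ has the ancestor $w\in\mathcal R_i$, then $\ell(v)$ contains $*$ exactly once, namely as its $i$-th symbol, and its $0$-th to $(i-1)$-th symbols are those of $\ell(w)$; (8) if $v\in\mathcal S_i$ has children, then they can be numbered $w_1,\dots,w_\Delta$ such that $w_j$ and all its descendants have $i$-th symbol $j$; $w_j$ is called the *$j$-th child* of $v$. **The transformation $F$.** Traverse $T$ depth-first, visiting the $j$-th children of each split node in the order $j=1,\dots,\Delta$, and let $Q=(v_1,\dots,v_{2N})$ be the sequence of reflect nodes visited, each listed at its first (*early*) and at its second (*late*) visit. The *early rank* of a reflect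 node is the position of its early appearance among all early appearances. For $1\le i\le 2N$ let $\mathcal K_i$ be the set of early ranks of the nodes whose late appearance is strictly before position $i$. The $i$-th layer of $F(T)$ consists of one node for each string obtained as follows: take $\ell(v_i)$ if $v_i$ is early and $*\ell(v_i)$ (prepend $*$) if $v_i$ is late, spread out its symbols, in order, over the positions in $\{0,1,2,\dots\}\setminus\mathcal K_i$, and fill the positions in $\mathcal K_i$ with arbitrary symbols from $\{1,\dots,\Delta\}$; this string is the label of the node. A node in layer $i$ is the parent of those nodes in layer $i+1$ whose labels agree with its own label in all positions in $\mathcal K_i$. **Input graphs.** A *$2$-leaf* is a node of degree $1$ whose label has $0$-th symbol $2$. *Splitting* at a node marks it. *Reflecting* at an unmarked leaf $v$: let $H_1$ be the connected component of $v$ in the subgraph induced by the unmarked nodes; add copies $H_2,\dots,H_\Delta$ of $H_1$, prepend $i$ to the labels of all nodes of $H_i$ other than $v$ and its copy ($1\le i\le\Delta$), identify $v$ with all its copies, and prepend $*$ to the label of $v$. For a construction tree $T$, let $v^{(1)},v^{(2)},\dots$ be any ordering of $V(T)$ in which every node comes after its proper ancestors. Let $G^{(0)}$ be a single edge whose two unmarked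 endpoints are labelled $1$ and $2$, and let $G^{(i)}$ arise from $G^{(i-1)}$ by reflecting (if $v^{(i)}$ is a reflect node) or splitting (if it is a split node) at the node with label $\ell(v^{(i)})$. $T$ is *distance-$D$-correct* if for every such ordering and every $i$ for which $v^{(i)}$ is a split node, each $2$-leaf of $G^{(i-1)}$ in the same connected component of unmarked nodes as the node labelled $\ell(v^{(i)})$ has distance at least $D$ from that node in $G^{(i-1)}$. **The sequence $T_i$.** $T_2$ has the following nodes, given by their labels: $1$; $w\,m\,2$ and $*\,w\,m\,2$ for $1\le m\le\Delta$ and $w\in\{1,\dots,\Delta\}^{m-1}$; and $w*1$ for $w\in\{1,\dots,\Delta\}^{\Delta}$. Its root is $1$, and its edges, from parent to child, are $1\to12$, $\;w\,m\,2\to *\,w\,m\,2$, $\;*\,w\,m\,2\to j\,w\,(m{+}1)\,2$ for $m<\Delta$, and $*\,w\,\Delta\,2\to j\,w*1$, for all $1\le j\le\Delta$. For $i\ge3$, $T_i:=F(T_{i-1})$. **Statement.** 1. For every $\Delta$-ary construction tree, the sequences $G^{(0)},G^{(1)},\dots$ are well-defined: for every $i\geq 1$, exactly one node of $G^{(i-1)}$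 has the label $\ell(v^{(i)})$; it is unmarked, and if $v^{(i)}$ is a reflect node, it is a leaf, which is a $2$-leaf if $i>1$. 2. If $D$ is a positive integer and $T$ is a distance-$D$-correct $\Delta$-ary construction tree, then $F(T)$ is a distance-$2D$-correct $\Delta$-ary construction tree. 3. For every integer $i\ge2$, $T_i$ is a distance-$2^{i-1}$-correct $\Delta$-ary construction tree. -/

import Mathlib

namespace CTree

section

open scoped Classical

/-! ### Strings -/

/-- The symbols `1, 2, 3, …` and `*`. -/
inductive Sym : Type
  | star : Sym
  | digit (n : ℕ) : Sym

/-- A string `x_j … x_1 x_0` is stored as the list `[x_0, x_1, …, x_j]`, so that `x[i]?` is its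
`i`-th symbol, prepending a symbol `c` on the left is `x ++ [c]`, and "`x` is a final substring
of `y`" is the prefix relation `x <+: y` of lists. -/
abbrev Str := List Sym

/-- The set `X_b`: nonempty strings over `1, …, b, *` whose `0`-th symbol is `1` or `2`. -/
def XStr (b : ℕ) : Set Str :=
  {x | (x[0]? = some (Sym.digit 1) ∨ x[0]? = some (Sym.digit 2)) ∧
    ∀ c ∈ x.tail, c = Sym.star ∨ ∃ d, 1 ≤ d ∧ d ≤ b ∧ c = Sym.digit d}

/-- The set `X_b^-` of the strings in `X_b` without the symbol `*`. -/
def XStrMinus (b : ℕ) : Set Str := {x | x ∈ XStr b ∧ Sym.star ∉ x}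

def Independent (Y : Set Str) : Prop :=
  ∀ y ∈ Y, ∀ y' ∈ Y, y ≠ y' → ¬ (y <+: y') ∧ ¬ (y' <+: y)

/-- Every string of `X_b^-` that is at least as long as all strings of `Y` has a final substring
in `Y`. -/
def Clearing (b : ℕ) (Y : Set Str) : Prop :=
  ∀ x ∈ XStrMinus b, (∀ y ∈ Y, y.length ≤ x.length) → ∃ y ∈ Y, y <+: x

/-! ### Rooted trees with node labels -/

/-- A directed graph with labelled nodes; `Child v w` says that `w` is a child of `v`. It is a
rooted tree if `IsRootedTree` holds. -/
structure LTree where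
  V : Type
  Child : V → V → Prop
  label : V → Str

namespace LTree

variable (T : LTree)

def IsRoot (r : T.V) : Prop := ∀ v, ¬ T.Child v r

/-- `w` is a descendant of `v` (every node is a descendant of itself). -/
def Desc (v w : T.V) : Prop := Relation.ReflTransGen T.Child v w

/-- A finite rooted tree: there is a root from which every node descends, and every node has at
most one parent. -/
def IsRootedTree : Prop :=
  Finite T.V ∧ (∃ r, T.IsRoot r ∧ ∀ v, T.Desc r v) ∧
    ∀ u v w, T.Child u w → T.Child v w → u = v

/-- The layer `L_i`, `i ≥ 1`: the nodes at distance `i - 1` from the root. -/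
def layer : ℕ → Set T.V
  | 0 => ∅
  | 1 => {r | T.IsRoot r}
  | n + 2 => {w | ∃ v ∈ layer (n + 1), T.Child v w}

noncomputable def numChildren (v : T.V) : ℕ := {w | T.Child v w}.ncard

def IsBalanced (b : ℕ) : Prop :=
  3 ≤ b ∧
  (∀ v, T.numChildren v = 0 ∨ T.numChildren v = 1 ∨ T.numChildren v = b) ∧
  ∀ i, ∀ v ∈ T.layer i, ∀ w ∈ T.layer i, T.numChildren v = T.numChildren w

def IsReflect (v : T.V) : Prop := T.numChildren v = 1
def IsSplit (v : T.V) : Prop := ¬ T.IsReflect v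
def IsInternalSplit (b : ℕ) (v : T.V) : Prop := T.IsSplit v ∧ T.numChildren v = b
def IsLeaf (v : T.V) : Prop := T.numChildren v = 0

/-- The set of the indices of the reflect layers. -/
def reflectLayers : Set ℕ := {i | (T.layer i).Nonempty ∧ ∀ v ∈ T.layer i, T.IsReflect v}
/-- The set of the indices of the split layers. -/
def splitLayers : Set ℕ := {i | (T.layer i).Nonempty ∧ ∀ v ∈ T.layer i, T.IsSplit v}
/-- `m` is the index of the leaf layer. -/
def IsLeafLayer (m : ℕ) : Prop := (T.layer m).Nonempty ∧ ∀ v ∈ T.layer m, T.IsLeaf v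

/-- `φ` (restricted to the indices of reflect layers) is a bijection from reflect layers to split
layers that witnesses well-nestedness; `m` is the index of the leaf layer. -/
structure IsNesting (m : ℕ) (φ : ℕ → ℕ) : Prop where
  bijOn : Set.BijOn φ T.reflectLayers T.splitLayers
  first : φ 1 = m
  lt : ∀ i ∈ T.reflectLayers, i < φ i
  nested : ∀ i ∈ T.reflectLayers, ∀ j ∈ T.reflectLayers, i < j → j < φ i → φ j < φ i

def WellNested : Prop :=
  ∃ m, T.IsLeafLayer m ∧ T.splitLayers.ncard = T.reflectLayers.ncard ∧
    1 ∈ T.reflectLayers ∧ m ∈ T.splitLayers ∧ ∃ φ, T.IsNesting m φ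

/-- The reflect layer `L_i` is the `j`-th reflect layer for `j = reflectIndex i`. -/
noncomputable def reflectIndex (i : ℕ) : ℕ := {k | k ∈ T.reflectLayers ∧ k ≤ i}.ncard

/-- `v` lies in the `j`-th reflect layer. -/
def InReflectLayer (j : ℕ) (v : T.V) : Prop :=
  ∃ i ∈ T.reflectLayers, T.reflectIndex i = j ∧ v ∈ T.layer i

/-- `v` lies in the `j`-th split layer, that is, in `L_{φ(i)}` where `L_i` is the `j`-th reflect
layer (`φ` is unique in a well-nested balanced rooted tree). -/
def InSplitLayer (j : ℕ) (v : T.V) : Prop :=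
  ∃ m φ, T.IsLeafLayer m ∧ T.IsNesting m φ ∧
    ∃ i ∈ T.reflectLayers, T.reflectIndex i = j ∧ v ∈ T.layer (φ i)

/-- Solid labelings. -/
structure IsSolid (b : ℕ) : Prop where
  mem_X : ∀ v, T.label v ∈ XStr b
  root : ∀ r, T.IsRoot r → T.label r = [Sym.digit 1]
  reflect_length : ∀ i v, T.InReflectLayer i v → (T.label v).length = i
  reflect_injective : ∀ v w, T.IsReflect v → T.IsReflect w → v ≠ w → T.label v ≠ T.label w
  reflect_no_star : ∀ v, T.IsReflect v → T.label v ∈ XStrMinus b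
  independent : Independent {x | ∃ v, T.IsReflect v ∧ T.label v = x}
  clearing : Clearing b {x | ∃ v, T.IsReflect v ∧ T.label v = x}
  split_length : ∀ i, ∀ v ∈ T.layer i, T.IsSplit v →
    (T.label v).length = {j | j ∈ T.reflectLayers ∧ j < i}.ncard + 1
  split_star : ∀ v, T.IsSplit v → ∀ i, T.InSplitLayer i v →
    ∀ w, T.InReflectLayer i w → T.Desc w v →
      (T.label v)[i]? = some Sym.star ∧ ∀ k < i, (T.label v)[k]? = (T.label w)[k]?
  split_star_unique : ∀ v, T.IsSplit v → ∃! k : ℕ, (T.label v)[k]? = some Sym.star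
  split_children : ∀ v, T.IsInternalSplit b v → ∀ i, T.InSplitLayer i v →
    ∃ ρ : T.V → ℕ, Set.BijOn ρ {w | T.Child v w} (Set.Icc 1 b) ∧
      ∀ w, T.Child v w → ∀ u, T.Desc w u → (T.label u)[i]? = some (Sym.digit (ρ w))

/-- `b`-ary construction trees. -/
def IsConstructionTree (b : ℕ) : Prop :=
  T.IsRootedTree ∧ T.IsBalanced b ∧ T.WellNested ∧ T.IsSolid b

/-! ### The transformation `F` -/

/-- `w` is the `j`-th child of the split node `v`. -/
def IsNthChild (v : T.V) (j : ℕ) (w : T.V) : Prop :=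
  T.Child v w ∧ ∃ i, T.InSplitLayer i v ∧ (T.label w)[i]? = some (Sym.digit j)

/-- The children of `v` in the order in which the depth-first traversal visits them: the only
child of a reflect node; the first, second, …, `b`-th child of an internal split node. -/
noncomputable def orderedChildren (b : ℕ) (v : T.V) : List T.V :=
  if T.IsReflect v then
    if h : ∃ w, T.Child v w then [h.choose] else []
  else
    (List.range' 1 b).filterMap fun j =>
      if h : ∃ w, T.IsNthChild v j w then some h.choose else none

/-- The reflect nodes visited by the depth-first traversal of the subtree hanging from a node,
each twice, with `false` at its first (early) and `true` at its second (late) appearance. The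
first argument bounds the height of the subtree. -/
noncomputable def visit (b : ℕ) : ℕ → T.V → List (T.V × Bool)
  | 0, _ => []
  | n + 1, v =>
    if T.IsReflect v then
      (v, false) :: ((T.orderedChildren b v).flatMap (visit b n) ++ [(v, true)])
    else (T.orderedChildren b v).flatMap (visit b n)

/-- The sequence `Q = (v_1, …, v_{2|V_R|})`; its positions are counted from `0` here. -/
noncomputable def Q (b : ℕ) : List (T.V × Bool) :=
  if h : ∃ r, T.IsRoot r then T.visit b (Nat.card T.V) h.choose else []

/-- The early rank of a reflect node, counted from `1`. -/
noncomputable def earlyRank (b : ℕ) (u : T.V) : ℕ :=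
  (((T.Q b).filter fun q => !q.2).map Prod.fst).idxOf u + 1

/-- The set `𝒦` for the layer of `F(T)` at position `p` of `Q`: the indices `k` such that the
`k`-th split layer of `F(T)` lies strictly before that layer. -/
noncomputable def lateRanks (b p : ℕ) : Finset ℕ :=
  ((((T.Q b).take p).filter fun q => q.2).map fun q => T.earlyRank b q.1).toFinset

end LTree

/-- The `K`-padded version of `x`, with `none` for the special symbol `□`. -/
def padded (K : Finset ℕ) (x : Str) : List (Option Sym) :=
  (List.range (x.length + K.card)).map fun n =>
    if n ∈ K then none else x[(Finset.range n \ K).card]?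

/-- The strings obtained from `y` by replacing each `□` with a symbol from `{1, …, b}`. -/
def fillings (b : ℕ) (y : List (Option Sym)) : Set Str :=
  {s | s.length = y.length ∧
    (∀ (n : ℕ) (c : Sym), y[n]? = some (some c) → s[n]? = some c) ∧
    ∀ n : ℕ, y[n]? = some none → ∃ d, 1 ≤ d ∧ d ≤ b ∧ s[n]? = some (Sym.digit d)}

namespace LTree

variable (T : LTree)

/-- The labels of the nodes of the layer of `F(T)` at position `p` of `Q`. -/
noncomputable def layerLabels (b : ℕ) (p : Fin (T.Q b).length) : Set Str :=
  let q := (T.Q b).get p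
  fillings b (padded (T.lateRanks b p)
    (if q.2 then T.label q.1 ++ [Sym.star] else T.label q.1))

/-- The tree `F(T)`. A node is a pair of a layer (a position of `Q`) and one of the labels
reserved for this layer; a node is joined to those nodes of the next layer whose labels agree
with its own label in all positions of `𝒦`. -/
noncomputable def F (b : ℕ) : LTree where
  V := (p : Fin (T.Q b).length) × T.layerLabels b p
  Child x y := (y.1 : ℕ) = x.1 + 1 ∧
    ∀ k ∈ T.lateRanks b x.1, x.2.1[k]? = y.2.1[k]?
  label x := x.2.1

end LTree

/-! ### The sequence of construction trees -/

/-- Words over `{1, …, Δ}`. -/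
def IsWord (Δ : ℕ) (w : List ℕ) : Prop := ∀ d ∈ w, 1 ≤ d ∧ d ≤ Δ

/-- The node labels of the initial tree, in usual notation (leftmost symbol first, `w` a word
over `{1, …, Δ}`): `1`; `w m 2` and `* w m 2` for `1 ≤ m ≤ Δ` and `|w| = m - 1`; and `w * 1` for
`|w| = Δ`. -/
inductive InitialLabel (Δ : ℕ) : Str → Prop
  | root : InitialLabel Δ [Sym.digit 1]
  | reflect (m : ℕ) (w : List ℕ) (hm : 1 ≤ m) (hm' : m ≤ Δ) (hw : IsWord Δ w)
      (hl : w.length = m - 1) :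
      InitialLabel Δ ([Sym.digit 2, Sym.digit m] ++ w.map Sym.digit)
  | split (m : ℕ) (w : List ℕ) (hm : 1 ≤ m) (hm' : m ≤ Δ) (hw : IsWord Δ w)
      (hl : w.length = m - 1) :
      InitialLabel Δ ([Sym.digit 2, Sym.digit m] ++ w.map Sym.digit ++ [Sym.star])
  | leaf (w : List ℕ) (hw : IsWord Δ w) (hl : w.length = Δ) :
      InitialLabel Δ ([Sym.digit 1, Sym.star] ++ w.map Sym.digit)

/-- The edges of the initial tree from a parent to a child: `1` to `12`, `w m 2` to `* w m 2`,
`* w m 2` to `j w (m+1) 2` for `m < Δ`, and `* w Δ 2` to `j w * 1`. -/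
inductive InitialChild (Δ : ℕ) : Str → Str → Prop
  | root : InitialChild Δ [Sym.digit 1] [Sym.digit 2, Sym.digit 1]
  | reflect (m : ℕ) (w : List ℕ) :
      InitialChild Δ ([Sym.digit 2, Sym.digit m] ++ w.map Sym.digit)
        ([Sym.digit 2, Sym.digit m] ++ w.map Sym.digit ++ [Sym.star])
  | split (m : ℕ) (w : List ℕ) (j : ℕ) (hm : m < Δ) :
      InitialChild Δ ([Sym.digit 2, Sym.digit m] ++ w.map Sym.digit ++ [Sym.star])
        ([Sym.digit 2, Sym.digit (m + 1)] ++ w.map Sym.digit ++ [Sym.digit j])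
  | leaf (w : List ℕ) (j : ℕ) :
      InitialChild Δ ([Sym.digit 2, Sym.digit Δ] ++ w.map Sym.digit ++ [Sym.star])
        ([Sym.digit 1, Sym.star] ++ w.map Sym.digit ++ [Sym.digit j])

/-- The initial tree `T_2`, whose nodes are their labels. -/
def initialTree (Δ : ℕ) : LTree where
  V := {s : Str // InitialLabel Δ s}
  Child s t := InitialChild Δ s.1 t.1
  label s := s.1

/-- `treeSeq Δ n` is the tree `T_{n+2}`. -/
noncomputable def treeSeq (Δ : ℕ) : ℕ → LTree
  | 0 => initialTree Δ
  | n + 1 => (treeSeq Δ n).F Δ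

/-! ### The input tree -/

/-- A graph with node labels and marked nodes. All those considered below arise from the tree
`initialGraph` by reflections at leaves and by splits, and hence are trees. Port numbers are
left out, as neither labels, marks nor distances depend on them. -/
structure MarkedGraph where
  V : Type
  graph : SimpleGraph V
  label : V → Str
  marked : Set V

namespace MarkedGraph

/-- `u` and `v` are unmarked and lie in the same connected component of the subgraph induced by
the unmarked nodes. -/
def SameComp (G : MarkedGraph) (u v : G.V) : Prop :=
  ∃ (hu : u ∈ G.markedᶜ) (hv : v ∈ G.markedᶜ),
    (G.graph.induce G.markedᶜ).Reachable ⟨u, hu⟩ ⟨v, hv⟩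

def IsLeaf (G : MarkedGraph) (v : G.V) : Prop := (G.graph.neighborSet v).ncard = 1

def IsTwoLeaf (G : MarkedGraph) (v : G.V) : Prop :=
  G.IsLeaf v ∧ (G.label v)[0]? = some (Sym.digit 2)

/-- Reflection at `v`. Let `H_1` be the component of unmarked nodes that contains `v`. The nodes
`Sum.inl w` are those of `G`, and `Sum.inr (w, i)` is the copy of `w ∈ H_1 \ {v}` in `H_i`, for
`2 ≤ i ≤ Δ`; the copies of `v` are identified with `v`. -/
noncomputable def reflect (Δ : ℕ) (G : MarkedGraph) (v : G.V) : MarkedGraph where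
  V := G.V ⊕ ({w : G.V // G.SameComp v w ∧ w ≠ v} × {i : ℕ // 2 ≤ i ∧ i ≤ Δ})
  graph := SimpleGraph.fromRel fun x y =>
    match x, y with
    | Sum.inl a, Sum.inl c => G.graph.Adj a c
    | Sum.inl a, Sum.inr (c, _) => a = v ∧ G.graph.Adj v c.1
    | Sum.inr _, Sum.inl _ => False
    | Sum.inr (a, i), Sum.inr (c, k) => i = k ∧ G.graph.Adj a.1 c.1
  label x :=
    match x with
    | Sum.inl w =>
      if w = v then G.label w ++ [Sym.star]
      else if G.SameComp v w then G.label w ++ [Sym.digit 1]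
      else G.label w
    | Sum.inr (w, i) => G.label w.1 ++ [Sym.digit i.1]
  marked := Sum.inl '' G.marked

/-- Split at `v`. -/
def split (G : MarkedGraph) (v : G.V) : MarkedGraph :=
  { G with marked := insert v G.marked }

end MarkedGraph

/-- Two unmarked adjacent nodes with labels `1` and `2`. -/
def initialGraph : MarkedGraph where
  V := Bool
  graph := ⊤
  label x := if x then [Sym.digit 2] else [Sym.digit 1]
  marked := ∅

namespace LTree

variable (T : LTree)

/-- Perform in `G` the operation that the node `v` of `T` stands for, at the node of `G` whose
label is the label of `v`. -/
noncomputable def step (Δ : ℕ) (G : MarkedGraph) (v : T.V) : MarkedGraph :=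
  if h : ∃ x : G.V, G.label x = T.label v then
    if T.IsReflect v then G.reflect Δ h.choose else G.split h.choose
  else G

/-- The orderings of the nodes of `T` in which no node precedes one of its proper ancestors. -/
def IsOrdering (vs : List T.V) : Prop :=
  vs.Nodup ∧ (∀ v, v ∈ vs) ∧
    vs.Pairwise fun v w => T.Desc v w ∨ (¬ T.Desc v w ∧ ¬ T.Desc w v)

/-- The marked tree `G^{(i)}` obtained by processing the first `i` nodes of `vs`. -/
noncomputable def inputGraph (Δ : ℕ) (vs : List T.V) (i : ℕ) : MarkedGraph :=
  (vs.take i).foldl (T.step Δ) initialGraph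

/-- Each operation on the way to the input tree is well-defined: exactly one node carries the
required label, it is unmarked, and it is a leaf if a reflection takes place (a `2`-leaf, except
for the very first reflection). Below, `vs[i]` is the node `v^{(i+1)}`. -/
def ProcessWellDefined (Δ : ℕ) : Prop :=
  ∀ vs, T.IsOrdering vs → ∀ (i : ℕ) (hi : i < vs.length),
    ∃ x : (T.inputGraph Δ vs i).V,
      (T.inputGraph Δ vs i).label x = T.label vs[i] ∧
      (∀ y, (T.inputGraph Δ vs i).label y = T.label vs[i] → y = x) ∧
      x ∉ (T.inputGraph Δ vs i).marked ∧
      (T.IsReflect vs[i] → (T.inputGraph Δ vs i).IsLeaf x) ∧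
      (T.IsReflect vs[i] → 0 < i → (T.inputGraph Δ vs i).IsTwoLeaf x)

/-- Distance-`D`-correctness. -/
def DistanceCorrect (Δ D : ℕ) : Prop :=
  ∀ vs, T.IsOrdering vs → ∀ (i : ℕ) (hi : i < vs.length), T.IsSplit vs[i] →
    ∀ x : (T.inputGraph Δ vs i).V, (T.inputGraph Δ vs i).label x = T.label vs[i] →
      ∀ u, (T.inputGraph Δ vs i).IsTwoLeaf u → (T.inputGraph Δ vs i).SameComp x u →
        D ≤ (T.inputGraph Δ vs i).graph.dist x u

end LTree

end

end CTree

/-! ### Construction trees as layered data: ancestors, ranks of reflect layers, divergence of paths.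
-/

namespace CTree

open scoped Classical

/-! Components of unmarked nodes can be described by strings alone. Suppose a component has gone
through reflections at nodes labelled `w 0`, `w 1`, …. As long as the node that arose from `w j` is
unsplit (position `j` is open), a label has `w j` as a final substring exactly if its symbol number
`j + 1` is a star. Once that node has been split (position `j` is closed), the labels do not have `w
j` as a final substring, and symbol `j + 1` is the digit of the side on which the component lies.
This is `Gam`. Adjacency is `Compat`: the `0`-th symbols differ and all others agree up to stars. No
label has two stars, and the `2`-leaves are the star-free labels starting with `2`.

`process` shows by induction along any ordering that the component waiting for the tree node `t` is
the string graph `CompLabel t`. The invariant `Comp` also contains a fold of the whole graph onto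
the component, mapping adjacent nodes to equal or adjacent ones. So leaving the component never
shortens a walk, and distances can be measured on strings. The folds survive splits because closing
positions of a string graph is itself a fold (`exists_retraction`): all copies are laid upon one,
and the node to be removed, a leaf before it was reflected, is pushed onto its only neighbour.
Connectedness (`near_of_gam`) comes from the same folds. This yields the first claim, and it turns
distance-correctness into the statement `SplitFar` about paths of strings (`distanceCorrect_iff`).

For `F(T)`, the position of a string given by the early rank of a reflect node `u` belongs to `u`
(`mem_layerLabels`): it is free once `u` has been visited late, and the positions of the nodes above
the current one spell out the label of the latter. A node of a layer is thus a choice of digits in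
the free positions. Since early and late visits are nested like brackets, `F(T)` satisfies the tree
axioms. For clearing, a string is read as a list of instructions, namely which child to take at the
split node that matches `u`; following it leads to one reflect node of `T` (`exists_guided`).

The distance doubles (`splitFar_F`) for the following reason. Let `t` be a split node of `F(T)`,
belonging to the late visit of `v`, and let `x` be a `2`-leaf in its component. The instructions in
`x` lead to a reflect node `u`. If `u` had been visited before `t`, then `x` would contain a star or
would have been cut off. So `u` comes later, and the paths to `v` and `u` separate at a split node
`s` of `T`. Keeping only position `0` and the positions of the reflect nodes above `s` maps a path
from the label of `t` to `x` onto a path in the component of `s`, between two `2`-leaves on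
different sides of `s`. This path passes through `s`, and by assumption each half has length at
least `D`.

Distance `2` is automatic in every construction tree (`splitFar_two`), so it remains to check that
the initial tree is one. -/

/-- A construction tree, described by the depths of its nodes and the indices of its reflect
layers. -/
structure Layering (T : LTree) (b : ℕ) where
  M : ℕ
  dep : T.V → ℕ
  root : T.V
  R : ℕ → Prop
  φ : ℕ → ℕ
  rk : ℕ → ℕ
  rk_eq : ∀ i, rk i = Nat.count R i
  three_le : 3 ≤ b
  fin : Finite T.V
  dep_root : dep root = 1
  eq_root : ∀ v, dep v = 1 → v = root
  dep_pos : ∀ v, 1 ≤ dep v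
  dep_le : ∀ v, dep v ≤ M
  dep_child : ∀ v w, T.Child v w → dep w = dep v + 1
  parent : ∀ w, 1 < dep w → ∃ v, T.Child v w
  parent_unique : ∀ u v w, T.Child u w → T.Child v w → u = v
  reflect_child : ∀ v, R (dep v) → ∃ w, ∀ u, T.Child v u ↔ u = w
  R_pos : ∀ i, R i → 1 ≤ i
  R_lt : ∀ i, R i → i < M
  R_one : R 1
  φ_not : ∀ i, R i → ¬ R (φ i)
  φ_le : ∀ i, R i → φ i ≤ M
  φ_inj : ∀ i j, R i → R j → φ i = φ j → i = j
  φ_surj : ∀ s, 1 ≤ s → s ≤ M → ¬ R s → ∃ i, R i ∧ φ i = s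
  φ_one : φ 1 = M
  φ_lt : ∀ i, R i → i < φ i
  nested : ∀ i j, R i → R j → i < j → j < φ i → φ j < φ i
  mem_X : ∀ v, T.label v ∈ XStr b
  label_root : T.label root = [Sym.digit 1]
  len_R : ∀ v, R (dep v) → (T.label v).length = rk (dep v) + 1
  inj_R : ∀ v w, R (dep v) → R (dep w) → T.label v = T.label w → v = w
  no_star : ∀ v, R (dep v) → Sym.star ∉ T.label v
  indep : ∀ v w, R (dep v) → R (dep w) → T.label v <+: T.label w → v = w
  clear : ∀ x ∈ XStrMinus b, (∀ v, R (dep v) → (T.label v).length ≤ x.length) →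
    ∃ v, R (dep v) ∧ T.label v <+: x
  len_S : ∀ v, ¬ R (dep v) → (T.label v).length = rk (dep v) + 1
  star_S : ∀ v w i, R i → dep v = φ i → dep w = i → T.Desc w v →
    (T.label v)[rk i + 1]? = some Sym.star ∧ ∀ k < rk i + 1, (T.label v)[k]? = (T.label w)[k]?
  star_unique : ∀ v, ¬ R (dep v) → ∃! k : ℕ, (T.label v)[k]? = some Sym.star
  split_child : ∀ v i, R i → dep v = φ i → φ i < M →
    ∃ ρ : T.V → ℕ, Set.BijOn ρ {w | T.Child v w} (Set.Icc 1 b) ∧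
      ∀ w, T.Child v w → ∀ u, T.Desc w u → (T.label u)[rk i + 1]? = some (Sym.digit (ρ w))

namespace LTree

variable {T : LTree}

theorem Desc.eq_or_parent {u w : T.V} (h : T.Desc u w) : u = w ∨ ∃ p, T.Desc u p ∧ T.Child p w := by
  rcases Relation.ReflTransGen.cases_tail h with h | ⟨p, h1, h2⟩
  · exact Or.inl h.symm
  · exact Or.inr ⟨p, h1, h2⟩

theorem Desc.eq_or_child {u w : T.V} (h : T.Desc u w) : u = w ∨ ∃ c, T.Child u c ∧ T.Desc c w := by
  rcases Relation.ReflTransGen.cases_head h with h | ⟨p, h1, h2⟩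
  · exact Or.inl h
  · exact Or.inr ⟨p, h1, h2⟩

theorem Desc.refl (u : T.V) : T.Desc u u := Relation.ReflTransGen.refl

theorem Desc.trans {u v w : T.V} (h : T.Desc u v) (h' : T.Desc v w) : T.Desc u w :=
  Relation.ReflTransGen.trans h h'

theorem Desc.single {u v : T.V} (h : T.Child u v) : T.Desc u v :=
  Relation.ReflTransGen.single h

end LTree

open LTree

namespace Layering

variable {T : LTree} {b : ℕ} (L : Layering T b)

include L

theorem dep_le_of_desc {u v : T.V} (h : T.Desc u v) : L.dep u ≤ L.dep v := by
  induction h with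
  | refl => exact le_rfl
  | tail _ h ih => have := L.dep_child _ _ h; omega

theorem eq_of_desc {u v : T.V} (h : T.Desc u v) (hd : L.dep v ≤ L.dep u) : u = v := by
  rcases h.eq_or_parent with h | ⟨p, h1, h2⟩
  · exact h
  · have := L.dep_child _ _ h2
    have := L.dep_le_of_desc h1
    omega

/-- Parents are unique, so the ancestors of a node form a chain. -/
theorem desc_comparable {u u' v : T.V} (h : T.Desc u v) (h' : T.Desc u' v)
    (hd : L.dep u ≤ L.dep u') : T.Desc u u' := by
  induction h with
  | refl => rw [L.eq_of_desc h' hd]; exact .refl _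
  | @tail p w h1 h2 ih =>
    rcases h'.eq_or_parent with rfl | ⟨q, hq, hq'⟩
    · exact h1.trans (.single h2)
    · exact ih (L.parent_unique _ _ _ h2 hq' ▸ hq)

theorem anc_unique {u u' v : T.V} (h : T.Desc u v) (h' : T.Desc u' v)
    (hd : L.dep u = L.dep u') : u = u' :=
  L.eq_of_desc (L.desc_comparable h h' hd.le) hd.ge

theorem exists_anc (v : T.V) (i : ℕ) (h1 : 1 ≤ i) (h2 : i ≤ L.dep v) :
    ∃ u, T.Desc u v ∧ L.dep u = i := by
  induction hn : L.dep v - i generalizing v with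
  | zero => exact ⟨v, .refl _, by omega⟩
  | succ n ih =>
    obtain ⟨p, hp⟩ := L.parent v (by omega)
    have := L.dep_child _ _ hp
    obtain ⟨u, hu, hu'⟩ := ih p (by omega) (by omega)
    exact ⟨u, hu.trans (.single hp), hu'⟩

theorem desc_root (v : T.V) : T.Desc L.root v := by
  obtain ⟨u, hu, hu'⟩ := L.exists_anc v 1 le_rfl (L.dep_pos v)
  rwa [← L.eq_root u hu']

/-- The ancestor of `v` at depth `i`. -/
noncomputable def anc (v : T.V) (i : ℕ) : T.V :=
  if h : ∃ u, T.Desc u v ∧ L.dep u = i then h.choose else v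

theorem anc_spec (v : T.V) (i : ℕ) (h1 : 1 ≤ i) (h2 : i ≤ L.dep v) :
    T.Desc (L.anc v i) v ∧ L.dep (L.anc v i) = i := by
  have h := L.exists_anc v i h1 h2
  rw [anc, dif_pos h]
  exact h.choose_spec

theorem eq_anc {u v : T.V} (h : T.Desc u v) : L.anc v (L.dep u) = u := by
  have := L.anc_spec v (L.dep u) (L.dep_pos u) (L.dep_le_of_desc h)
  exact L.anc_unique this.1 h this.2

/-- `rk i` counts the reflect layers strictly above depth `i`. A reflect layer at depth `i`
therefore has number `rk i` when counting from `0`, and it owns symbol `rk i + 1` of the labels, as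
symbol `0` is the label in the initial edge. -/
theorem rk_mono {i j : ℕ} (h : i ≤ j) : L.rk i ≤ L.rk j := by
  rw [L.rk_eq, L.rk_eq]; exact Nat.count_monotone _ h

theorem rk_lt {i j : ℕ} (hi : L.R i) (h : i < j) : L.rk i < L.rk j := by
  rw [L.rk_eq, L.rk_eq]; exact Nat.count_strict_mono hi h

theorem rk_inj {i j : ℕ} (hi : L.R i) (hj : L.R j) (h : L.rk i = L.rk j) : i = j := by
  rw [L.rk_eq, L.rk_eq] at h; exact Nat.count_injective hi hj h

theorem lt_of_rk_lt {i j : ℕ} (h : L.rk i < L.rk j) : i < j := by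
  by_contra hh
  have := L.rk_mono (not_lt.1 hh)
  omega

theorem rk_succ_R {i : ℕ} (hi : L.R i) : L.rk (i + 1) = L.rk i + 1 := by
  rw [L.rk_eq, L.rk_eq, Nat.count_succ, if_pos hi]

theorem rk_succ_S {i : ℕ} (hi : ¬ L.R i) : L.rk (i + 1) = L.rk i := by
  rw [L.rk_eq, L.rk_eq, Nat.count_succ, if_neg hi, add_zero]

theorem rk_one : L.rk 1 = 0 := by
  rw [L.rk_eq, Nat.count_succ, Nat.count_zero, if_neg (fun h => by have := L.R_pos 0 h; omega)]

/-- The index of the reflect layer with number `j`, counted from `0`. -/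
noncomputable def nthR (_ : Layering T b) (j : ℕ) : ℕ := Nat.nth ‹Layering T b›.R j

omit L in
theorem nthR_rk (L : Layering T b) {i : ℕ} (hi : L.R i) : L.nthR (L.rk i) = i := by
  rw [L.rk_eq, nthR]; exact Nat.nth_count hi

theorem exists_rk_eq (n j : ℕ) (h : j < L.rk n) : ∃ i < n, L.R i ∧ L.rk i = j := by
  induction n with
  | zero => simp [L.rk_eq] at h
  | succ n ih =>
    by_cases hn : L.R n
    · rw [L.rk_succ_R hn] at h
      rcases Nat.lt_succ_iff_lt_or_eq.1 h with h | h
      · obtain ⟨i, hi, h⟩ := ih h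
        exact ⟨i, by omega, h⟩
      · exact ⟨n, by omega, hn, h.symm⟩
    · rw [L.rk_succ_S hn] at h
      obtain ⟨i, hi, h⟩ := ih h
      exact ⟨i, by omega, h⟩

theorem nthR_spec {n j : ℕ} (h : j < L.rk n) :
    L.nthR j < n ∧ L.R (L.nthR j) ∧ L.rk (L.nthR j) = j := by
  obtain ⟨i, h1, h2, rfl⟩ := L.exists_rk_eq n j h
  rw [L.nthR_rk h2]
  exact ⟨h1, h2, rfl⟩

theorem one_lt_M : 1 < L.M := L.R_lt 1 L.R_one

theorem dep_child_split (v : T.V) (i : ℕ) (hi : L.R i) (h : L.dep v = L.φ i) (h' : L.φ i < L.M) :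
    ∃ w, T.Child v w := by
  obtain ⟨ρ, h1, -⟩ := L.split_child v i hi h h'
  obtain ⟨w, hw, -⟩ := h1.surjOn (show 1 ∈ Set.Icc 1 b from ⟨le_rfl, by have := L.three_le; omega⟩)
  exact ⟨w, hw⟩

theorem exists_child (v : T.V) (h : L.dep v < L.M) : ∃ w, T.Child v w := by
  by_cases hv : L.R (L.dep v)
  · obtain ⟨w, hw⟩ := L.reflect_child v hv
    exact ⟨w, (hw w).2 rfl⟩
  · obtain ⟨i, hi, h1⟩ := L.φ_surj _ (L.dep_pos v) (L.dep_le v) hv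
    exact L.dep_child_split v i hi h1.symm (h1 ▸ h)

theorem exists_dep_eq (n : ℕ) (h1 : 1 ≤ n) (h2 : n ≤ L.M) : ∃ v, L.dep v = n := by
  induction n, h1 using Nat.le_induction with
  | base => exact ⟨L.root, L.dep_root⟩
  | succ n h ih =>
    obtain ⟨v, rfl⟩ := ih (by omega)
    obtain ⟨w, hw⟩ := L.exists_child v (by omega)
    exact ⟨w, L.dep_child _ _ hw⟩

theorem not_child_of_dep_eq {v w : T.V} (h : L.dep v = L.M) : ¬ T.Child v w := fun hw => by
  have := L.dep_child _ _ hw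
  have := L.dep_le w
  omega

/-- Below a child of a split node of depth `φ i`, all labels have the same digit at the index of
the reflect layer `i`. -/
theorem exists_digit {i : ℕ} (hi : L.R i) (c : T.V) (hc : L.dep c = L.φ i + 1) :
    ∃ d, 1 ≤ d ∧ d ≤ b ∧ ∀ u, T.Desc c u → (T.label u)[L.rk i + 1]? = some (Sym.digit d) := by
  have := L.φ_lt i hi
  obtain ⟨s, hs⟩ := L.parent c (by omega)
  have h1 := L.dep_child _ _ hs
  have h2 := L.dep_le c
  obtain ⟨ρ, hρ, h⟩ := L.split_child s i hi (by omega) (by omega)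
  have := hρ.mapsTo hs
  exact ⟨ρ c, this.1, this.2, h c hs⟩

theorem digit_injective {i : ℕ} (hi : L.R i) {s c c' : T.V} (hs : L.dep s = L.φ i)
    (hc : T.Child s c) (hc' : T.Child s c')
    (h : (T.label c)[L.rk i + 1]? = (T.label c')[L.rk i + 1]?) : c = c' := by
  have h1 := L.dep_child _ _ hc
  have h2 := L.dep_le c
  obtain ⟨ρ, hρ, h3⟩ := L.split_child s i hi hs (by omega)
  refine hρ.injOn hc hc' ?_
  rw [h3 c hc c (.refl _), h3 c' hc' c' (.refl _)] at h
  simpa using h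

theorem exists_digit_of_lt {i : ℕ} (hi : L.R i) (v : T.V) (h : L.φ i < L.dep v) :
    ∃ d, 1 ≤ d ∧ d ≤ b ∧ (T.label v)[L.rk i + 1]? = some (Sym.digit d) := by
  have := L.φ_lt i hi
  obtain ⟨c, hc, hc'⟩ := L.exists_anc v (L.φ i + 1) (by omega) h
  obtain ⟨d, h1, h2, h3⟩ := L.exists_digit hi c hc'
  exact ⟨d, h1, h2, h3 v hc⟩

/-- Both nodes lie below the same child of the split layer `φ i`, and that child fixes the digit for
its whole subtree. -/
theorem digit_eq_of_desc {i : ℕ} (hi : L.R i) {v w : T.V} (h : L.φ i < L.dep v) (hw : T.Desc v w) :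
    (T.label w)[L.rk i + 1]? = (T.label v)[L.rk i + 1]? := by
  have := L.φ_lt i hi
  obtain ⟨c, hc, hc'⟩ := L.exists_anc v (L.φ i + 1) (by omega) h
  obtain ⟨d, h1, h2, h3⟩ := L.exists_digit hi c hc'
  rw [h3 w (hc.trans hw), h3 v hc]

/-- Walk down from the root as long as the paths to `u` and `v` agree. Reflect nodes have a single
child, so the paths separate at a split node, whose children carry different digits. -/
theorem diverge {u v : T.V} (h : ¬ T.Desc u v) (h' : ¬ T.Desc v u) :
    ∃ i s, L.R i ∧ L.dep s = L.φ i ∧ T.Desc s u ∧ T.Desc s v ∧ L.φ i < L.dep u ∧ L.φ i < L.dep v ∧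
      (T.label u)[L.rk i + 1]? ≠ (T.label v)[L.rk i + 1]? := by
  -- Induction on the height difference `n` between `u` and a common ancestor `p`.
  have key : ∀ n, ∀ p, L.dep p + n = L.dep u → T.Desc p u → T.Desc p v →
      ∃ s c c', T.Child s c ∧ T.Child s c' ∧ c ≠ c' ∧ T.Desc c u ∧ T.Desc c' v := by
    intro n
    induction n with
    | zero =>
      intro p hp h1 h2
      exact absurd (L.eq_of_desc h1 (by omega) ▸ h2) h
    | succ n ih =>
      intro p hp h1 h2
      rcases h1.eq_or_child with rfl | ⟨c, hc, hcu⟩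
      · exact absurd h2 h
      rcases h2.eq_or_child with rfl | ⟨c', hc', hcv⟩
      · exact absurd h1 h'
      by_cases hcc : c = c'
      · subst hcc
        have := L.dep_child _ _ hc
        exact ih c (by omega) hcu hcv
      · exact ⟨p, c, c', hc, hc', hcc, hcu, hcv⟩
  have h0 := L.dep_le_of_desc (L.desc_root u)
  obtain ⟨s, c, c', hc, hc', hcc, hu, hv⟩ :=
    key (L.dep u - L.dep L.root) L.root (by omega) (L.desc_root u) (L.desc_root v)
  have hsR : ¬ L.R (L.dep s) := fun hR => by
    obtain ⟨w, hw⟩ := L.reflect_child s hR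
    exact hcc (((hw _).1 hc).trans ((hw _).1 hc').symm)
  obtain ⟨i, hi, his⟩ := L.φ_surj _ (L.dep_pos s) (L.dep_le s) hsR
  have h1 := L.dep_child _ _ hc
  have h2 := L.dep_child _ _ hc'
  have h3 := L.dep_le_of_desc hu
  have h4 := L.dep_le_of_desc hv
  refine ⟨i, s, hi, his.symm, (Desc.single hc).trans hu, (Desc.single hc').trans hv, by omega,
    by omega, fun hh => hcc (L.digit_injective hi his.symm hc hc' ?_)⟩
  rw [← L.digit_eq_of_desc hi (by omega) hu, ← L.digit_eq_of_desc hi (by omega) hv, hh]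

theorem len_label (v : T.V) : (T.label v).length = L.rk (L.dep v) + 1 := by
  by_cases h : L.R (L.dep v)
  · exact L.len_R v h
  · exact L.len_S v h

end Layering

end CTree

/-! ### Passing between construction trees and layerings. -/

namespace CTree

open scoped Classical
open LTree

theorem ncard_lt_eq_count (p : ℕ → Prop) (n : ℕ) : {k | p k ∧ k < n}.ncard = Nat.count p n := by
  rw [Nat.count_eq_card_filter_range, ← Set.ncard_coe_finset]
  congr 1
  ext k
  simp [and_comm]

theorem ncard_le_eq_count (p : ℕ → Prop) (n : ℕ) :
    {k | p k ∧ k ≤ n}.ncard = Nat.count p (n + 1) := by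
  rw [← ncard_lt_eq_count]
  simp only [Nat.lt_succ_iff]

namespace LTree

variable {T : LTree} {b : ℕ}

theorem mem_layer_one {v : T.V} : v ∈ T.layer 1 ↔ T.IsRoot v := Iff.rfl

theorem mem_layer_succ {n : ℕ} {v : T.V} :
    v ∈ T.layer (n + 2) ↔ ∃ u ∈ T.layer (n + 1), T.Child u v := Iff.rfl

theorem layer_disjoint (hT : T.IsRootedTree) {i j : ℕ} {v : T.V} (hi : v ∈ T.layer i)
    (hj : v ∈ T.layer j) : i = j := by
  induction i generalizing j v with
  | zero => exact hi.elim
  | succ i ih =>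
    rcases i with _ | i
    · rcases j with _ | _ | j
      · exact hj.elim
      · rfl
      · obtain ⟨u, -, hu⟩ := hj
        exact absurd hu (hi u)
    · obtain ⟨u, hu, huv⟩ := hi
      rcases j with _ | _ | j
      · exact hj.elim
      · exact absurd huv (hj u)
      · obtain ⟨u', hu', huv'⟩ := hj
        have := hT.2.2 _ _ _ huv huv'
        subst this
        have := ih hu hu'
        omega

theorem exists_layer (hT : T.IsRootedTree) (v : T.V) : ∃ n, v ∈ T.layer n := by
  obtain ⟨r, hr, h⟩ := hT.2.1
  have := h v
  induction this with
  | refl => exact ⟨1, hr⟩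
  | @tail u w _ huw ih =>
    obtain ⟨n, hn⟩ := ih
    rcases n with _ | n
    · exact hn.elim
    · exact ⟨n + 2, u, hn, huw⟩

theorem layer_nonempty_of_le {n k : ℕ} (hk : 1 ≤ k) (h : k ≤ n) (hn : (T.layer n).Nonempty) :
    (T.layer k).Nonempty := by
  induction n, h using Nat.le_induction with
  | base => exact hn
  | succ n hkn ih =>
    obtain ⟨m, rfl⟩ : ∃ m, n = m + 1 := ⟨n - 1, by omega⟩
    obtain ⟨v, u, hu, -⟩ := hn
    exact ih ⟨u, hu⟩

theorem isReflect_of_layer (hb : T.IsBalanced b) {i : ℕ} {v w : T.V} (hv : v ∈ T.layer i)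
    (hw : w ∈ T.layer i) (h : T.IsReflect v) : T.IsReflect w := (hb.2.2 i w hw v hv).trans h

theorem no_child_of_numChildren [Finite T.V] {v : T.V} (h : T.numChildren v = 0) (w : T.V) :
    ¬ T.Child v w := fun hw => by
  rw [numChildren, Set.ncard_eq_zero (Set.toFinite _)] at h
  exact (h ▸ hw : w ∈ (∅ : Set T.V)).elim

theorem layer_le_leafLayer (hT : T.IsRootedTree) {m n : ℕ} (hm : T.IsLeafLayer m)
    (hn : (T.layer n).Nonempty) : n ≤ m := by
  by_contra hlt
  have := hT.1
  obtain ⟨k, rfl⟩ : ∃ k, m = k + 1 := by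
    rcases m with _ | k
    · exact hm.1.some_mem.elim
    · exact ⟨k, rfl⟩
  obtain ⟨v, u, hu, huv⟩ := layer_nonempty_of_le (k := k + 2) (by omega) (by omega) hn
  exact no_child_of_numChildren (hm.2 u hu) v huv

/-- Together with `Layering.isConstructionTree` this makes the two descriptions interchangeable. The
labelling axioms count reflect layers from `1`, which produces the `+ 1` after each count. -/
theorem IsConstructionTree.exists_layering (hT : T.IsConstructionTree b) :
    Nonempty (Layering T b) := by
  obtain ⟨hR, hB, ⟨m, hm, -, h1, hmS, φ, hφ⟩, hS⟩ := hT
  have hfin := hR.1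
  choose dep hdep using exists_layer hR
  have hdep' : ∀ {v n}, v ∈ T.layer n → dep v = n := fun h => layer_disjoint hR (hdep _) h
  obtain ⟨r, hr, hrd⟩ := hR.2.1
  have hpos : ∀ v, 1 ≤ dep v := fun v => by
    by_contra h
    have h0 : dep v = 0 := by omega
    have := hdep v
    rw [h0] at this
    exact this
  have hroot : ∀ v, T.IsRoot v → v = r := fun v hv => by
    rcases (hrd v).eq_or_parent with h | ⟨p, -, hp⟩
    · exact h.symm
    · exact absurd hp (hv p)
  have hchild : ∀ v w, T.Child v w → dep w = dep v + 1 := fun v w h => by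
    obtain ⟨n, hn⟩ : ∃ n, dep v = n + 1 := ⟨dep v - 1, by have := hpos v; omega⟩
    have := hdep v
    rw [hn] at this ⊢
    exact hdep' ⟨v, this, h⟩
  have hle : ∀ v, dep v ≤ m := fun v => layer_le_leafLayer hR hm ⟨v, hdep v⟩
  have hRe : ∀ v, dep v ∈ T.reflectLayers ↔ T.IsReflect v := fun v =>
    ⟨fun h => h.2 v (hdep v), fun h =>
      ⟨⟨v, hdep v⟩, fun w hw => isReflect_of_layer hB (hdep v) hw h⟩⟩
  have hSR : ∀ i, i ∈ T.splitLayers → i ∉ T.reflectLayers := fun i hi hi' =>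
    hi.2 _ hi.1.some_mem (hi'.2 _ hi.1.some_mem)
  have hSm : ∀ i, i ∈ T.splitLayers → i ≤ m := fun i hi => layer_le_leafLayer hR hm hi.1
  have hidx : ∀ i, T.reflectIndex i = Nat.count (· ∈ T.reflectLayers) (i + 1) := fun i =>
    ncard_le_eq_count _ _
  have hidx' : ∀ i ∈ T.reflectLayers, T.reflectIndex i =
      Nat.count (· ∈ T.reflectLayers) i + 1 := fun i hi => by
    rw [hidx, Nat.count_succ, if_pos hi]
  refine ⟨⟨m, dep, r, (· ∈ T.reflectLayers), φ, Nat.count (· ∈ T.reflectLayers), fun _ => rfl,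
    hB.1, hR.1, hdep' hr, ?_, hpos, hle, hchild, ?_, hR.2.2, ?_, ?_, ?_, h1, ?_, ?_, ?_, ?_,
    hφ.first, hφ.lt, ?_, hS.mem_X, hS.root r hr, ?_, ?_, ?_, ?_, ?_, ?_, ?_, ?_, ?_⟩⟩
  · intro v hv
    have := hdep v
    rw [hv] at this
    exact hroot v this
  · intro w hw
    obtain ⟨n, hn⟩ : ∃ n, dep w = n + 2 := ⟨dep w - 2, by omega⟩
    have := hdep w
    rw [hn] at this
    obtain ⟨u, -, hu⟩ := this
    exact ⟨u, hu⟩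
  · intro v hv
    have h2 : T.numChildren v = 1 := (hRe v).1 hv
    obtain ⟨w, hw⟩ := Set.ncard_eq_one.1 h2
    exact ⟨w, fun u => by
      have : u ∈ {w | T.Child v w} ↔ u = w := by rw [hw]; rfl
      exact this⟩
  · intro i hi
    obtain ⟨v, hv⟩ := hi.1
    rw [← hdep' hv]
    exact hpos v
  · intro i hi
    exact (hφ.lt i hi).trans_le (hSm _ (hφ.bijOn.mapsTo hi))
  · exact fun i hi => hSR _ (hφ.bijOn.mapsTo hi)
  · exact fun i hi => hSm _ (hφ.bijOn.mapsTo hi)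
  · exact fun i j hi hj h => hφ.bijOn.injOn hi hj h
  · intro s hs1 hsm hs
    have hne := layer_nonempty_of_le hs1 hsm hm.1
    have : s ∈ T.splitLayers := ⟨hne, fun v hv hvr => hs ⟨hne, fun w hw =>
      isReflect_of_layer hB hv hw hvr⟩⟩
    exact hφ.bijOn.surjOn this
  · exact fun i j hi hj => hφ.nested i hi j hj
  · intro v hv
    rw [hS.reflect_length _ v ⟨dep v, hv, rfl, hdep v⟩, hidx' _ hv]
  · intro v w hv hw h
    by_contra hne
    exact hS.reflect_injective v w ((hRe v).1 hv) ((hRe w).1 hw) hne h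
  · exact fun v hv => (hS.reflect_no_star v ((hRe v).1 hv)).2
  · intro v w hv hw h
    by_contra hne
    exact (hS.independent _ ⟨v, (hRe v).1 hv, rfl⟩ _ ⟨w, (hRe w).1 hw, rfl⟩
      (hS.reflect_injective v w ((hRe v).1 hv) ((hRe w).1 hw) hne)).1 h
  · intro x hx h
    obtain ⟨y, ⟨v, hv, rfl⟩, hy⟩ := hS.clearing x hx (by
      rintro y ⟨v, hv, rfl⟩
      exact h v ((hRe v).2 hv))
    exact ⟨v, (hRe v).2 hv, hy⟩
  · intro v hv
    rw [hS.split_length _ v (hdep v) (fun h => hv ((hRe v).2 h)), ncard_lt_eq_count]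
  · intro v w i hi hv hw hd
    have h2 := hidx' i hi
    rw [← h2]
    refine hS.split_star v (fun h => hSR _ (hφ.bijOn.mapsTo hi) (hv ▸ (hRe v).2 h)) _
      ⟨m, φ, hm, hφ, i, hi, rfl, hv ▸ hdep v⟩ w ⟨i, hi, rfl, hw ▸ hdep w⟩ hd
  · exact fun v hv => hS.split_star_unique v (fun h => hv ((hRe v).2 h))
  · intro v i hi hv hlt
    have hs : T.IsSplit v := fun h => hSR _ (hφ.bijOn.mapsTo hi) (hv ▸ (hRe v).2 h)
    have h2 := hidx' i hi
    rw [← h2]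
    refine hS.split_children v ⟨hs, ?_⟩ _ ⟨m, φ, hm, hφ, i, hi, rfl, hv ▸ hdep v⟩
    -- A childless `v` above the last layer is impossible: some node in its layer has a child, and
    -- nodes in a layer have equally many children.
    rcases hB.2.1 v with h | h | h
    · exfalso
      obtain ⟨k, hk⟩ : ∃ k, dep v = k + 1 := ⟨dep v - 1, by have := hpos v; omega⟩
      obtain ⟨w, u, hu, huw⟩ := layer_nonempty_of_le (k := k + 2) (by omega) (by omega) hm.1
      rw [← hk] at hu
      exact no_child_of_numChildren ((hB.2.2 _ u hu v (hdep v)).trans h) w huw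
    · exact absurd h hs
    · exact h

end LTree

namespace Layering

variable {T : LTree} {b : ℕ} (L : Layering T b)

include L

theorem isRoot_iff {v : T.V} : T.IsRoot v ↔ v = L.root := by
  constructor
  · intro h
    by_contra hne
    obtain ⟨p, hp⟩ := L.parent v (by
      have := L.dep_pos v
      have : L.dep v ≠ 1 := fun h => hne (L.eq_root v h)
      omega)
    exact h p hp
  · rintro rfl v hv
    have := L.dep_child _ _ hv
    have := L.dep_pos v
    have := L.dep_root
    omega

theorem mem_layer_iff {n : ℕ} {v : T.V} : v ∈ T.layer n ↔ L.dep v = n := by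
  induction n generalizing v with
  | zero => exact ⟨fun h => h.elim, fun h => by have := L.dep_pos v; omega⟩
  | succ n ih =>
    rcases n with _ | n
    · rw [zero_add, mem_layer_one, L.isRoot_iff]
      exact ⟨fun h => h ▸ L.dep_root, L.eq_root v⟩
    · rw [mem_layer_succ]
      constructor
      · rintro ⟨u, hu, huv⟩
        rw [L.dep_child _ _ huv, ih.1 hu]
      · intro h
        obtain ⟨p, hp⟩ := L.parent v (by omega)
        have := L.dep_child _ _ hp
        exact ⟨p, ih.2 (by omega), hp⟩

theorem numChildren_R {v : T.V} (h : L.R (L.dep v)) : T.numChildren v = 1 := by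
  obtain ⟨w, hw⟩ := L.reflect_child v h
  exact Set.ncard_eq_one.2 ⟨w, Set.ext hw⟩

theorem numChildren_S {v : T.V} (h : ¬ L.R (L.dep v)) (h' : L.dep v < L.M) :
    T.numChildren v = b := by
  obtain ⟨i, hi, his⟩ := L.φ_surj _ (L.dep_pos v) (L.dep_le v) h
  obtain ⟨ρ, hρ, -⟩ := L.split_child v i hi his.symm (by omega)
  rw [numChildren, ← hρ.injOn.ncard_image, hρ.image_eq,
    ← Finset.coe_Icc, Set.ncard_coe_finset]
  simp

theorem numChildren_M {v : T.V} (h : L.dep v = L.M) : T.numChildren v = 0 := by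
  have : {w | T.Child v w} = ∅ := Set.eq_empty_of_forall_notMem fun w => L.not_child_of_dep_eq h
  rw [numChildren, this, Set.ncard_empty]

theorem isReflect_iff {v : T.V} : T.IsReflect v ↔ L.R (L.dep v) := by
  refine ⟨fun h => ?_, L.numChildren_R⟩
  by_contra hv
  rcases (L.dep_le v).lt_or_eq with h1 | h1
  · have h2 := L.numChildren_S hv h1
    have h3 : T.numChildren v = 1 := h
    have := L.three_le
    omega
  · have h2 := L.numChildren_M h1
    have h3 : T.numChildren v = 1 := h
    omega

theorem layer_nonempty_iff {n : ℕ} : (T.layer n).Nonempty ↔ 1 ≤ n ∧ n ≤ L.M := by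
  constructor
  · rintro ⟨v, hv⟩
    rw [← L.mem_layer_iff.1 hv]
    exact ⟨L.dep_pos v, L.dep_le v⟩
  · rintro ⟨h1, h2⟩
    obtain ⟨v, hv⟩ := L.exists_dep_eq n h1 h2
    exact ⟨v, L.mem_layer_iff.2 hv⟩

theorem mem_reflectLayers {i : ℕ} : i ∈ T.reflectLayers ↔ L.R i := by
  constructor
  · rintro ⟨⟨v, hv⟩, h⟩
    rw [← L.mem_layer_iff.1 hv]
    exact L.isReflect_iff.1 (h v hv)
  · intro h
    refine ⟨L.layer_nonempty_iff.2 ⟨L.R_pos i h, (L.R_lt i h).le⟩, fun v hv => ?_⟩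
    rw [L.isReflect_iff, L.mem_layer_iff.1 hv]
    exact h

theorem mem_splitLayers {i : ℕ} : i ∈ T.splitLayers ↔ 1 ≤ i ∧ i ≤ L.M ∧ ¬ L.R i := by
  constructor
  · rintro ⟨h1, h⟩
    have h2 := L.layer_nonempty_iff.1 h1
    obtain ⟨v, hv⟩ := h1
    refine ⟨h2.1, h2.2, ?_⟩
    rw [← L.mem_layer_iff.1 hv]
    exact fun hh => h v hv (L.isReflect_iff.2 hh)
  · rintro ⟨h1, h2, h⟩
    refine ⟨L.layer_nonempty_iff.2 ⟨h1, h2⟩, fun v hv hh => ?_⟩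
    rw [L.isReflect_iff, L.mem_layer_iff.1 hv] at hh
    exact h hh

theorem isLeafLayer_iff {m : ℕ} : T.IsLeafLayer m ↔ m = L.M := by
  constructor
  · rintro ⟨⟨v, hv⟩, h⟩
    have h1 : T.numChildren v = 0 := h v hv
    rw [← L.mem_layer_iff.1 hv]
    by_contra hne
    have hlt := (L.dep_le v).lt_of_ne hne
    by_cases hR : L.R (L.dep v)
    · have := L.numChildren_R hR
      omega
    · have := L.numChildren_S hR hlt
      have := L.three_le
      omega
  · rintro rfl
    exact ⟨L.layer_nonempty_iff.2 ⟨L.one_lt_M.le, le_rfl⟩, fun v hv =>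
      L.numChildren_M (L.mem_layer_iff.1 hv)⟩

theorem isNesting : T.IsNesting L.M L.φ where
  bijOn := by
    refine ⟨fun i hi => ?_, fun i hi j hj h => ?_, fun s hs => ?_⟩
    · have hi := L.mem_reflectLayers.1 hi
      have := L.φ_lt i hi
      exact L.mem_splitLayers.2 ⟨by omega, L.φ_le i hi, L.φ_not i hi⟩
    · exact L.φ_inj i j (L.mem_reflectLayers.1 hi) (L.mem_reflectLayers.1 hj) h
    · obtain ⟨h1, h2, h3⟩ := L.mem_splitLayers.1 hs
      obtain ⟨i, hi, h⟩ := L.φ_surj s h1 h2 h3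
      exact ⟨i, L.mem_reflectLayers.2 hi, h⟩
  first := L.φ_one
  lt i hi := L.φ_lt i (L.mem_reflectLayers.1 hi)
  nested i hi j hj := L.nested i j (L.mem_reflectLayers.1 hi) (L.mem_reflectLayers.1 hj)

/-- Needed since `InSplitLayer` quantifies over all nestings. Go from the bottom up. If `f i > g i`
for two nestings that agree below `i`, then the layer `g i` equals `f k` for some `k`. Here `k < i`
violates nestedness of `f`, and `k > i` gives `g k = g i`, against injectivity. -/
theorem nesting_unique {m : ℕ} {ψ : ℕ → ℕ} (hψ : T.IsNesting m ψ) :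
    ∀ i, L.R i → ψ i = L.φ i := by
  have hφ := L.isNesting
  have key : ∀ {m m' : ℕ} {f g : ℕ → ℕ}, T.IsNesting m f → T.IsNesting m' g → ∀ i, L.R i →
      (∀ j, L.R j → i < j → f j = g j) → f i ≤ g i := by
    intro m m' f g hf hg i hi h
    have hi := L.mem_reflectLayers.2 hi
    by_contra hlt
    obtain ⟨k, hk, hki⟩ := hf.bijOn.surjOn (hg.bijOn.mapsTo hi)
    have h1 := hg.lt i hi
    rcases lt_trichotomy k i with hlt' | rfl | hlt'
    · have := hf.nested k hk i hi hlt' (by omega)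
      omega
    · omega
    · have := h k (L.mem_reflectLayers.1 hk) hlt'
      have := hg.bijOn.injOn hk hi (by omega)
      omega
  intro i
  induction hn : L.M - i using Nat.strong_induction_on generalizing i with
  | _ n ih =>
    intro hi
    have h : ∀ j, L.R j → i < j → ψ j = L.φ j := fun j hj hij =>
      ih (L.M - j) (by have := L.R_lt j hj; omega) j rfl hj
    exact le_antisymm (key hψ hφ i hi h) (key hφ hψ i hi fun j hj hij => (h j hj hij).symm)

theorem reflectIndex_eq {i : ℕ} (hi : L.R i) : T.reflectIndex i = L.rk i + 1 := by
  rw [← L.rk_succ_R hi, L.rk_eq, reflectIndex, ← ncard_le_eq_count]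
  simp only [L.mem_reflectLayers]

theorem inReflectLayer_iff {j : ℕ} {v : T.V} :
    T.InReflectLayer j v ↔ L.R (L.dep v) ∧ j = L.rk (L.dep v) + 1 := by
  constructor
  · rintro ⟨i, hi, rfl, hv⟩
    have hv := L.mem_layer_iff.1 hv
    have hi := L.mem_reflectLayers.1 hi
    rw [hv, L.reflectIndex_eq hi]
    exact ⟨hi, rfl⟩
  · rintro ⟨h, rfl⟩
    exact ⟨_, L.mem_reflectLayers.2 h, L.reflectIndex_eq h, L.mem_layer_iff.2 rfl⟩

theorem inSplitLayer_iff {j : ℕ} {v : T.V} :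
    T.InSplitLayer j v ↔ ∃ i, L.R i ∧ L.dep v = L.φ i ∧ j = L.rk i + 1 := by
  constructor
  · rintro ⟨m, ψ, -, hψ, i, hi, rfl, hv⟩
    have hi := L.mem_reflectLayers.1 hi
    rw [L.nesting_unique hψ i hi] at hv
    exact ⟨i, hi, L.mem_layer_iff.1 hv, L.reflectIndex_eq hi⟩
  · rintro ⟨i, hi, h, rfl⟩
    exact ⟨L.M, L.φ, L.isLeafLayer_iff.2 rfl, L.isNesting, i, L.mem_reflectLayers.2 hi,
      L.reflectIndex_eq hi, L.mem_layer_iff.2 h⟩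

theorem isConstructionTree : T.IsConstructionTree b := by
  refine ⟨⟨L.fin, ⟨L.root, L.isRoot_iff.2 rfl, L.desc_root⟩, L.parent_unique⟩,
    ⟨L.three_le, fun v => ?_, fun i v hv w hw => ?_⟩,
    ⟨L.M, L.isLeafLayer_iff.2 rfl, ?_, L.mem_reflectLayers.2 L.R_one, ?_, L.φ, L.isNesting⟩, ?_⟩
  · rcases (L.dep_le v).lt_or_eq with h | h
    · by_cases hR : L.R (L.dep v)
      · exact Or.inr (Or.inl (L.numChildren_R hR))
      · exact Or.inr (Or.inr (L.numChildren_S hR h))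
    · exact Or.inl (L.numChildren_M h)
  · have hv := L.mem_layer_iff.1 hv
    have hw := L.mem_layer_iff.1 hw
    rcases (L.dep_le v).lt_or_eq with h | h
    · by_cases hR : L.R (L.dep v)
      · rw [L.numChildren_R hR, L.numChildren_R (by rwa [hw, ← hv])]
      · rw [L.numChildren_S hR h, L.numChildren_S (by rwa [hw, ← hv]) (by omega)]
    · rw [L.numChildren_M h, L.numChildren_M (by omega)]
  · have := L.isNesting.bijOn
    rw [← this.image_eq, this.injOn.ncard_image]
  · refine L.mem_splitLayers.2 ⟨L.one_lt_M.le, le_rfl, fun h => ?_⟩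
    have := L.R_lt _ h
    omega
  · constructor
    · exact L.mem_X
    · intro r hr
      rw [L.isRoot_iff.1 hr, L.label_root]
    · intro i v h
      obtain ⟨h', rfl⟩ := L.inReflectLayer_iff.1 h
      exact L.len_R v h'
    · intro v w hv hw hne h
      exact hne (L.inj_R v w (L.isReflect_iff.1 hv) (L.isReflect_iff.1 hw) h)
    · exact fun v hv => ⟨L.mem_X v, L.no_star v (L.isReflect_iff.1 hv)⟩
    · rintro _ ⟨v, hv, rfl⟩ _ ⟨w, hw, rfl⟩ hne
      have hv := L.isReflect_iff.1 hv
      have hw := L.isReflect_iff.1 hw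
      exact ⟨fun h => hne (by rw [L.indep v w hv hw h]), fun h => hne (by rw [L.indep w v hw hv h])⟩
    · intro x hx h
      obtain ⟨v, hv, hvx⟩ := L.clear x hx fun v hv => h _ ⟨v, L.isReflect_iff.2 hv, rfl⟩
      exact ⟨_, ⟨v, L.isReflect_iff.2 hv, rfl⟩, hvx⟩
    · intro i v hv hs
      have hv := L.mem_layer_iff.1 hv
      rw [L.len_label v, hv, L.rk_eq, ← ncard_lt_eq_count]
      simp only [L.mem_reflectLayers]
    · intro v hv i hi w hw hd
      obtain ⟨k, hk, hvk, rfl⟩ := L.inSplitLayer_iff.1 hi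
      obtain ⟨hw, h⟩ := L.inReflectLayer_iff.1 hw
      have := L.rk_inj hk hw (by omega)
      exact L.star_S v w k hk hvk this.symm hd
    · exact fun v hv => L.star_unique v fun h => hv (L.isReflect_iff.2 h)
    · intro v hv i hi
      obtain ⟨k, hk, hvk, rfl⟩ := L.inSplitLayer_iff.1 hi
      refine L.split_child v k hk hvk ((L.φ_le k hk).lt_of_ne fun h => ?_)
      have h1 := L.numChildren_M (hvk.trans h)
      have h2 := hv.2
      have := L.three_le
      omega

end Layering

end CTree

namespace CTree

open scoped Classical

/-! ### The components of unmarked nodes as graphs on strings -/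

theorem prefix_iff_forall {w x : Str} :
    w <+: x ↔ ∀ k < w.length, x[k]? = w[k]? := by
  rw [List.prefix_iff_getElem?]
  exact forall₂_congr fun k hk => by rw [List.getElem?_eq_getElem hk]

theorem mem_XStr_iff {b : ℕ} {x : Str} :
    x ∈ XStr b ↔ (x[0]? = some (Sym.digit 1) ∨ x[0]? = some (Sym.digit 2)) ∧
      ∀ j c, x[j + 1]? = some c → c = Sym.star ∨ ∃ d, 1 ≤ d ∧ d ≤ b ∧ c = Sym.digit d := by
  refine and_congr_right fun _ => ⟨fun h j c hc => h c ?_, fun h c hc => ?_⟩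
  · refine List.mem_iff_getElem?.2 ⟨j, ?_⟩
    rw [List.getElem?_tail, hc]
  · obtain ⟨j, hj⟩ := List.mem_iff_getElem?.1 hc
    rw [List.getElem?_tail] at hj
    exact h j c hj

theorem star_notMem_iff {x : Str} : Sym.star ∉ x ↔ ∀ j : ℕ, x[j]? ≠ some Sym.star := by
  rw [List.mem_iff_getElem?]
  push Not
  rfl

theorem exists_digit_of_mem_XStr {b : ℕ} {x : Str} (hx : x ∈ XStr b) {j : ℕ}
    (hj : j + 1 < x.length) (hs : x[j + 1]? ≠ some Sym.star) :
    ∃ d, 1 ≤ d ∧ d ≤ b ∧ x[j + 1]? = some (Sym.digit d) := by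
  have h := List.getElem?_eq_getElem hj
  rcases (mem_XStr_iff.1 hx).2 j _ h with h' | ⟨d, h1, h2, h'⟩
  · exact absurd (h.trans (congrArg some h')) hs
  · exact ⟨d, h1, h2, h.trans (congrArg some h')⟩

/-- The labels of two adjacent nodes of a component of unmarked nodes are compatible. -/
def Compat (x y : Str) : Prop :=
  x[0]? ≠ y[0]? ∧ ∀ j : ℕ, x[j + 1]? = y[j + 1]? ∨ x[j + 1]? = some Sym.star ∨
    y[j + 1]? = some Sym.star

theorem Compat.symm {x y : Str} (h : Compat x y) : Compat y x :=
  ⟨h.1.symm, fun j => by rcases h.2 j with h | h | h <;> simp [h]⟩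

/-- The basis of all inductions over the number of reflections. Equal lengths make the conditions
beyond the end vacuous, and nonemptiness keeps the new symbol away from position `0`, where the
condition is a different one. -/
theorem compat_concat {x y : Str} (hxy : x.length = y.length) (hx : x ≠ []) {s t : Sym} :
    Compat (x ++ [s]) (y ++ [t]) ↔ Compat x y ∧ (s = t ∨ s = Sym.star ∨ t = Sym.star) := by
  have hpos : 0 < x.length := List.length_pos_iff.2 hx
  have hlt : ∀ j, j < x.length → (x ++ [s])[j]? = x[j]? ∧ (y ++ [t])[j]? = y[j]? := fun j hj =>
    ⟨List.getElem?_append_left hj, List.getElem?_append_left (hxy ▸ hj)⟩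
  have heq : (x ++ [s])[x.length]? = some s ∧ (y ++ [t])[x.length]? = some t := by
    refine ⟨List.getElem?_concat_length, ?_⟩
    rw [hxy]; exact List.getElem?_concat_length
  have hgt : ∀ j, x.length < j → (x ++ [s])[j]? = none ∧ (y ++ [t])[j]? = none ∧ x[j]? = none ∧
      y[j]? = none := fun j hj => by
    refine ⟨?_, ?_, ?_, ?_⟩ <;> apply List.getElem?_eq_none <;> (try simp) <;> omega
  obtain ⟨n, hn⟩ : ∃ n, x.length = n + 1 := ⟨x.length - 1, by omega⟩
  unfold Compat
  rw [(hlt 0 hpos).1, (hlt 0 hpos).2, and_assoc]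
  refine and_congr_right fun _ => ⟨fun h => ⟨fun j => ?_, ?_⟩, fun h j => ?_⟩
  · rcases lt_or_ge (j + 1) x.length with hj | hj
    · have := h j
      rwa [(hlt _ hj).1, (hlt _ hj).2] at this
    · refine Or.inl ?_
      rw [List.getElem?_eq_none hj, List.getElem?_eq_none (hxy ▸ hj)]
  · have := h n
    rw [← hn, heq.1, heq.2] at this
    simpa using this
  · rcases lt_trichotomy (j + 1) x.length with hj | hj | hj
    · rw [(hlt _ hj).1, (hlt _ hj).2]
      exact h.1 j
    · rw [hj, heq.1, heq.2]
      simpa using h.2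
    · rw [(hgt _ hj).1, (hgt _ hj).2.1]
      exact Or.inl rfl

/-- `Near P n x y`: one can get from `x` to `y` in at most `n` steps between compatible strings
satisfying `P`. -/
inductive Near (P : Str → Prop) : ℕ → Str → Str → Prop
  | refl {x : Str} : P x → Near P 0 x x
  | step {n : ℕ} {x z y : Str} : P x → (x = z ∨ Compat x z) → Near P n z y → Near P (n + 1) x y

namespace Near

variable {P P' : Str → Prop} {n m : ℕ} {x y z : Str}

theorem left (h : Near P n x y) : P x := by cases h <;> assumption

theorem right (h : Near P n x y) : P y := by induction h <;> assumption

theorem trans (h : Near P n x y) (h' : Near P m y z) : Near P (n + m) x z := by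
  induction h with
  | refl => simpa using h'
  | @step n x u y hx hu _ ih =>
    rw [Nat.add_right_comm]
    exact .step hx hu (ih h')

theorem symm (h : Near P n x y) : Near P n y x := by
  induction h with
  | refl h => exact .refl h
  | @step n x u y hx hu h ih =>
    exact ih.trans (.step h.left (hu.imp Eq.symm Compat.symm) (.refl hx))

theorem map {f : Str → Str} (hf : ∀ x, P x → P' (f x))
    (hf' : ∀ x y, P x → P y → Compat x y → f x = f y ∨ Compat (f x) (f y)) (h : Near P n x y) :
    Near P' n (f x) (f y) := by
  induction h with
  | refl h => exact .refl (hf _ h)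
  | @step n x u y hx hu h ih =>
    refine .step (hf _ hx) ?_ ih
    rcases hu with rfl | hu
    · exact Or.inl rfl
    · exact hf' _ _ hx h.left hu

/-- A step changes symbol `k + 1` only if one of its ends has a star there. This is where the factor
two in the distances comes from. -/
theorem crossing (h : Near P n x y) (k : ℕ) (hk : x[k + 1]? ≠ y[k + 1]?) :
    ∃ z m l, z[k + 1]? = some Sym.star ∧ Near P m x z ∧ Near P l z y ∧ m + l = n := by
  induction h with
  | refl => exact absurd rfl hk
  | @step n x u y hx hu h ih =>
    by_cases hs : x[k + 1]? = some Sym.star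
    · exact ⟨x, 0, n + 1, hs, .refl hx, .step hx hu h, by omega⟩
    by_cases hs' : u[k + 1]? = some Sym.star
    · exact ⟨u, 1, n, hs', .step hx hu (.refl h.left), h, by omega⟩
    have : x[k + 1]? = u[k + 1]? := by
      rcases hu with rfl | hu
      · rfl
      · rcases hu.2 k with h | h | h
        exacts [h, absurd h hs, absurd h hs']
    obtain ⟨z, m, l, h1, h2, h3, h4⟩ := ih (this ▸ hk)
    exact ⟨z, m + 1, l, h1, .step hx hu h2, h3, by omega⟩

end Near

/-- The labels in a component that has gone through `a` reflections, the `j`-th of them at the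
node labelled `w j`, where `c j = some s` means that the node that arose from this node has been
split and that the component lies on the side with symbol `s`. -/
structure Gam (b a : ℕ) (w : ℕ → Str) (c : ℕ → Option Sym) (x : Str) : Prop where
  mem : x ∈ XStr b
  len : x.length = a + 1
  opn : ∀ j < a, c j = none → (w j <+: x ↔ x[j + 1]? = some Sym.star)
  cls : ∀ j < a, ∀ s, c j = some s → ¬ w j <+: x ∧ x[j + 1]? = some s

/-- What the reflect nodes above a tree node provide, without the tree. `open_zero` reflects that
the root is matched with the last layer. `cons` is the trace of well-nestedness: if `i` is closed
while a later `j` is open, then the reflect node `j` lies below the split node of `i`, so its label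
already has the digit of that side. -/
structure WF (b a : ℕ) (w : ℕ → Str) (c : ℕ → Option Sym) : Prop where
  two_le : 2 ≤ b
  len : ∀ j < a, (w j).length = j + 1
  mem : ∀ j < a, w j ∈ XStrMinus b
  zero : 0 < a → w 0 = [Sym.digit 1]
  indep : ∀ i j, i < j → j < a → ¬ w i <+: w j
  open_zero : 0 < a → c 0 = none
  digit : ∀ j < a, ∀ s, c j = some s → ∃ d, 1 ≤ d ∧ d ≤ b ∧ s = Sym.digit d
  cons : ∀ i j, i < j → j < a → c j = none → ∀ s, c i = some s → (w j)[i + 1]? = some s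

theorem Gam.congr {b a : ℕ} {w w' : ℕ → Str} {c c' : ℕ → Option Sym} {x : Str}
    (h : Gam b a w c x) (hw : ∀ j < a, w j = w' j) (hc : ∀ j < a, c j = c' j) :
    Gam b a w' c' x :=
  ⟨h.mem, h.len, fun j hj => hw j hj ▸ hc j hj ▸ h.opn j hj,
    fun j hj => hw j hj ▸ hc j hj ▸ h.cls j hj⟩

variable {b a : ℕ} {w : ℕ → Str} {c c' : ℕ → Option Sym} {x y : Str}

namespace WF

theorem mono (h : WF b (a + 1) w c) : WF b a w c where
  two_le := h.two_le
  len j hj := h.len j (by omega)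
  mem j hj := h.mem j (by omega)
  zero ha := h.zero (by omega)
  indep i j hij hj := h.indep i j hij (by omega)
  open_zero ha := h.open_zero (by omega)
  digit j hj := h.digit j (by omega)
  cons i j hij hj := h.cons i j hij (by omega)

theorem allOpen (h : WF b a w c) : WF b a w fun _ => none where
  two_le := h.two_le
  len := h.len
  mem := h.mem
  zero := h.zero
  indep := h.indep
  open_zero _ := rfl
  digit _ _ _ := by simp
  cons _ _ _ _ _ _ := by simp

/-- A later label starting with `1` would have `w 0` as a final substring, against independence. -/
theorem getElem_zero (h : WF b a w c) {j : ℕ} (hj : 0 < j) (hja : j < a) :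
    (w j)[0]? = some (Sym.digit 2) := by
  rcases (h.mem j hja).1.1 with h' | h'
  · refine absurd ?_ (h.indep 0 j hj hja)
    rw [h.zero (by omega), prefix_iff_forall]
    intro k hk
    obtain rfl : k = 0 := by simpa using hk
    exact h'
  · exact h'

theorem gam_of_notMem_star (_ : WF b a w c) (hx : x ∈ XStr b) (hs : Sym.star ∉ x)
    (hl : x.length = a + 1) (hp : ∀ j < a, ¬ w j <+: x)
    (hc : ∀ j < a, ∀ s, c j = some s → x[j + 1]? = some s) : Gam b a w c x where
  mem := hx
  len := hl
  opn j hj _ := ⟨fun h => absurd h (hp j hj), fun h => absurd h (star_notMem_iff.1 hs _)⟩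
  cls j hj s hs := ⟨hp j hj, hc j hj s hs⟩

/-- The node at which the next reflection takes place exists: `indep` and `cons` are the two
conditions on a star-free string. -/
theorem gam_self (h : WF b (a + 1) w c) (ha : c a = none) : Gam b a w c (w a) :=
  h.mono.gam_of_notMem_star (h.mem a (by omega)).1 (h.mem a (by omega)).2 (h.len a (by omega))
    (fun j hj => h.indep j a hj (by omega)) (fun j hj => h.cons j a hj (by omega) ha)

/-- The star at position `1` is what `w 0` demands. All later `w j` start with `2` and are
irrelevant, so only the closed positions restrict `z`. These strings serve as neighbours of given
ones. -/
theorem gam_oneStar (h : WF b a w c) (ha : 0 < a) {z : Str} (hl : z.length + 1 = a)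
    (hz : ∀ k < z.length, ∃ d, 1 ≤ d ∧ d ≤ b ∧ z[k]? = some (Sym.digit d))
    (hc : ∀ k < z.length, ∀ s, c (k + 1) = some s → z[k]? = some s) :
    Gam b a w c (Sym.digit 1 :: Sym.star :: z) := by
  have hp : ∀ k < z.length, ¬ w (k + 1) <+: Sym.digit 1 :: Sym.star :: z := fun k hk hp => by
    have h1 := prefix_iff_forall.1 hp 0 (by rw [h.len _ (by omega)]; omega)
    rw [h.getElem_zero (by omega) (by omega)] at h1
    simp at h1
  refine ⟨mem_XStr_iff.2 ⟨Or.inl rfl, fun j s hs => ?_⟩, by simp; omega, fun j hj hcj => ?_,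
    fun j hj s hs => ?_⟩
  · rcases j with _ | k
    · left; simpa using hs.symm
    · have hk : k < z.length := by
        have := (List.getElem?_eq_some_iff.1 hs).1
        simp at this; omega
      obtain ⟨d, h1, h2, h3⟩ := hz k hk
      have hs' : z[k]? = some s := by simpa using hs
      exact Or.inr ⟨d, h1, h2, by simpa using hs'.symm.trans h3⟩
  · rcases j with _ | k
    · rw [h.zero ha]
      simp
    · refine ⟨fun hh => absurd hh (hp k (by omega)), fun hh => ?_⟩
      obtain ⟨d, h1, h2, h3⟩ := hz k (by omega)
      have : z[k]? = some Sym.star := by simpa using hh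
      simp [h3] at this
  · rcases j with _ | k
    · rw [h.open_zero ha] at hs
      cases hs
    · exact ⟨hp k (by omega), by simpa using hc k (by omega) s hs⟩

end WF

namespace Gam

theorem ne_nil (hx : Gam b a w c x) : x ≠ [] := fun h => by
  have := hx.len
  simp [h] at this

/-- A string that satisfies `Gam` has at most one star. -/
theorem star_unique (hW : WF b a w c) (hx : Gam b a w c x) {i j : ℕ}
    (hi : x[i]? = some Sym.star) (hj : x[j]? = some Sym.star) : i = j := by
  have aux : ∀ {i j : ℕ}, x[i]? = some Sym.star → x[j]? = some Sym.star → ¬ i < j := by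
    intro i j hi hj hij
    obtain ⟨k, rfl⟩ : ∃ k, j = k + 1 := ⟨j - 1, by omega⟩
    have hk : k < a := by
      have := (List.getElem?_eq_some_iff.1 hj).1
      have := hx.len
      omega
    rcases hc : c k with _ | s
    · have h1 := prefix_iff_forall.1 ((hx.opn k hk hc).2 hj) i (by rw [hW.len k hk]; exact hij)
      exact star_notMem_iff.1 (hW.mem k hk).2 i (h1 ▸ hi)
    · obtain ⟨d, -, -, rfl⟩ := hW.digit k hk s hc
      rw [(hx.cls k hk _ hc).2] at hj
      simp at hj
  have := aux hi hj
  have := aux hj hi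
  omega

theorem getElem_one (hW : WF b a w c) (ha : 0 < a) (hx : Gam b a w c x)
    (h : x[0]? = some (Sym.digit 1)) : x[1]? = some Sym.star := by
  refine (hx.opn 0 ha (hW.open_zero ha)).1 ?_
  rw [hW.zero ha, prefix_iff_forall]
  intro k hk
  obtain rfl : k = 0 := by simpa using hk
  exact h

theorem getElem_zero_of_notMem_star (hW : WF b a w c) (ha : 0 < a) (hx : Gam b a w c x)
    (h : Sym.star ∉ x) : x[0]? = some (Sym.digit 2) := by
  rcases hx.mem.1 with h' | h'
  · exact absurd (hx.getElem_one hW ha h') (star_notMem_iff.1 h _)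
  · exact h'

theorem getElem_zero_of_star (hW : WF b a w c) (hx : Gam b a w c x) {j : ℕ} (hj : 0 < j)
    (h : x[j + 1]? = some Sym.star) : x[0]? = some (Sym.digit 2) := by
  have ha : j < a := by
    have := (List.getElem?_eq_some_iff.1 h).1
    have := hx.len
    omega
  rcases hx.mem.1 with h' | h'
  · have := hx.star_unique hW (hx.getElem_one hW (by omega) h') h
    omega
  · exact h'

/-- Star-free strings have degree at most one. After the first reflection such an `x` starts with
`2`, so a neighbour starts with `1` and has its only star at position `1`; all later symbols are
those of `x`. -/
theorem eq_of_compat (hW : WF b a w c) (hx : Sym.star ∉ x) {n m : Str}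
    (hn : Gam b a w c n) (hm : Gam b a w c m) (hxn : Compat x n) (hxm : Compat x m) 
    (hxx : Gam b a w c x) : n = m := by
  rcases Nat.eq_zero_or_pos a with rfl | ha
  · have h1 := hn.len
    have h2 := hm.len
    refine List.ext_getElem? fun k => ?_
    rcases k with _ | k
    · have h3 := hxn.1
      have h4 := hxm.1
      rcases hn.mem.1 with h5 | h5 <;> rcases hm.mem.1 with h6 | h6 <;>
        rcases hxx.mem.1 with h7 | h7 <;> simp_all
    · rw [List.getElem?_eq_none (by omega), List.getElem?_eq_none (by omega)]
  · have h0 := hxx.getElem_zero_of_notMem_star hW ha hx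
    have key : ∀ n, Gam b a w c n → Compat x n → n[0]? = some (Sym.digit 1) ∧
        n[1]? = some Sym.star ∧ ∀ k, n[k + 2]? = x[k + 2]? := by
      intro n hn hxn
      have h1 : n[0]? = some (Sym.digit 1) := hn.mem.1.resolve_right fun h => hxn.1 (h0.trans h.symm)
      have h2 := hn.getElem_one hW ha h1
      refine ⟨h1, h2, fun k => ?_⟩
      rcases hxn.2 (k + 1) with h | h | h
      · exact h.symm
      · exact absurd h (star_notMem_iff.1 hx _)
      · have := hn.star_unique hW h2 h
        omega
    refine List.ext_getElem? fun k => ?_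
    have h1 := key n hn hxn
    have h2 := key m hm hxm
    rcases k with _ | _ | k
    · rw [h1.1, h2.1]
    · rw [h1.2.1, h2.2.1]
    · rw [h1.2.2, h2.2.2]

/-- Before the first reflection the neighbour is the other end of the initial edge; afterwards
symbols `0` and `1` of `x` become `1` and a star. -/
theorem exists_compat (hW : WF b a w c) (hx : Gam b a w c x) (hs : Sym.star ∉ x) :
    ∃ n, Gam b a w c n ∧ Compat x n := by
  rcases Nat.eq_zero_or_pos a with rfl | ha
  · obtain ⟨d, e, hd, he⟩ : ∃ d e, x[0]? = some (Sym.digit d) ∧ d ≠ e ∧ (e = 1 ∨ e = 2) := by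
      rcases hx.mem.1 with h | h
      · exact ⟨1, 2, h, by omega⟩
      · exact ⟨2, 1, h, by omega⟩
    have hl := hx.len
    refine ⟨[Sym.digit e], ⟨⟨by simpa using he.2, by simp⟩, rfl, fun j hj => absurd hj (by omega),
      fun j hj => absurd hj (by omega)⟩, by simpa [hd] using he.1, fun j => Or.inl ?_⟩
    rw [List.getElem?_eq_none (by omega), List.getElem?_eq_none (by simp)]
  · have h0 := hx.getElem_zero_of_notMem_star hW ha hs
    have hl := hx.len
    refine ⟨Sym.digit 1 :: Sym.star :: x.drop 2, hW.gam_oneStar ha (by simp; omega) ?_ ?_, ?_, ?_⟩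
    · intro k hk
      rw [List.length_drop] at hk
      rw [List.getElem?_drop, add_comm 2 k]
      exact exists_digit_of_mem_XStr hx.mem (by omega) (star_notMem_iff.1 hs _)
    · intro k hk s hs
      rw [List.length_drop] at hk
      rw [List.getElem?_drop, add_comm 2 k]
      exact (hx.cls (k + 1) (by omega) s hs).2
    · simp [h0]
    · intro j
      rcases j with _ | k
      · exact Or.inr (Or.inr rfl)
      · left
        simp [add_comm 2 k]

/-- A string that contains a star and starts with `2` has two compatible strings. -/
theorem exists_compat_pair (hW : WF b a w c) (hx : Gam b a w c x)
    (h0 : x[0]? = some (Sym.digit 2)) (hs : Sym.star ∈ x) :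
    ∃ n m, n ≠ m ∧ Gam b a w c n ∧ Gam b a w c m ∧ Compat x n ∧ Compat x m := by
  obtain ⟨i, hi⟩ := List.mem_iff_getElem?.1 hs
  have hl := hx.len
  have hil := (List.getElem?_eq_some_iff.1 hi).1
  -- Symbol `0` is the digit `2`, and a star at position `1` would force symbol `0` to be `1`.
  obtain ⟨k, rfl⟩ : ∃ k, i = k + 2 := by
    rcases i with _ | _ | k
    · simp [h0] at hi
    · have h1 := (hx.opn 0 (by omega) (hW.open_zero (by omega))).2 hi
      rw [hW.zero (by omega)] at h1
      have := prefix_iff_forall.1 h1 0 (by simp)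
      simp [h0] at this
    · exact ⟨k, rfl⟩
  -- The star can be filled with any digit, while symbols `0` and `1` become `1` and a star; two
  -- choices of `d` are available as `2 ≤ b`.
  have key : ∀ d, 1 ≤ d → d ≤ b →
      Gam b a w c (Sym.digit 1 :: Sym.star :: (x.drop 2).set k (Sym.digit d)) ∧
      Compat x (Sym.digit 1 :: Sym.star :: (x.drop 2).set k (Sym.digit d)) := by
    intro d hd hdb
    refine ⟨hW.gam_oneStar (by omega) (by simp; omega) ?_ ?_, by simp [h0], ?_⟩
    · intro j hj
      rw [List.length_set, List.length_drop] at hj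
      rw [List.getElem?_set]
      split_ifs with h1 h2
      · exact ⟨d, hd, hdb, rfl⟩
      · rw [List.length_drop] at h2; omega
      · rw [List.getElem?_drop, add_comm 2 j]
        refine exists_digit_of_mem_XStr hx.mem (by omega) fun hh => ?_
        have := hx.star_unique hW hi hh
        omega
    · intro j hj s hs
      rw [List.length_set, List.length_drop] at hj
      have h1 := (hx.cls (j + 1) (by omega) s hs).2
      obtain ⟨e, -, -, rfl⟩ := hW.digit _ (by omega) s hs
      rw [List.getElem?_set, if_neg, List.getElem?_drop, add_comm 2 j]
      · exact h1
      · rintro rfl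
        rw [h1] at hi
        simp at hi
    · intro j
      rcases j with _ | j
      · exact Or.inr (Or.inr rfl)
      · by_cases hjk : j = k
        · subst hjk
          exact Or.inr (Or.inl hi)
        · left
          simp [Ne.symm hjk, add_comm 2 j]
  have h1 := key 1 le_rfl (by have := hW.two_le; omega)
  have h2 := key 2 (by omega) hW.two_le
  refine ⟨_, _, fun h => ?_, h1.1, h2.1, h1.2, h2.2⟩
  have := congrArg (fun l : Str => l[k + 2]?) h
  have hk : k < x.length - 2 := by omega
  simp [hk] at this

/-- Everything is prescribed: the symbols up to `j` by `w j`, symbol `j + 1` is the star, and later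
positions are closed. So the node that arose from `w j` is the only one in its component with a star
there. -/
theorem eq_of_star (hx : Gam b a w c x) (hy : Gam b a w c y) {j : ℕ} (hj : j < a)
    (hcj : c j = none) (hc : ∀ k < a, j < k → c k ≠ none) (hwj : (w j).length = j + 1)
    (hxj : x[j + 1]? = some Sym.star) (hyj : y[j + 1]? = some Sym.star) : x = y := by
  have h1 := prefix_iff_forall.1 ((hx.opn j hj hcj).2 hxj)
  have h2 := prefix_iff_forall.1 ((hy.opn j hj hcj).2 hyj)
  refine List.ext_getElem? fun k => ?_
  rcases lt_trichotomy k (j + 1) with hk | rfl | hk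
  · rw [h1 k (by omega), h2 k (by omega)]
  · rw [hxj, hyj]
  · obtain ⟨k, rfl⟩ : ∃ l, k = l + 1 := ⟨k - 1, by omega⟩
    rcases lt_or_ge k a with hka | hka
    · obtain ⟨s, hs⟩ := Option.ne_none_iff_exists'.1 (hc k hka (by omega))
      rw [(hx.cls k hka s hs).2, (hy.cls k hka s hs).2]
    · rw [List.getElem?_eq_none (by rw [hx.len]; omega), List.getElem?_eq_none (by rw [hy.len]; omega)]

theorem exists_concat (hx : Gam b (a + 1) w c x) : ∃ y s, x = y ++ [s] :=
  ⟨x.dropLast, x.getLast hx.ne_nil, (List.dropLast_concat_getLast _).symm⟩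

/-- `Gam` in recursive form. The conditions for `j < a` do not see the last symbol, since `w j` is
shorter than `x`. For an open position this is exactly the effect of a reflection on the labels. -/
theorem concat_iff (hw : ∀ j ≤ a, (w j).length = j + 1) {s : Sym} :
    Gam b (a + 1) w c (x ++ [s]) ↔ Gam b a w c x ∧
      (s = Sym.star ∨ ∃ d, 1 ≤ d ∧ d ≤ b ∧ s = Sym.digit d) ∧
      (c a = none → (x = w a ↔ s = Sym.star)) ∧ ∀ t, c a = some t → x ≠ w a ∧ s = t := by
  by_cases hl : x.length = a + 1
  swap
  · exact ⟨fun h => absurd h.len (by simpa using hl), fun h => absurd h.1.len hl⟩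
  have hlt : ∀ j, j ≤ a → (x ++ [s])[j]? = x[j]? := fun j hj =>
    List.getElem?_append_left (by omega)
  have heq : (x ++ [s])[a + 1]? = some s := by rw [← hl]; exact List.getElem?_concat_length
  have hp : ∀ j ≤ a, w j <+: x ++ [s] ↔ w j <+: x := fun j hj => by
    rw [List.prefix_concat_iff]
    refine or_iff_right fun h => ?_
    have h1 := hw j hj
    rw [h] at h1
    simp at h1
    omega
  have hpa : w a <+: x ↔ x = w a := by
    refine ⟨fun h => (h.eq_of_length ?_).symm, fun h => by rw [h]⟩
    rw [hw a le_rfl, hl]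
  constructor
  · intro h
    refine ⟨⟨mem_XStr_iff.2 ⟨?_, fun j t ht => ?_⟩, hl, fun j hj hc => ?_, fun j hj t hc => ?_⟩,
      ?_, fun hc => ?_, fun t hc => ?_⟩
    · have := h.mem.1
      rwa [hlt 0 (by omega)] at this
    · have hj := (List.getElem?_eq_some_iff.1 ht).1
      exact (mem_XStr_iff.1 h.mem).2 j t (by rw [hlt _ (by omega), ht])
    · have := h.opn j (by omega) hc
      rwa [hp j hj.le, hlt _ (by omega)] at this
    · have := h.cls j (by omega) t hc
      rwa [hp j hj.le, hlt _ (by omega)] at this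
    · exact (mem_XStr_iff.1 h.mem).2 a s heq
    · have := h.opn a (by omega) hc
      rw [hp a le_rfl, heq, hpa] at this
      simpa using this
    · have := h.cls a (by omega) t hc
      rw [hp a le_rfl, heq, hpa] at this
      simpa using this
  · rintro ⟨h, h1, h2, h3⟩
    refine ⟨mem_XStr_iff.2 ⟨?_, fun j t ht => ?_⟩, by simpa using hl, fun j hj hc => ?_,
      fun j hj t hc => ?_⟩
    · rw [hlt 0 (by omega)]
      exact h.mem.1
    · have hj := (List.getElem?_eq_some_iff.1 ht).1
      simp only [List.length_append, List.length_singleton] at hj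
      rcases (show j ≤ a by omega).lt_or_eq with hj' | rfl
      · rw [hlt _ (by omega)] at ht
        exact (mem_XStr_iff.1 h.mem).2 j t ht
      · rw [heq] at ht
        obtain rfl : s = t := by simpa using ht
        exact h1
    · rcases (show j ≤ a by omega).lt_or_eq with hj' | rfl
      · rw [hp j hj'.le, hlt _ (by omega)]
        exact h.opn j hj' hc
      · rw [hp j le_rfl, heq, hpa, h2 hc]
        simp
    · rcases (show j ≤ a by omega).lt_or_eq with hj' | rfl
      · rw [hp j hj'.le, hlt _ (by omega)]
        exact h.cls j hj' t hc
      · rw [hp j le_rfl, heq, hpa]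
        simpa using h3 t hc

theorem concat_digit (hW : WF b (a + 1) w c) (hc : c a = none) (hx : Gam b a w c x)
    (hxw : x ≠ w a) {d : ℕ} (h1 : 1 ≤ d) (h2 : d ≤ b) : Gam b (a + 1) w c (x ++ [Sym.digit d]) :=
  (concat_iff fun j hj => hW.len j (by omega)).2 ⟨hx, Or.inr ⟨d, h1, h2, rfl⟩,
    fun _ => by simp [hxw], fun t ht => by simp [hc] at ht⟩

theorem concat_star (hW : WF b (a + 1) w c) (hc : c a = none) :
    Gam b (a + 1) w c (w a ++ [Sym.star]) :=
  (concat_iff fun j hj => hW.len j (by omega)).2 ⟨hW.gam_self hc, Or.inl rfl,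
    fun _ => by simp, fun t ht => by simp [hc] at ht⟩

theorem exists_concat_cases (hW : WF b (a + 1) w c) (hc : c a = none)
    (hx : Gam b (a + 1) w c x) : x = w a ++ [Sym.star] ∨
      ∃ y d, 1 ≤ d ∧ d ≤ b ∧ Gam b a w c y ∧ y ≠ w a ∧ x = y ++ [Sym.digit d] := by
  obtain ⟨y, s, rfl⟩ := hx.exists_concat
  obtain ⟨h1, h2, h3, -⟩ := (concat_iff fun j hj => hW.len j (by omega)).1 hx
  have h3 := h3 hc
  rcases h2 with rfl | ⟨d, hd, hdb, rfl⟩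
  · left
    rw [h3.2 rfl]
  · exact Or.inr ⟨y, d, hd, hdb, h1, fun h => by simpa using h3.1 h, rfl⟩

end Gam

/-! ### Folding string graphs by closing positions; connectedness. -/

/-- At a closed position both sides of the condition for open positions are false, so closing
positions passes to a subgraph. -/
theorem Gam.reopen (hW : WF b a w c) (hx : Gam b a w c x) (hc : ∀ j < a, c' j = none ∨ c' j = c j) :
    Gam b a w c' x where
  mem := hx.mem
  len := hx.len
  opn j hj h := by
    rcases h' : c j with _ | s
    · exact hx.opn j hj h'
    · obtain ⟨d, -, -, rfl⟩ := hW.digit j hj s h'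
      have := hx.cls j hj _ h'
      exact ⟨fun hp => absurd hp this.1, fun hs => by simp [this.2] at hs⟩
  cls j hj s h := by
    rcases hc j hj with h' | h'
    · simp [h] at h'
    · exact hx.cls j hj s (h'.symm.trans h)

/-- Closing some positions amounts to folding the graph onto a subgraph. -/
theorem exists_retraction (hW : WF b a w c') (hc : ∀ j < a, c j = none ∨ c j = c' j) :
    ∃ r : Str → Str, (∀ x, Gam b a w c x → Gam b a w c' (r x)) ∧
      (∀ x, Gam b a w c' x → r x = x) ∧
      ∀ x y, Gam b a w c x → Gam b a w c y → Compat x y → r x = r y ∨ Compat (r x) (r y) := by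
  induction a with
  | zero =>
    refine ⟨id, fun x hx => ⟨hx.mem, hx.len, fun j hj => absurd hj (by omega),
      fun j hj => absurd hj (by omega)⟩, fun _ _ => rfl, fun _ _ _ _ h => Or.inr h⟩
  | succ a ih =>
    obtain ⟨r, h1, h2, h3⟩ := ih hW.mono fun j hj => hc j (by omega)
    have hl : ∀ j ≤ a, (w j).length = j + 1 := fun j hj => hW.len j (by omega)
    have hwa : Sym.star ∉ w a := (hW.mem a (by omega)).2
    -- it suffices to say what to do with the image of the string without its last symbol
    suffices ∃ g : Str → Sym → Str,
        (∀ x s, Gam b (a + 1) w c (x ++ [s]) → Gam b (a + 1) w c' (g (r x) s)) ∧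
        (∀ x s, Gam b (a + 1) w c' (x ++ [s]) → g x s = x ++ [s]) ∧
        ∀ x s y t, Gam b (a + 1) w c (x ++ [s]) → Gam b (a + 1) w c (y ++ [t]) →
          (r x = r y ∨ Compat (r x) (r y)) → (s = t ∨ s = Sym.star ∨ t = Sym.star) →
          g (r x) s = g (r y) t ∨ Compat (g (r x) s) (g (r y) t) by
      obtain ⟨g, hg1, hg2, hg3⟩ := this
      have hr : ∀ x s, (fun x : Str => g (r x.dropLast) (x.getLast?.getD Sym.star)) (x ++ [s])
          = g (r x) s := fun x s => by simp
      refine ⟨fun x => g (r x.dropLast) (x.getLast?.getD Sym.star), fun x hx => ?_, fun x hx => ?_,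
        fun x y hx hy hxy => ?_⟩
      · obtain ⟨x, s, rfl⟩ := hx.exists_concat
        rw [hr]
        exact hg1 x s hx
      · obtain ⟨x, s, rfl⟩ := hx.exists_concat
        rw [hr, h2 x ((Gam.concat_iff hl).1 hx).1]
        exact hg2 x s hx
      · obtain ⟨x, s, rfl⟩ := hx.exists_concat
        obtain ⟨y, t, rfl⟩ := hy.exists_concat
        rw [hr, hr]
        have hx' := ((Gam.concat_iff hl).1 hx).1
        have hy' := ((Gam.concat_iff hl).1 hy).1
        obtain ⟨hxy, hst⟩ := (compat_concat (hx'.len.trans hy'.len.symm) hx'.ne_nil).1 hxy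
        exact hg3 x s y t hx hy (h3 x y hx' hy' hxy) hst
    -- If the last position stays open, digits are kept, except that strings whose beginning is
    -- folded onto `w a` end in a star. If it becomes closed, all copies are laid upon the one with
    -- digit `d`, and `w a` is pushed onto its only neighbour.
    rcases hca : c' a with _ | e
    · have hwG := hW.gam_self hca
      have hca' : c a = none := (hc a (by omega)).elim id fun h => h.trans hca
      refine ⟨fun y s => if y = w a then w a ++ [Sym.star] else y ++ [s], ?_, ?_, ?_⟩
      · intro x s hx
        obtain ⟨hx1, hx2, hx3, -⟩ := (Gam.concat_iff hl).1 hx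
        show Gam b (a + 1) w c' (if _ then _ else _)
        split_ifs with h
        · exact Gam.concat_star hW hca
        · rcases hx2 with rfl | ⟨d, hd, hdb, rfl⟩
          · refine absurd ?_ h
            rw [(hx3 hca').2 rfl]
            exact h2 _ hwG
          · exact Gam.concat_digit hW hca (h1 x hx1) h hd hdb
      · intro x s hx
        show (if _ then _ else _) = _
        split_ifs with h
        · subst h
          rw [(((Gam.concat_iff hl).1 hx).2.2.1 hca).1 rfl]
        · rfl
      · intro x s y t hx hy hxy hst
        obtain ⟨hx1, hx2, hx3, -⟩ := (Gam.concat_iff hl).1 hx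
        obtain ⟨hy1, hy2, hy3, -⟩ := (Gam.concat_iff hl).1 hy
        have hx0 := h1 x hx1
        have hy0 := h1 y hy1
        -- A final star means `x = w a`, and the fold fixes `w a`.
        have hxs : r x ≠ w a → s ≠ Sym.star := fun h hs => h (by
          rw [(hx3 hca').2 hs]; exact h2 _ hwG)
        have hyt : r y ≠ w a → t ≠ Sym.star := fun h hs => h (by
          rw [(hy3 hca').2 hs]; exact h2 _ hwG)
        show (if r x = w a then _ else _) = (if r y = w a then _ else _) ∨
          Compat (if r x = w a then _ else _) (if r y = w a then _ else _)
        by_cases hxw : r x = w a <;> by_cases hyw : r y = w a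
        · left; rw [if_pos hxw, if_pos hyw]
        · right
          rw [if_pos hxw, if_neg hyw, ← hxw,
            compat_concat (hx0.len.trans hy0.len.symm) hx0.ne_nil]
          exact ⟨hxy.resolve_left fun h => hyw (h ▸ hxw), Or.inr (Or.inl rfl)⟩
        · right
          rw [if_neg hxw, if_pos hyw, ← hyw,
            compat_concat (hx0.len.trans hy0.len.symm) hx0.ne_nil]
          exact ⟨hxy.resolve_left fun h => hxw (h ▸ hyw), Or.inr (Or.inr rfl)⟩
        · rw [if_neg hxw, if_neg hyw]
          obtain rfl : s = t := by
            rcases hst with h | h | h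
            exacts [h, absurd h (hxs hxw), absurd h (hyt hyw)]
          refine hxy.imp (fun h => by rw [h]) fun h => ?_
          rw [compat_concat (hx0.len.trans hy0.len.symm) hx0.ne_nil]
          exact ⟨h, Or.inl rfl⟩
    · obtain ⟨d, hd, hdb, rfl⟩ := hW.digit a (by omega) e hca
      -- a neighbour to which the removed string is mapped
      obtain ⟨n, hn1, hn2⟩ : ∃ n, n ≠ w a ∧ (Gam b a w c' (w a) →
          Gam b a w c' n ∧ Compat (w a) n) := by
        by_cases hG : Gam b a w c' (w a)
        · obtain ⟨n, hn, hn'⟩ := hG.exists_compat hW.mono hwa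
          exact ⟨n, fun h => hn'.1 (by rw [h]), fun _ => ⟨hn, hn'⟩⟩
        -- If `w a` is not in the folded graph, any string other than `w a` will do.
        · exact ⟨w a ++ [Sym.star], by simp, fun h => absurd h hG⟩
      have hconcat : ∀ y, Gam b a w c' y → y ≠ w a → Gam b (a + 1) w c' (y ++ [Sym.digit d]) :=
        fun y hy hyw => (Gam.concat_iff hl).2 ⟨hy, Or.inr ⟨d, hd, hdb, rfl⟩,
          fun h => by simp [h] at hca, fun t ht => ⟨hyw, by
            rw [hca] at ht; simpa using ht⟩⟩
      have hcompat : ∀ y z, Gam b a w c' y → Gam b a w c' z → Compat y z →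
          Compat (y ++ [Sym.digit d]) (z ++ [Sym.digit d]) := fun y z hy hz h =>
        (compat_concat (hy.len.trans hz.len.symm) hy.ne_nil).2 ⟨h, Or.inl rfl⟩
      refine ⟨fun y _ => (if y = w a then n else y) ++ [Sym.digit d], ?_, ?_, ?_⟩
      · intro x s hx
        have hx0 := h1 x ((Gam.concat_iff hl).1 hx).1
        show Gam b (a + 1) w c' ((if _ then _ else _) ++ _)
        split_ifs with h
        · exact hconcat n (hn2 (h ▸ hx0)).1 hn1
        · exact hconcat _ hx0 h
      · intro x s hx
        obtain ⟨h4, rfl⟩ := ((Gam.concat_iff hl).1 hx).2.2.2 _ hca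
        show (if _ then _ else _) ++ _ = _
        rw [if_neg h4]
      · intro x s y t hx hy hxy hst
        have hx0 := h1 x ((Gam.concat_iff hl).1 hx).1
        have hy0 := h1 y ((Gam.concat_iff hl).1 hy).1
        show (if r x = w a then _ else _) ++ _ = (if r y = w a then _ else _) ++ _ ∨
          Compat ((if r x = w a then _ else _) ++ _) ((if r y = w a then _ else _) ++ _)
        rcases hxy with hxy | hxy
        · left; rw [hxy]
        by_cases hxw : r x = w a <;> by_cases hyw : r y = w a
        · left; rw [if_pos hxw, if_pos hyw]
        · left
          -- Here `r y` is a neighbour of the leaf `w a`, hence equals `n`: the edge collapses.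
          rw [if_pos hxw, if_neg hyw]
          obtain ⟨h5, h6⟩ := hn2 (hxw ▸ hx0)
          rw [Gam.eq_of_compat hW.mono hwa h5 hy0 h6 (hxw ▸ hxy) (hxw ▸ hx0)]
        · left
          rw [if_neg hxw, if_pos hyw]
          obtain ⟨h5, h6⟩ := hn2 (hyw ▸ hy0)
          rw [Gam.eq_of_compat hW.mono hwa h5 hx0 h6 (hyw ▸ hxy).symm (hyw ▸ hy0)]
        · right
          rw [if_neg hxw, if_neg hyw]
          exact hcompat _ _ hx0 hy0 hxy

/-- Each copy is connected by induction and contains the shared node `w a` followed by a star. -/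
theorem near_of_gam_allOpen (hW : WF b a w fun _ => none) (hx : Gam b a w (fun _ => none) x)
    (hy : Gam b a w (fun _ => none) y) : ∃ n, Near (Gam b a w fun _ => none) n x y := by
  induction a generalizing x y with
  | zero =>
    by_cases h : x[0]? = y[0]?
    · refine ⟨0, ?_⟩
      obtain rfl : x = y := by
        refine List.ext_getElem? fun k => ?_
        rcases k with _ | k
        · exact h
        · rw [List.getElem?_eq_none (by rw [hx.len]; omega),
            List.getElem?_eq_none (by rw [hy.len]; omega)]
      exact .refl hx
    · refine ⟨1, .step hx (Or.inr ⟨h, fun j => Or.inl ?_⟩) (.refl hy)⟩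
      rw [List.getElem?_eq_none (by rw [hx.len]; omega),
        List.getElem?_eq_none (by rw [hy.len]; omega)]
  | succ a ih =>
    have hG := hW.gam_self rfl
    have key : ∀ x, Gam b (a + 1) w (fun _ => none) x →
        ∃ n, Near (Gam b (a + 1) w fun _ => none) n x (w a ++ [Sym.star]) := by
      intro x hx
      rcases hx.exists_concat_cases hW rfl with rfl | ⟨y, d, hd, hdb, hy, hyw, rfl⟩
      · exact ⟨0, .refl hx⟩
      · obtain ⟨n, hn⟩ := ih hW.mono hy hG
        have := hn.map (P' := Gam b (a + 1) w fun _ => none)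
          (f := fun y => if y = w a then w a ++ [Sym.star] else y ++ [Sym.digit d])
          (fun x hx => ?_) fun x z hx hz hxz => ?_
        · simp only [if_neg hyw, if_true] at this
          exact ⟨n, this⟩
        · show Gam b (a + 1) w _ (if _ then _ else _)
          split_ifs with h
          · exact Gam.concat_star hW rfl
          · exact Gam.concat_digit hW rfl hx h hd hdb
        · right
          show Compat (if _ then _ else _) (if _ then _ else _)
          split_ifs with h h' h'
          · exact absurd (by rw [h, h']) hxz.1
          all_goals
            try rw [← h]
            try rw [← h']
            rw [compat_concat (hx.len.trans hz.len.symm) hx.ne_nil]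
            exact ⟨hxz, by simp⟩
    obtain ⟨n, hn⟩ := key x hx
    obtain ⟨m, hm⟩ := key y hy
    exact ⟨n + m, hn.trans hm.symm⟩

/-- The image of a connected graph under a fold that fixes both ends. -/
theorem near_of_gam (hW : WF b a w c) (hx : Gam b a w c x) (hy : Gam b a w c y) :
    ∃ n, Near (Gam b a w c) n x y := by
  obtain ⟨r, h1, h2, h3⟩ := exists_retraction (c := fun _ => none) hW fun _ _ => Or.inl rfl
  obtain ⟨n, hn⟩ := near_of_gam_allOpen hW.allOpen (hx.reopen hW fun _ _ => Or.inl rfl)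
    (hy.reopen hW fun _ _ => Or.inl rfl)
  have := hn.map h1 h3
  rw [h2 x hx, h2 y hy] at this
  exact ⟨n, this⟩

end CTree

/-! ### The effect of reflections and splits on marked graphs and their components. -/

namespace CTree

open scoped Classical

namespace MarkedGraph

variable {G : MarkedGraph} {Δ : ℕ} {v : G.V}

theorem SameComp.refl {u : G.V} (hu : u ∉ G.marked) : G.SameComp u u :=
  ⟨hu, hu, SimpleGraph.Reachable.refl _⟩

theorem SameComp.adj_left {u z y : G.V} (hu : u ∉ G.marked) (h : G.graph.Adj u z)
    (h' : G.SameComp z y) : G.SameComp u y := by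
  obtain ⟨hz, hy, hr⟩ := h'
  have : (G.graph.induce G.markedᶜ).Adj ⟨u, hu⟩ ⟨z, hz⟩ := h
  exact ⟨hu, hy, this.reachable.trans hr⟩

theorem SameComp.reachable {u z : G.V} (h : G.SameComp u z) : G.graph.Reachable u z := by
  obtain ⟨hu, hz, hr⟩ := h
  exact hr.map (SimpleGraph.Embedding.induce _).toHom

theorem reflect_adj_inl_inl {x y : G.V} :
    (G.reflect Δ v).graph.Adj (Sum.inl x) (Sum.inl y) ↔ G.graph.Adj x y := by
  show _ ∧ (G.graph.Adj x y ∨ G.graph.Adj y x) ↔ _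
  refine ⟨fun h => h.2.elim id SimpleGraph.Adj.symm, fun h => ⟨fun hh => h.ne (Sum.inl.inj hh),
    Or.inl h⟩⟩

theorem reflect_adj_inl_inr {x : G.V}
    {y : {w : G.V // G.SameComp v w ∧ w ≠ v} × {i : ℕ // 2 ≤ i ∧ i ≤ Δ}} :
    (G.reflect Δ v).graph.Adj (Sum.inl x) (Sum.inr y) ↔ x = v ∧ G.graph.Adj v y.1 := by
  show _ ∧ ((x = v ∧ G.graph.Adj v y.1) ∨ False) ↔ _
  exact ⟨fun h => h.2.elim id False.elim, fun h => ⟨Sum.inl_ne_inr, Or.inl h⟩⟩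

theorem reflect_adj_inr_inr
    {x y : {w : G.V // G.SameComp v w ∧ w ≠ v} × {i : ℕ // 2 ≤ i ∧ i ≤ Δ}} :
    (G.reflect Δ v).graph.Adj (Sum.inr x) (Sum.inr y) ↔ x.2 = y.2 ∧ G.graph.Adj x.1 y.1 := by
  show _ ∧ ((x.2 = y.2 ∧ G.graph.Adj x.1 y.1) ∨ (y.2 = x.2 ∧ G.graph.Adj y.1 x.1)) ↔ _
  constructor
  · rintro ⟨-, h | h⟩
    exacts [h, ⟨h.1.symm, h.2.symm⟩]
  · exact fun h => ⟨fun hh => h.2.ne (by rw [Sum.inr.inj hh]), Or.inl h⟩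

theorem reflect_label_self :
    (G.reflect Δ v).label (Sum.inl v) = G.label v ++ [Sym.star] := if_pos rfl

theorem reflect_label_sameComp {u : G.V} (h : u ≠ v) (h' : G.SameComp v u) :
    (G.reflect Δ v).label (Sum.inl u) = G.label u ++ [Sym.digit 1] :=
  (if_neg h).trans (if_pos h')

theorem reflect_label_other {u : G.V} (h : u ≠ v) (h' : ¬ G.SameComp v u) :
    (G.reflect Δ v).label (Sum.inl u) = G.label u :=
  (if_neg h).trans (if_neg h')

theorem reflect_label_inr (y : {w : G.V // G.SameComp v w ∧ w ≠ v} × {i : ℕ // 2 ≤ i ∧ i ≤ Δ}) :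
    (G.reflect Δ v).label (Sum.inr y) = G.label y.1 ++ [Sym.digit y.2] := rfl

theorem reflect_notMem_marked_inl {u : G.V} :
    Sum.inl u ∉ (G.reflect Δ v).marked ↔ u ∉ G.marked := by
  show ¬ (Sum.inl u ∈ Sum.inl '' G.marked) ↔ _
  simp

theorem reflect_notMem_marked_inr
    (y : {w : G.V // G.SameComp v w ∧ w ≠ v} × {i : ℕ // 2 ≤ i ∧ i ≤ Δ}) :
    Sum.inr y ∉ (G.reflect Δ v).marked := by
  show ¬ (Sum.inr y ∈ Sum.inl '' G.marked)
  simp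

/-- No label is a final substring of the label of another node. -/
def PrefixFree (G : MarkedGraph) : Prop := ∀ u z, G.label u <+: G.label z → u = z

theorem PrefixFree.injective (hG : G.PrefixFree) {u z : G.V} (h : G.label u = G.label z) : u = z :=
  hG u z (h ▸ List.prefix_rfl)

theorem PrefixFree.split (hG : G.PrefixFree) : (G.split v).PrefixFree := hG

/-- Being prefix-free, unlike mere injectivity of the labels, is an invariant: a reflection
lengthens labels in one component only, and an extended label could otherwise collide with a label
elsewhere. -/
theorem PrefixFree.reflect (hG : G.PrefixFree) : (G.reflect Δ v).PrefixFree := by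
  -- Three kinds of nodes: `v`, nodes outside its component, and copies with index `i`, where copy
  -- `1` consists of the original nodes.
  have hcases : ∀ x : (G.reflect Δ v).V,
      ((x = Sum.inl v ∧ (G.reflect Δ v).label x = G.label v ++ [Sym.star]) ∨
      (∃ u, u ≠ v ∧ ¬ G.SameComp v u ∧ x = Sum.inl u ∧ (G.reflect Δ v).label x = G.label u)) ∨
      ∃ u : {w : G.V // G.SameComp v w ∧ w ≠ v}, ∃ i : ℕ,
        (G.reflect Δ v).label x = G.label u.1 ++ [Sym.digit i] ∧
        ((i = 1 ∧ x = Sum.inl u.1) ∨ ∃ hi : 2 ≤ i ∧ i ≤ Δ, x = Sum.inr (u, ⟨i, hi⟩)) := by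
    rintro (u | ⟨u, i⟩)
    · by_cases h : u = v
      · subst h
        exact Or.inl (Or.inl ⟨rfl, reflect_label_self⟩)
      by_cases h' : G.SameComp v u
      · exact Or.inr ⟨⟨u, h', h⟩, 1, reflect_label_sameComp h h', Or.inl ⟨rfl, rfl⟩⟩
      · exact Or.inl (Or.inr ⟨u, h, h', rfl, reflect_label_other h h'⟩)
    · exact Or.inr ⟨u, i, rfl, Or.inr ⟨i.2, rfl⟩⟩
  have hpre : ∀ {u z : G.V} {l : Str}, G.label u <+: l → G.label z <+: l → u = z := fun h h' =>
    (List.prefix_or_prefix_of_prefix h h').elim (hG _ _) fun h => (hG _ _ h).symm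
  intro x y hxy
  rcases hcases x with (⟨rfl, hx⟩ | ⟨u, hu, hu', rfl, hx⟩) | ⟨u, i, hx, hx'⟩ <;>
    rcases hcases y with (⟨rfl, hy⟩ | ⟨z, hz, hz', rfl, hy⟩) | ⟨z, k, hy, hy'⟩ <;>
    first | rw [hx, hy] at hxy | rw [hx] at hxy
  · exact absurd (hpre ((List.prefix_append _ _).trans hxy) List.prefix_rfl) hz.symm
  · exact absurd (hpre ((List.prefix_append _ _).trans hxy) (List.prefix_append _ _)) z.2.2.symm
  · exact absurd (hpre hxy (List.prefix_append _ _)) hu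
  · rw [hpre hxy List.prefix_rfl]
  · exact absurd (hpre hxy (List.prefix_append _ _)) fun h => hu' (h ▸ z.2.1)
  · exact absurd (hpre ((List.prefix_append _ _).trans hxy) (List.prefix_append _ _)) u.2.2
  · exact absurd (hpre ((List.prefix_append _ _).trans hxy) List.prefix_rfl)
      fun h => hz' (h ▸ u.2.1)
  · have huz := hpre ((List.prefix_append _ _).trans hxy) (List.prefix_append _ _)
    obtain rfl : u = z := Subtype.ext huz
    obtain rfl : i = k := by simpa using hxy
    rcases hx' with ⟨hi, rfl⟩ | ⟨hi, rfl⟩ <;> rcases hy' with ⟨hk, rfl⟩ | ⟨hk, rfl⟩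
    · rfl
    · omega
    · omega
    · rfl

end MarkedGraph

open MarkedGraph

/-- The strings satisfying `P` are the labels in a component of the unmarked nodes of `G`, onto
which `G` can be folded by `ρ`. -/
structure Comp (G : MarkedGraph) (P : Str → Prop) (e : Str → G.V) (ρ : G.V → Str) : Prop where
  label : ∀ x, P x → G.label (e x) = x
  unmarked : ∀ x, P x → e x ∉ G.marked
  fold_self : ∀ x, P x → ρ (e x) = x
  fold_mem : ∀ u, P (ρ u)
  fold_adj : ∀ u z, G.graph.Adj u z → ρ u = ρ z ∨ Compat (ρ u) (ρ z)
  closed : ∀ x u, P x → G.graph.Adj (e x) u → u ∉ G.marked → ∃ y, P y ∧ u = e y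
  adj : ∀ x y, P x → P y → Compat x y → G.graph.Adj (e x) (e y)
  leaf : ∀ x u, P x → Sym.star ∉ x → G.graph.Adj (e x) u → u ∉ G.marked

namespace Comp

variable {G : MarkedGraph} {P P' : Str → Prop} {e e' : Str → G.V} {ρ ρ' : G.V → Str}
  {b a : ℕ} {w : ℕ → Str} {c c' : ℕ → Option Sym} {x y : Str}

theorem inj (h : Comp G P e ρ) (hx : P x) (hy : P y) (hxy : e x = e y) : x = y := by
  rw [← h.label x hx, hxy, h.label y hy]

theorem compat_of_adj (h : Comp G P e ρ) (hx : P x) (hy : P y) (hxy : G.graph.Adj (e x) (e y)) :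
    Compat x y := by
  have := h.fold_adj _ _ hxy
  rw [h.fold_self x hx, h.fold_self y hy] at this
  exact this.resolve_left fun h => hxy.ne (by rw [h])

/-- Applies to walks in all of `G`, through marked nodes as well: folding them gives lower bounds
for distances in `G`. -/
theorem near_of_walk (h : Comp G P e ρ) {u z : G.V} (p : G.graph.Walk u z) :
    Near P p.length (ρ u) (ρ z) := by
  induction p with
  | nil => exact .refl (h.fold_mem _)
  | cons hadj _ ih => exact .step (h.fold_mem _) (h.fold_adj _ _ hadj) ih

theorem exists_walk_of_near (h : Comp G P e ρ) {n : ℕ} (hn : Near P n x y) :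
    ∃ p : G.graph.Walk (e x) (e y), p.length ≤ n := by
  induction hn with
  | refl _ => exact ⟨.nil, by simp⟩
  | @step n x z y hx hz hn ih =>
    obtain ⟨p, hp⟩ := ih
    rcases hz with rfl | hz
    · exact ⟨p, by omega⟩
    · exact ⟨.cons (h.adj x z hx hn.left hz) p, by simpa using hp⟩

theorem sameComp_of_near (h : Comp G P e ρ) {n : ℕ} (hn : Near P n x y) :
    G.SameComp (e x) (e y) := by
  induction hn with
  | refl hx => exact .refl (h.unmarked _ hx)
  | @step n x z y hx hz hn ih =>
    rcases hz with rfl | hz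
    · exact ih
    · exact ih.adj_left (h.unmarked x hx) (h.adj x z hx hn.left hz)

theorem exists_of_sameComp (h : Comp G P e ρ) (hx : P x) {u : G.V} (hu : G.SameComp (e x) u) :
    ∃ y, P y ∧ u = e y := by
  obtain ⟨h1, h2, ⟨p⟩⟩ := hu
  have key : ∀ (s t : ↥G.markedᶜ) (p : (G.graph.induce G.markedᶜ).Walk s t) (x : Str), P x →
      s.1 = e x → ∃ y, P y ∧ t.1 = e y := by
    intro s t p
    induction p with
    | nil => exact fun x hx hs => ⟨x, hx, hs⟩
    | @cons s z t hadj p ih =>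
      intro x hx hs
      have hadj : G.graph.Adj s.1 z.1 := hadj
      obtain ⟨y, hy, hz⟩ := h.closed x z.1 hx (hs ▸ hadj) z.2
      exact ih y hy hz
  exact key _ _ p x hx rfl

theorem sameComp_iff (hW : WF b a w c) (h : Comp G (Gam b a w c) e ρ) (hx : Gam b a w c x)
    {u : G.V} : G.SameComp (e x) u ↔ ∃ y, Gam b a w c y ∧ u = e y := by
  refine ⟨h.exists_of_sameComp hx, ?_⟩
  rintro ⟨y, hy, rfl⟩
  obtain ⟨n, hn⟩ := near_of_gam hW hx hy
  exact h.sameComp_of_near hn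

/-- The degree counts marked neighbours too; the field `leaf` of `Comp` excludes them here. -/
theorem isLeaf (hW : WF b a w c) (h : Comp G (Gam b a w c) e ρ) (hx : Gam b a w c x)
    (hs : Sym.star ∉ x) : G.IsLeaf (e x) := by
  obtain ⟨n, hn, hxn⟩ := hx.exists_compat hW hs
  refine Set.ncard_eq_one.2 ⟨e n, Set.ext fun u => ⟨fun hu => ?_, ?_⟩⟩
  · have hu : G.graph.Adj (e x) u := hu
    obtain ⟨y, hy, rfl⟩ := h.closed x u hx hu (h.leaf x u hx hs hu)
    rw [Gam.eq_of_compat hW hs hy hn (h.compat_of_adj hx hy hu) hxn hx]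
    rfl
  · rintro rfl
    exact h.adj x n hx hn hxn

theorem isTwoLeaf_iff (hW : WF b a w c) (h : Comp G (Gam b a w c) e ρ) (hx : Gam b a w c x) :
    G.IsTwoLeaf (e x) ↔ Sym.star ∉ x ∧ x[0]? = some (Sym.digit 2) := by
  unfold IsTwoLeaf
  rw [h.label x hx]
  refine ⟨fun hh => ⟨fun hs => ?_, hh.2⟩, fun hh => ⟨h.isLeaf hW hx hh.1, hh.2⟩⟩
  obtain ⟨n, m, hnm, hn, hm, hxn, hxm⟩ := hx.exists_compat_pair hW hh.2 hs
  obtain ⟨u, hu⟩ := Set.ncard_eq_one.1 hh.1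
  have h1 : e n ∈ G.graph.neighborSet (e x) := h.adj x n hx hn hxn
  have h2 : e m ∈ G.graph.neighborSet (e x) := h.adj x m hx hm hxm
  rw [hu, Set.mem_singleton_iff] at h1 h2
  exact hnm (h.inj hn hm (h1.trans h2.symm))

theorem split_other (h : Comp G P e ρ) {v : G.V} (hv : ∀ x, P x → e x ≠ v) :
    Comp (G.split v) P e ρ where
  label := h.label
  unmarked x hx := fun hh => (hh : e x = v ∨ e x ∈ G.marked).elim (hv x hx) (h.unmarked x hx)
  fold_self := h.fold_self
  fold_mem := h.fold_mem
  fold_adj := h.fold_adj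
  closed x u hx hu hum := h.closed x u hx hu fun hh => hum (Or.inr hh)
  adj := h.adj
  leaf x u hx hs hu hum := by
    have h1 := h.leaf x u hx hs hu
    obtain ⟨y, hy, rfl⟩ := h.closed x u hx hu h1
    exact (hum : e y = v ∨ e y ∈ G.marked).elim (hv y hy) h1

/-- By `eq_of_star`, the marked node is the only one with a star at position `k + 1`, and no other
node joins different digits there. The part with digit `d` is therefore a component, onto which the
old one is folded by `exists_retraction`. -/
theorem split_self (hW : WF b a w c) (hW' : WF b a w c') (h : Comp G (Gam b a w c) e ρ) {k : ℕ}
    (hk : 0 < k) (hka : k < a) (hck : c k = none) {d : ℕ} (hck' : c' k = some (Sym.digit d))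
    (hcc : ∀ j < a, j ≠ k → c' j = c j) (hopen : ∀ j < a, k < j → c j ≠ none) {s : Str}
    (hs : Gam b a w c s) (hsk : s[k + 1]? = some Sym.star) :
    ∃ ρ', Comp (G.split (e s)) (Gam b a w c') e ρ' := by
  have hle : ∀ j < a, c j = none ∨ c j = c' j := fun j hj => by
    by_cases h : j = k
    · subst h; exact Or.inl hck
    · exact Or.inr (hcc j hj h).symm
  obtain ⟨r, h1, h2, h3⟩ := exists_retraction hW' hle
  have hsub : ∀ x, Gam b a w c' x → Gam b a w c x := fun x hx => hx.reopen hW' hle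
  have hne : ∀ x, Gam b a w c' x → e x ≠ e s := fun x hx hxs => by
    have := (hx.cls k hka _ hck').2
    rw [h.inj (hsub x hx) hs hxs, hsk] at this
    simp at this
  refine ⟨r ∘ ρ, fun x hx => h.label x (hsub x hx), fun x hx hh => ?_, fun x hx => ?_,
    fun u => h1 _ (h.fold_mem u), fun u z huz => ?_, fun x u hx hu hum => ?_,
    fun x y hx hy => h.adj x y (hsub x hx) (hsub y hy), fun x u hx hxs hu hum => ?_⟩
  · exact (hh : e x = e s ∨ e x ∈ G.marked).elim (hne x hx) (h.unmarked x (hsub x hx))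
  · show r (ρ (e x)) = x
    rw [h.fold_self x (hsub x hx), h2 x hx]
  · rcases h.fold_adj u z huz with h | h'
    · exact Or.inl (congrArg r h)
    · exact h3 _ _ (h.fold_mem u) (h.fold_mem z) h'
  · obtain ⟨y, hy, rfl⟩ := h.closed x u (hsub x hx) hu fun hh => hum (Or.inr hh)
    refine ⟨y, ?_, rfl⟩
    have hxy := h.compat_of_adj (hsub x hx) hy hu
    have hxk := (hx.cls k hka _ hck').2
    -- The node with this star is the freshly marked one, so an unmarked neighbour keeps the digit
    -- `d`.
    have hys : y[k + 1]? ≠ some Sym.star := fun hh => hum (Or.inl (by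
      rw [hy.eq_of_star hs hka hck hopen (hW.len k hka) hh hsk]))
    have hyk : y[k + 1]? = some (Sym.digit d) := by
      rcases hxy.2 k with h | h | h
      · rw [← h, hxk]
      · rw [hxk] at h; simp at h
      · exact absurd h hys
    refine ⟨hy.mem, hy.len, fun j hj hcj => hy.opn j hj ?_, fun j hj t hcj => ?_⟩
    · by_cases hjk : j = k
      · subst hjk; exact hck
      · rw [← hcc j hj hjk, hcj]
    · by_cases hjk : j = k
      · subst hjk
        rw [hck'] at hcj
        exact ⟨fun hp => hys ((hy.opn j hj hck).1 hp), hyk.trans hcj⟩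
      · exact hy.cls j hj t (by rw [← hcc j hj hjk, hcj])
  · have h4 := h.leaf x u (hsub x hx) hxs hu
    -- A star-free string starts with `2`, and so does `s` because `0 < k`; hence the split node is
    -- adjacent to no leaf.
    rcases (hum : u = e s ∨ u ∈ G.marked) with rfl | hum
    · have h5 := (h.compat_of_adj (hsub x hx) hs hu).1
      rw [hx.getElem_zero_of_notMem_star hW' (by omega) hxs,
        hs.getElem_zero_of_star hW hk hsk] at h5
      exact h5 rfl
    · exact h4 hum

/-- The component of `P'` is untouched, and each copied node is folded as its original. -/
theorem reflect_other (h : Comp G P e ρ) (h' : Comp G P' e' ρ')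
    (hd : ∀ x, P x → ¬ P' x) (hx : P x) (Δ : ℕ) :
    ∃ e'' ρ'', Comp (G.reflect Δ (e x)) P' e'' ρ'' := by
  have hsc : ∀ y, P' y → ¬ G.SameComp (e x) (e' y) := fun y hy hh => by
    obtain ⟨z, hz, hyz⟩ := h.exists_of_sameComp hx hh
    have : y = z := by rw [← h'.label y hy, hyz, h.label z hz]
    exact hd z hz (this ▸ hy)
  have hne : ∀ y, P' y → e' y ≠ e x := fun y hy hh =>
    hsc y hy (by rw [hh]; exact .refl (h.unmarked x hx))
  refine ⟨fun y => Sum.inl (e' y), Sum.elim ρ' fun u => ρ' u.1, fun y hy => ?_, fun y hy => ?_,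
    fun y hy => h'.fold_self y hy, ?_, ?_, ?_, fun y z hy hz hyz => ?_, ?_⟩
  · rw [reflect_label_other (hne y hy) (hsc y hy), h'.label y hy]
  · exact reflect_notMem_marked_inl.2 (h'.unmarked y hy)
  · rintro (u | u) <;> exact h'.fold_mem _
  · rintro (u | u) (z | z) huz
    · exact h'.fold_adj _ _ (reflect_adj_inl_inl.1 huz)
    · obtain ⟨rfl, hadj⟩ := reflect_adj_inl_inr.1 huz
      exact h'.fold_adj _ _ hadj
    · obtain ⟨rfl, hadj⟩ := reflect_adj_inl_inr.1 huz.symm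
      exact h'.fold_adj _ _ hadj.symm
    · exact h'.fold_adj _ _ (reflect_adj_inr_inr.1 huz).2
  · rintro y (u | u) hy huz hum
    · obtain ⟨z, hz, rfl⟩ := h'.closed y u hy (reflect_adj_inl_inl.1 huz)
        (reflect_notMem_marked_inl.1 hum)
      exact ⟨z, hz, rfl⟩
    · exact absurd (reflect_adj_inl_inr.1 huz).1 (hne y hy)
  · exact reflect_adj_inl_inl.2 (h'.adj y z hy hz hyz)
  · rintro y (u | u) hy hs huz
    · exact reflect_notMem_marked_inl.2 (h'.leaf y u hy hs (reflect_adj_inl_inl.1 huz))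
    · exact reflect_notMem_marked_inr _

/-- Used with `q` selecting the nodes that get copied: the last symbol tells which copy is meant,
and a star or the digit `1` refers to the original. -/
theorem exists_copies_embedding {V : Type} (q : V → Prop) (e : Str → V) (b : ℕ) :
    ∃ e' : Str → V ⊕ ({u // q u} × {i : ℕ // 2 ≤ i ∧ i ≤ b}),
      (∀ y s, (¬ q (e y) ∨ ∀ i, 2 ≤ i → s ≠ Sym.digit i) → e' (y ++ [s]) = Sum.inl (e y)) ∧
      ∀ y (hy : q (e y)) i (hi : 2 ≤ i ∧ i ≤ b),
        e' (y ++ [Sym.digit i]) = Sum.inr (⟨e y, hy⟩, ⟨i, hi⟩) := by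
  refine ⟨fun z => if hz : q (e z.dropLast) ∧
      ∃ i : {i : ℕ // 2 ≤ i ∧ i ≤ b}, z.getLast? = some (Sym.digit i.1) then
        Sum.inr (⟨e z.dropLast, hz.1⟩, hz.2.choose) else Sum.inl (e z.dropLast), ?_, ?_⟩
  · intro y s hs
    have : ¬ (q (e (y ++ [s]).dropLast) ∧ ∃ i : {i : ℕ // 2 ≤ i ∧ i ≤ b},
        (y ++ [s]).getLast? = some (Sym.digit i.1)) := by
      rintro ⟨h1, i, hi⟩
      rw [List.dropLast_concat] at h1
      rw [List.getLast?_concat, Option.some.injEq] at hi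
      exact hs.elim (fun h => h h1) fun h => h i i.2.1 hi
    beta_reduce
    rw [dif_neg this, List.dropLast_concat]
  · intro y hy i hi
    have hex : q (e (y ++ [Sym.digit i]).dropLast) ∧ ∃ i' : {i : ℕ // 2 ≤ i ∧ i ≤ b},
        (y ++ [Sym.digit i]).getLast? = some (Sym.digit i'.1) := by
      rw [List.dropLast_concat]
      exact ⟨hy, ⟨i, hi⟩, by simp⟩
    beta_reduce
    rw [dif_pos hex]
    have h1 := hex.2.choose_spec
    have h2 : hex.2.choose = ⟨i, hi⟩ := Subtype.ext (by simpa using h1.symm)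
    rw [h2]
    simp

/-- By `concat_iff`, the strings allowed after the reflection are `w a` with a star and all others
with an arbitrary digit, one for each copy; `compat_concat` gives the edges. -/
theorem reflect_self (hW : WF b (a + 1) w c) (hc : c a = none) (h : Comp G (Gam b a w c) e ρ) :
    ∃ e' ρ', Comp (G.reflect b (e (w a))) (Gam b (a + 1) w c) e' ρ' := by
  have hwa := hW.gam_self hc
  have hb1 : 1 ≤ b := by have := hW.two_le; omega
  have hsc : ∀ y, Gam b a w c y → G.SameComp (e (w a)) (e y) := fun y hy =>
    (h.sameComp_iff hW.mono hwa).2 ⟨y, hy, rfl⟩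
  have hne : ∀ y, Gam b a w c y → y ≠ w a → e y ≠ e (w a) := fun y hy hyw hh =>
    hyw (h.inj hy hwa hh)
  obtain ⟨e', he1, he2, he3⟩ : ∃ e' : Str → (G.reflect b (e (w a))).V,
      e' (w a ++ [Sym.star]) = Sum.inl (e (w a)) ∧
      (∀ y, e' (y ++ [Sym.digit 1]) = Sum.inl (e y)) ∧
      ∀ y (hy : G.SameComp (e (w a)) (e y) ∧ e y ≠ e (w a)) i (hi : 2 ≤ i ∧ i ≤ b),
        e' (y ++ [Sym.digit i]) = Sum.inr (⟨e y, hy⟩, ⟨i, hi⟩) := by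
    obtain ⟨e', h1, h2⟩ := exists_copies_embedding
      (fun u => G.SameComp (e (w a)) u ∧ u ≠ e (w a)) e b
    exact ⟨e', h1 _ _ (Or.inl fun h => h.2 rfl), fun y => h1 _ _ (Or.inr fun i hi => by
      simp; omega), h2⟩
  have he3' : ∀ u : {u : G.V // G.SameComp (e (w a)) u ∧ u ≠ e (w a)},
      ∀ i : {i : ℕ // 2 ≤ i ∧ i ≤ b}, ∃ y, Gam b a w c y ∧ y ≠ w a ∧ u.1 = e y ∧
        Gam b (a + 1) w c (y ++ [Sym.digit i.1]) ∧ Sum.inr (u, i) = e' (y ++ [Sym.digit i.1]) := by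
    rintro ⟨u, hu⟩ ⟨i, hi⟩
    obtain ⟨y, hy, rfl⟩ := h.exists_of_sameComp hwa hu.1
    have hyw : y ≠ w a := fun hh => hu.2 (by rw [hh])
    exact ⟨y, hy, hyw, rfl, .concat_digit hW hc hy hyw (le_trans (by norm_num) hi.1) hi.2, (he3 y hu i hi).symm⟩
  have he2' : ∀ y, Gam b a w c y → ∃ z, Gam b (a + 1) w c z ∧ Sum.inl (e y) = e' z := by
    intro y hy
    by_cases hyw : y = w a
    · subst hyw
      exact ⟨_, .concat_star hW hc, he1.symm⟩
    · exact ⟨_, .concat_digit hW hc hy hyw le_rfl hb1, (he2 y).symm⟩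
  -- Original nodes are folded as before, onto the first copy; those folded onto `w a` now land on
  -- the shared node.
  let ρ' : (G.reflect b (e (w a))).V → Str :=
    Sum.elim (fun u => if ρ u = w a then w a ++ [Sym.star] else ρ u ++ [Sym.digit 1])
      fun p => ρ p.1.1 ++ [Sym.digit p.2.1]
  have hρr : ∀ p, ρ' (Sum.inr p) = ρ p.1.1 ++ [Sym.digit p.2.1] := fun _ => rfl
  have hρ1 : ∀ u, ρ u = w a → ρ' (Sum.inl u) = ρ u ++ [Sym.star] := fun u hu =>
    (if_pos hu).trans (by rw [hu])
  have hρ2 : ∀ u, ρ u ≠ w a → ρ' (Sum.inl u) = ρ u ++ [Sym.digit 1] := fun u hu => if_neg hu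
  have hcc : ∀ u z s t, Compat (ρ u) (ρ z) → (s = t ∨ s = Sym.star ∨ t = Sym.star) →
      Compat (ρ u ++ [s]) (ρ z ++ [t]) := fun u z s t huz hst =>
    (compat_concat ((h.fold_mem u).len.trans (h.fold_mem z).len.symm) (h.fold_mem u).ne_nil).2
      ⟨huz, hst⟩
  have hforms : ∀ x, Gam b (a + 1) w c x → x = w a ++ [Sym.star] ∨
      ∃ y d, Gam b a w c y ∧ y ≠ w a ∧ x = y ++ [Sym.digit d] ∧ (d = 1 ∨ ∃ hd : 2 ≤ d ∧ d ≤ b,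
        ∃ hy : G.SameComp (e (w a)) (e y) ∧ e y ≠ e (w a),
          e' x = Sum.inr (⟨e y, hy⟩, ⟨d, hd⟩)) := by
    intro x hx
    rcases hx.exists_concat_cases hW hc with hx | ⟨y, d, hd, hdb, hy, hyw, rfl⟩
    · exact Or.inl hx
    · refine Or.inr ⟨y, d, hy, hyw, rfl, ?_⟩
      rcases hd.eq_or_lt with hd | hd
      · exact Or.inl hd.symm
      · exact Or.inr ⟨⟨hd, hdb⟩, ⟨hsc y hy, hne y hy hyw⟩, he3 y _ d _⟩
  refine ⟨e', ρ', fun x hx => ?_, fun x hx => ?_, fun x hx => ?_, ?_, ?_, ?_, ?_, ?_⟩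
  · rcases hforms x hx with rfl | ⟨y, d, hy, hyw, rfl, rfl | ⟨hd, hy', hxe⟩⟩
    · rw [he1, reflect_label_self, h.label _ hwa]
    · rw [he2, reflect_label_sameComp (hne y hy hyw) (hsc y hy), h.label y hy]
    · rw [hxe, reflect_label_inr, h.label y hy]
  · rcases hforms x hx with rfl | ⟨y, d, hy, hyw, rfl, rfl | ⟨hd, hy', hxe⟩⟩
    · rw [he1]
      exact reflect_notMem_marked_inl.2 (h.unmarked _ hwa)
    · rw [he2]
      exact reflect_notMem_marked_inl.2 (h.unmarked y hy)
    · rw [hxe]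
      exact reflect_notMem_marked_inr _
  · rcases hforms x hx with rfl | ⟨y, d, hy, hyw, rfl, rfl | ⟨hd, hy', hxe⟩⟩
    · rw [he1, hρ1 _ (h.fold_self _ hwa), h.fold_self _ hwa]
    · rw [he2, hρ2 _ (by rwa [h.fold_self y hy]), h.fold_self y hy]
    · rw [hxe, hρr, h.fold_self y hy]
  · rintro (u | ⟨u, i⟩)
    · by_cases hu : ρ u = w a
      · rw [hρ1 u hu, hu]
        exact .concat_star hW hc
      · rw [hρ2 u hu]
        exact .concat_digit hW hc (h.fold_mem u) hu le_rfl hb1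
    · obtain ⟨y, hy, hyw, huy, hG, -⟩ := he3' u i
      rw [hρr]
      rwa [huy, h.fold_self y hy]
  -- Edges between original nodes and new copies start at the reflected node, whose string ends in a
  -- star and so tolerates any digit.
  · have hlr : ∀ u p, (G.reflect b (e (w a))).graph.Adj (Sum.inl u) (Sum.inr p) →
        Compat (ρ' (Sum.inl u)) (ρ' (Sum.inr p)) := by
      rintro u ⟨p, i⟩ hup
      obtain ⟨rfl, hadj⟩ := reflect_adj_inl_inr.1 hup
      obtain ⟨y, hy, hyw, huy, -⟩ := he3' p i
      rw [hρ1 _ (h.fold_self _ hwa), hρr]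
      refine hcc _ _ _ _ ((h.fold_adj _ _ hadj).resolve_left ?_) (Or.inr (Or.inl rfl))
      rw [h.fold_self _ hwa]
      show _ ≠ ρ p.1
      rw [huy, h.fold_self y hy]
      exact hyw.symm
    rintro (u | u) (z | z) huz
    · rcases h.fold_adj _ _ (reflect_adj_inl_inl.1 huz) with huz | huz
      · left
        show ite _ _ _ = ite _ _ _
        rw [huz]
      · right
        by_cases hu : ρ u = w a <;> by_cases hz : ρ z = w a
        · rw [hu, hz] at huz
          exact absurd rfl huz.1
        · rw [hρ1 u hu, hρ2 z hz]
          exact hcc _ _ _ _ huz (Or.inr (Or.inl rfl))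
        · rw [hρ2 u hu, hρ1 z hz]
          exact hcc _ _ _ _ huz (Or.inr (Or.inr rfl))
        · rw [hρ2 u hu, hρ2 z hz]
          exact hcc _ _ _ _ huz (Or.inl rfl)
    · exact Or.inr (hlr u z huz)
    · exact Or.inr (hlr z u huz.symm).symm
    · obtain ⟨h1, h2⟩ := reflect_adj_inr_inr.1 huz
      rw [hρr, hρr, h1]
      exact (h.fold_adj _ _ h2).imp (fun h => by rw [h]) fun h => hcc _ _ _ _ h (Or.inl rfl)
  · rintro x (u | ⟨u, i⟩) hx hxu hum
    · have hum := reflect_notMem_marked_inl.1 hum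
      rcases hforms x hx with rfl | ⟨y, d, hy, hyw, rfl, rfl | ⟨hd, hy', hxe⟩⟩
      · rw [he1] at hxu
        obtain ⟨z, hz, rfl⟩ := h.closed _ u hwa (reflect_adj_inl_inl.1 hxu) hum
        exact he2' z hz
      · rw [he2] at hxu
        obtain ⟨z, hz, rfl⟩ := h.closed _ u hy (reflect_adj_inl_inl.1 hxu) hum
        exact he2' z hz
      · rw [hxe] at hxu
        obtain ⟨rfl, -⟩ := reflect_adj_inl_inr.1 hxu.symm
        exact he2' _ hwa
    · obtain ⟨y, -, -, -, hG, hy⟩ := he3' u i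
      exact ⟨_, hG, hy⟩
  · have key : ∀ y d, Gam b a w c y → y ≠ w a → Compat (w a) y → 1 ≤ d → d ≤ b →
        (G.reflect b (e (w a))).graph.Adj (Sum.inl (e (w a))) (e' (y ++ [Sym.digit d])) := by
      intro y d hy hyw hwy h1 h2
      rcases h1.eq_or_lt with rfl | h1
      · rw [he2]
        exact reflect_adj_inl_inl.2 (h.adj _ _ hwa hy hwy)
      · rw [he3 y ⟨hsc y hy, hne y hy hyw⟩ d ⟨h1, h2⟩]
        exact reflect_adj_inl_inr.2 ⟨rfl, h.adj _ _ hwa hy hwy⟩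
    intro x y hx hy hxy
    rcases hx.exists_concat_cases hW hc with rfl | ⟨x, d, hd, hdb, hx', hxw, rfl⟩ <;>
      rcases hy.exists_concat_cases hW hc with rfl | ⟨y, k, hk, hkb, hy', hyw, rfl⟩
    · exact absurd rfl hxy.1
    · rw [compat_concat (hwa.len.trans hy'.len.symm) hwa.ne_nil] at hxy
      rw [he1]
      exact key y k hy' hyw hxy.1 hk hkb
    · rw [compat_concat (hx'.len.trans hwa.len.symm) hx'.ne_nil] at hxy
      rw [he1]
      exact (key x d hx' hxw hxy.1.symm hd hdb).symm
    · rw [compat_concat (hx'.len.trans hy'.len.symm) hx'.ne_nil] at hxy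
      obtain ⟨hxy, hdk⟩ := hxy
      obtain rfl : d = k := by simpa using hdk
      rcases hd.eq_or_lt with rfl | hd
      · rw [he2, he2]
        exact reflect_adj_inl_inl.2 (h.adj _ _ hx' hy' hxy)
      · rw [he3 x ⟨hsc x hx', hne x hx' hxw⟩ d ⟨hd, hdb⟩,
          he3 y ⟨hsc y hy', hne y hy' hyw⟩ d ⟨hd, hdb⟩]
        exact reflect_adj_inr_inr.2 ⟨rfl, h.adj _ _ hx' hy' hxy⟩
  · rintro x (u | u) hx hxs hxu
    · refine reflect_notMem_marked_inl.2 ?_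
      rcases hforms x hx with rfl | ⟨y, d, hy, hyw, rfl, rfl | ⟨hd, hy', hxe⟩⟩
      · simp at hxs
      · rw [he2] at hxu
        exact h.leaf y u hy (fun hh => hxs (by simp [hh])) (reflect_adj_inl_inl.1 hxu)
      · rw [hxe] at hxu
        obtain ⟨rfl, -⟩ := reflect_adj_inl_inr.1 hxu.symm
        exact h.unmarked _ hwa
    · exact reflect_notMem_marked_inr _

theorem initialGraph (hx : ∀ x, P x ↔ x = [Sym.digit 1] ∨ x = [Sym.digit 2]) :
    ∃ e ρ, Comp CTree.initialGraph P e ρ := by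
  have h12 : Compat [Sym.digit 1] [Sym.digit 2] := ⟨by simp, fun j => Or.inl (by simp)⟩
  let e : Str → Bool := fun x => decide (x = [Sym.digit 2])
  let ρ : Bool → Str := fun u => if u then [Sym.digit 2] else [Sym.digit 1]
  refine ⟨e, ρ, ?_, fun _ _ => id, ?_, ?_, ?_, ?_, ?_, fun _ _ _ _ _ => id⟩
  · intro x h
    rcases (hx x).1 h with rfl | rfl <;> simp [CTree.initialGraph, e]
  · intro x h
    rcases (hx x).1 h with rfl | rfl <;> simp [e, ρ]
  · intro u
    rw [hx]
    rcases u <;> simp [ρ]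
  · rintro (_ | _) (_ | _) h
    · exact Or.inl rfl
    · right; simpa [ρ] using h12
    · right; simpa [ρ] using h12.symm
    · exact Or.inl rfl
  · rintro x (_ | _) - - -
    · exact ⟨[Sym.digit 1], (hx _).2 (Or.inl rfl), by simp [e]; rfl⟩
    · exact ⟨[Sym.digit 2], (hx _).2 (Or.inr rfl), by simp [e]; rfl⟩
  · intro x y h h' hxy
    show decide _ ≠ decide _
    rcases (hx x).1 h with rfl | rfl <;> rcases (hx y).1 h' with rfl | rfl
    · exact absurd rfl hxy.1
    · simp
    · simp
    · exact absurd rfl hxy.1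

end Comp

end CTree

/-! ### The component belonging to a node of a construction tree. -/

namespace CTree

open scoped Classical
open LTree MarkedGraph

namespace Layering

variable {T : LTree} {b : ℕ} (L : Layering T b)

/-- The label of the `j`-th reflect node above `t`. -/
noncomputable def wt (t : T.V) (j : ℕ) : Str := T.label (L.anc t (L.nthR j))

/-- The symbol that the labels below `t` have at the index of the `j`-th reflect node above `t`,
if the matching split node is above `t`. -/
noncomputable def ct (t : T.V) (j : ℕ) : Option Sym :=
  if L.φ (L.nthR j) < L.dep t then (T.label t)[j + 1]? else none

/-- The labels in the component that is processed at the node `t`. -/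
def CompLabel (t : T.V) : Str → Prop := Gam b (L.rk (L.dep t)) (L.wt t) (L.ct t)

include L

theorem exists_reflect_of_lt_rk {t : T.V} {j : ℕ} (hj : j < L.rk (L.dep t)) :
    ∃ u, L.R (L.dep u) ∧ T.Desc u t ∧ L.dep u < L.dep t ∧ L.rk (L.dep u) = j := by
  obtain ⟨h1, h2, h3⟩ := L.nthR_spec hj
  have := L.anc_spec t (L.nthR j) (L.R_pos _ h2) h1.le
  exact ⟨L.anc t (L.nthR j), this.2.symm ▸ h2, this.1, this.2.symm ▸ h1, this.2.symm ▸ h3⟩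

theorem wt_rk {t u : T.V} (hu : L.R (L.dep u)) (hut : T.Desc u t) :
    L.wt t (L.rk (L.dep u)) = T.label u := by
  rw [wt, L.nthR_rk hu, L.eq_anc hut]

theorem ct_rk_of_lt {t u : T.V} (hu : L.R (L.dep u)) (h : L.φ (L.dep u) < L.dep t) :
    L.ct t (L.rk (L.dep u)) = (T.label t)[L.rk (L.dep u) + 1]? := by
  rw [ct, L.nthR_rk hu, if_pos h]

theorem ct_rk_of_le {t u : T.V} (hu : L.R (L.dep u)) (h : L.dep t ≤ L.φ (L.dep u)) :
    L.ct t (L.rk (L.dep u)) = none := by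
  rw [ct, L.nthR_rk hu, if_neg h.not_gt]

/-- `Gam` speaks about numbers of reflect layers; here its conditions refer to the reflect nodes
strictly above `t` instead, open or closed according to whether `t` lies beyond their split layers.
-/
theorem compLabel_iff {t : T.V} {x : Str} : L.CompLabel t x ↔
    x ∈ XStr b ∧ x.length = L.rk (L.dep t) + 1 ∧
    ∀ u, L.R (L.dep u) → T.Desc u t → L.dep u < L.dep t →
      (L.dep t ≤ L.φ (L.dep u) →
        (T.label u <+: x ↔ x[L.rk (L.dep u) + 1]? = some Sym.star)) ∧
      (L.φ (L.dep u) < L.dep t → ¬ T.label u <+: x ∧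
        x[L.rk (L.dep u) + 1]? = (T.label t)[L.rk (L.dep u) + 1]?) := by
  constructor
  · intro h
    refine ⟨h.mem, h.len, fun u hu hut hlt => ⟨fun hφ => ?_, fun hφ => ?_⟩⟩
    · have := h.opn _ (L.rk_lt hu hlt) (L.ct_rk_of_le hu hφ)
      rwa [L.wt_rk hu hut] at this
    · obtain ⟨d, -, -, hd⟩ := L.exists_digit_of_lt hu t hφ
      have := h.cls _ (L.rk_lt hu hlt) _ ((L.ct_rk_of_lt hu hφ).trans hd)
      rwa [L.wt_rk hu hut, ← hd] at this
  · rintro ⟨h1, h2, h3⟩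
    refine ⟨h1, h2, fun j hj hc => ?_, fun j hj s hc => ?_⟩
    all_goals
      obtain ⟨u, hu, hut, hlt, rfl⟩ := L.exists_reflect_of_lt_rk hj
      rw [L.wt_rk hu hut]
      rcases lt_or_ge (L.φ (L.dep u)) (L.dep t) with hφ | hφ
    · obtain ⟨d, -, -, hd⟩ := L.exists_digit_of_lt hu t hφ
      rw [L.ct_rk_of_lt hu hφ, hd] at hc
      cases hc
    · exact (h3 u hu hut hlt).1 hφ
    · rw [L.ct_rk_of_lt hu hφ] at hc
      rw [← hc]
      exact (h3 u hu hut hlt).2 hφ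
    · rw [L.ct_rk_of_le hu hφ] at hc
      cases hc

/-- If the split node that matches `u` lies above `t`, and `v` is a reflect node between `u` and
`t` whose matching split node does not, then `v` lies below the former. -/
theorem φ_lt_of_open {u v t : T.V} (hu : L.R (L.dep u)) (hv : L.R (L.dep v))
    (huv : L.dep u < L.dep v) (h : L.φ (L.dep u) < L.dep t) (h' : L.dep t ≤ L.φ (L.dep v)) :
    L.φ (L.dep u) < L.dep v := by
  by_contra hlt
  have hne : L.dep v ≠ L.φ (L.dep u) := fun hh => L.φ_not _ hu (hh ▸ hv)
  have := L.nested _ _ hu hv huv (by omega)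
  omega

theorem eq_root_of_rk {u : T.V} (hu : L.R (L.dep u)) (h : L.rk (L.dep u) = 0) : u = L.root := by
  refine L.eq_root u (L.rk_inj hu L.R_one ?_)
  rw [h, L.rk_one]

/-- Only `cons` uses the nesting: by `φ_lt_of_open` an open reflect node lies below the split layer
of a closed earlier one, where the digit is already fixed. -/
theorem wf (t : T.V) : WF b (L.rk (L.dep t)) (L.wt t) (L.ct t) where
  two_le := by have := L.three_le; omega
  len j hj := by
    obtain ⟨u, hu, hut, hlt, rfl⟩ := L.exists_reflect_of_lt_rk hj
    rw [L.wt_rk hu hut, L.len_R u hu]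
  mem j hj := by
    obtain ⟨u, hu, hut, hlt, rfl⟩ := L.exists_reflect_of_lt_rk hj
    rw [L.wt_rk hu hut]
    exact ⟨L.mem_X u, L.no_star u hu⟩
  zero ha := by
    obtain ⟨u, hu, hut, hlt, h⟩ := L.exists_reflect_of_lt_rk ha
    rw [← h, L.wt_rk hu hut, L.eq_root_of_rk hu h, L.label_root]
  indep i j hij hj := by
    obtain ⟨u, hu, hut, hlt, rfl⟩ := L.exists_reflect_of_lt_rk hj
    obtain ⟨v, hv, hvt, hlt', rfl⟩ := L.exists_reflect_of_lt_rk (hij.trans hj)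
    rw [L.wt_rk hu hut, L.wt_rk hv hvt]
    intro h
    rw [L.indep v u hv hu h] at hij
    omega
  open_zero ha := by
    obtain ⟨u, hu, hut, hlt, h⟩ := L.exists_reflect_of_lt_rk ha
    rw [← h]
    refine L.ct_rk_of_le hu ?_
    rw [L.eq_root_of_rk hu h, L.dep_root, L.φ_one]
    exact L.dep_le t
  digit j hj s hs := by
    obtain ⟨u, hu, hut, hlt, rfl⟩ := L.exists_reflect_of_lt_rk hj
    rcases lt_or_ge (L.φ (L.dep u)) (L.dep t) with hφ | hφ
    · obtain ⟨d, h1, h2, hd⟩ := L.exists_digit_of_lt hu t hφ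
      rw [L.ct_rk_of_lt hu hφ, hd] at hs
      exact ⟨d, h1, h2, (Option.some.inj hs).symm⟩
    · rw [L.ct_rk_of_le hu hφ] at hs
      cases hs
  cons i j hij hj hcj s hs := by
    obtain ⟨v, hv, hvt, hlt, rfl⟩ := L.exists_reflect_of_lt_rk hj
    obtain ⟨u, hu, hut, hlt', rfl⟩ := L.exists_reflect_of_lt_rk (hij.trans hj)
    have hvφ : L.dep t ≤ L.φ (L.dep v) := by
      by_contra hφ
      obtain ⟨d, -, -, hd⟩ := L.exists_digit_of_lt hv t (not_le.1 hφ)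
      rw [L.ct_rk_of_lt hv (not_le.1 hφ), hd] at hcj
      cases hcj
    have huφ : L.φ (L.dep u) < L.dep t := by
      by_contra hφ
      rw [L.ct_rk_of_le hu (not_lt.1 hφ)] at hs
      cases hs
    rw [L.ct_rk_of_lt hu huφ] at hs
    rw [L.wt_rk hv hvt, ← hs]
    exact (L.digit_eq_of_desc hu (L.φ_lt_of_open hu hv (L.lt_of_rk_lt hij) huφ hvφ) hvt).symm

/-- The reflect node that matches a split node. -/
theorem exists_mate (t : T.V) (ht : ¬ L.R (L.dep t)) :
    ∃ u, L.R (L.dep u) ∧ T.Desc u t ∧ L.dep u < L.dep t ∧ L.φ (L.dep u) = L.dep t ∧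
      (T.label t)[L.rk (L.dep u) + 1]? = some Sym.star ∧
      ∀ k < L.rk (L.dep u) + 1, (T.label t)[k]? = (T.label u)[k]? := by
  obtain ⟨i, hi, h⟩ := L.φ_surj _ (L.dep_pos t) (L.dep_le t) ht
  have hlt := L.φ_lt i hi
  obtain ⟨h1, h2⟩ := L.anc_spec t i (L.R_pos i hi) (by omega)
  have := L.star_S t _ i hi h.symm h2 h1
  refine ⟨L.anc t i, h2.symm ▸ hi, h1, by omega, by rw [h2, h], ?_⟩
  rwa [h2]

/-- The node on which `t` operates lies in the component of `t`. For a reflect node this is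
independence and the absence of stars. The label of a split node follows that of its mate up to the
star and has no other star. -/
theorem compLabel_label (t : T.V) : L.CompLabel t (T.label t) := by
  refine L.compLabel_iff.2 ⟨L.mem_X t, L.len_label t, fun u hu hut hlt => ?_⟩
  by_cases ht : L.R (L.dep t)
  · have hp : ¬ T.label u <+: T.label t := fun h => by
      rw [L.indep u t hu ht h] at hlt
      omega
    exact ⟨fun _ => ⟨fun h => absurd h hp, fun h =>
      absurd h (star_notMem_iff.1 (L.no_star t ht) _)⟩, fun _ => ⟨hp, rfl⟩⟩
  · obtain ⟨v, hv, hvt, hlt', hφ, hst, hpre⟩ := L.exists_mate t ht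
    -- If `u` is above the mate `v`, its label would be a final substring of that of `v`; if it is
    -- below, its label would contain the star of `t`.
    have hp : T.label u <+: T.label t ↔ u = v := by
      constructor
      · intro h
        rw [prefix_iff_forall, L.len_R u hu] at h
        rcases lt_trichotomy (L.rk (L.dep u)) (L.rk (L.dep v)) with h1 | h1 | h1
        · refine L.indep u v hu hv (prefix_iff_forall.2 fun k hk => ?_)
          rw [L.len_R u hu] at hk
          rw [← hpre k (by omega), h k hk]
        · exact L.anc_unique hut hvt (L.rk_inj hu hv h1)
        · have := h (L.rk (L.dep v) + 1) (by omega)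
          rw [hst] at this
          exact absurd this.symm (star_notMem_iff.1 (L.no_star u hu) _)
      · rintro rfl
        rw [prefix_iff_forall, L.len_R u hu]
        exact hpre
    refine ⟨fun _ => hp.trans ⟨fun h => h ▸ hst, fun h => ?_⟩, fun h => ⟨fun h' => ?_, rfl⟩⟩
    · have := (L.star_unique t ht).unique h hst
      exact L.anc_unique hut hvt (L.rk_inj hu hv (by omega))
    · rw [hp.1 h'] at h
      omega

/-- The paths separate at a split node, and the position of its mate is closed with different
digits. -/
theorem compLabel_disjoint {t t' : T.V} (h : ¬ T.Desc t t') (h' : ¬ T.Desc t' t) {x : Str}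
    (hx : L.CompLabel t x) : ¬ L.CompLabel t' x := fun hx' => by
  obtain ⟨i, s, hi, hs, hst, hst', hlt, hlt', hne⟩ := L.diverge h h'
  have hφ := L.φ_lt i hi
  obtain ⟨u, h1, rfl⟩ := L.exists_anc s i (L.R_pos i hi) (by omega)
  have h3 := ((L.compLabel_iff.1 hx).2.2 _ hi (h1.trans hst) (by omega)).2 hlt
  have h4 := ((L.compLabel_iff.1 hx').2.2 _ hi (h1.trans hst') (by omega)).2 hlt'
  exact hne (h3.2.symm.trans h4.2)

section Child

variable {L}

theorem wt_child {t t' : T.V} (h : T.Child t t') {j : ℕ} (hj : j < L.rk (L.dep t)) :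
    L.wt t' j = L.wt t j := by
  obtain ⟨u, hu, hut, hlt, rfl⟩ := L.exists_reflect_of_lt_rk hj
  rw [L.wt_rk hu hut, L.wt_rk hu (hut.trans (.single h))]

theorem ct_child {t t' : T.V} (h : T.Child t t') {j : ℕ} (hj : j < L.rk (L.dep t))
    (hne : L.φ (L.nthR j) ≠ L.dep t) : L.ct t' j = L.ct t j := by
  obtain ⟨u, hu, hut, hlt, rfl⟩ := L.exists_reflect_of_lt_rk hj
  rw [L.nthR_rk hu] at hne
  have := L.dep_child _ _ h
  rcases lt_or_ge (L.φ (L.dep u)) (L.dep t) with hφ | hφ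
  · rw [L.ct_rk_of_lt hu hφ, L.ct_rk_of_lt hu (by omega), L.digit_eq_of_desc hu hφ (.single h)]
  · rw [L.ct_rk_of_le hu hφ, L.ct_rk_of_le hu (by omega)]

theorem exists_comp_reflect {t t' : T.V} (ht : L.R (L.dep t)) (h : T.Child t t')
    {G : MarkedGraph} {e : Str → G.V} {ρ : G.V → Str} (hC : Comp G (L.CompLabel t) e ρ) :
    ∃ e' ρ', Comp (G.reflect b (e (T.label t))) (L.CompLabel t') e' ρ' := by
  have hd := L.dep_child _ _ h
  have hrk : L.rk (L.dep t') = L.rk (L.dep t) + 1 := by rw [hd, L.rk_succ_R ht]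
  have hW := L.wf t'
  rw [hrk] at hW
  have hw : L.wt t' (L.rk (L.dep t)) = T.label t := L.wt_rk ht (.single h)
  have hc : L.ct t' (L.rk (L.dep t)) = none := L.ct_rk_of_le ht (by have := L.φ_lt _ ht; omega)
  have hce : ∀ j < L.rk (L.dep t), L.ct t' j = L.ct t j := fun j hj =>
    ct_child h hj fun hh => L.φ_not _ (L.nthR_spec hj).2.1 (hh ▸ ht)
  have heq : L.CompLabel t = Gam b (L.rk (L.dep t)) (L.wt t') (L.ct t') := funext fun x =>
    propext ⟨fun hx => hx.congr (fun j hj => (wt_child h hj).symm) fun j hj => (hce j hj).symm,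
      fun hx => hx.congr (fun j hj => wt_child h hj) hce⟩
  rw [heq] at hC
  have := hC.reflect_self hW hc
  rw [hw] at this
  unfold CompLabel
  rwa [hrk]

theorem exists_comp_split {t t' : T.V} (ht : ¬ L.R (L.dep t)) (h : T.Child t t')
    {G : MarkedGraph} {e : Str → G.V} {ρ : G.V → Str} (hC : Comp G (L.CompLabel t) e ρ) :
    ∃ e' ρ', Comp (G.split (e (T.label t))) (L.CompLabel t') e' ρ' := by
  have hd := L.dep_child _ _ h
  have hrk : L.rk (L.dep t') = L.rk (L.dep t) := by rw [hd, L.rk_succ_S ht]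
  obtain ⟨u, hu, hut, hlt, hφ, hst, -⟩ := L.exists_mate t ht
  have hku := L.rk_lt hu hlt
  have hW := L.wf t'
  rw [hrk] at hW
  have heq : L.CompLabel t = Gam b (L.rk (L.dep t)) (L.wt t') (L.ct t) := funext fun x =>
    propext ⟨fun hx => hx.congr (fun j hj => (wt_child h hj).symm) fun _ _ => rfl,
      fun hx => hx.congr (fun j hj => wt_child h hj) fun _ _ => rfl⟩
  have hW' : WF b (L.rk (L.dep t)) (L.wt t') (L.ct t) := by
    have := L.wf t
    have hw : ∀ j < L.rk (L.dep t), L.wt t' j = L.wt t j := fun j hj => wt_child h hj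
    refine ⟨this.two_le, fun j hj => hw j hj ▸ this.len j hj, fun j hj => hw j hj ▸ this.mem j hj,
      fun h0 => hw 0 h0 ▸ this.zero h0, fun i j hij hj => ?_, this.open_zero, this.digit,
      fun i j hij hj => hw j hj ▸ this.cons i j hij hj⟩
    rw [hw j hj, hw i (hij.trans hj)]
    exact this.indep i j hij hj
  have hG := L.compLabel_label t
  rw [heq] at hC hG
  obtain ⟨d, -, -, hd'⟩ := L.exists_digit_of_lt hu t' (by omega)
  -- A split node that matches the root lies in the last layer and has no child.
  have hpos : 0 < L.rk (L.dep u) := by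
    by_contra h0
    have := L.eq_root_of_rk hu (by omega)
    rw [this, L.dep_root, L.φ_one] at hφ
    exact L.not_child_of_dep_eq hφ.symm h
  have hother : ∀ j < L.rk (L.dep t), j ≠ L.rk (L.dep u) → L.ct t' j = L.ct t j := by
    refine fun j hj hj' => ct_child h hj fun hh => hj' ?_
    obtain ⟨v, hv, hvt, hlt', rfl⟩ := L.exists_reflect_of_lt_rk hj
    rw [L.nthR_rk hv] at hh
    rw [L.φ_inj _ _ hv hu (hh.trans hφ.symm)]
  -- Reflect layers between `u` and `t` have their split layers there too, by nestedness, and are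
  -- already closed.
  have hopen : ∀ j < L.rk (L.dep t), L.rk (L.dep u) < j → L.ct t j ≠ none := by
    intro j hj hj' hh
    obtain ⟨v, hv, hvt, hlt', rfl⟩ := L.exists_reflect_of_lt_rk hj
    have := L.nested _ _ hu hv (L.lt_of_rk_lt hj') (by omega)
    rw [L.ct_rk_of_lt hv (by omega)] at hh
    obtain ⟨d, -, -, hd⟩ := L.exists_digit_of_lt hv t (by omega)
    rw [hd] at hh
    cases hh
  obtain ⟨ρ', h'⟩ := hC.split_self hW' hW hpos hku (L.ct_rk_of_le hu hφ.ge)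
    ((L.ct_rk_of_lt hu (by omega)).trans hd') hother hopen hG hst
  unfold CompLabel
  rw [hrk]
  exact ⟨e, ρ', h'⟩

end Child

/-! ### Processing the nodes in an ordering -/

variable {vs : List T.V}

theorem mem_take_of_desc (hvs : T.IsOrdering vs) {i : ℕ} (hi : i < vs.length) {u : T.V}
    (hu : T.Desc u vs[i]) (hne : u ≠ vs[i]) : u ∈ vs.take i := by
  obtain ⟨k, hk, rfl⟩ := List.mem_iff_getElem.1 (hvs.2.1 u)
  rcases lt_trichotomy k i with h | rfl | h
  · exact List.mem_take_iff_getElem.2 ⟨k, by omega, rfl⟩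
  · exact absurd rfl hne
  · have := List.pairwise_iff_getElem.1 hvs.2.2 i k hi hk h
    rcases this with h' | h'
    · exact absurd (L.eq_of_desc hu (L.dep_le_of_desc h')) hne
    · exact absurd hu h'.2

theorem mem_take_of_desc_of_mem (hvs : T.IsOrdering vs) {i : ℕ} {u t : T.V} (hu : T.Desc u t)
    (ht : t ∈ vs.take i) : u ∈ vs.take i := by
  obtain ⟨k, hk, rfl⟩ := List.mem_take_iff_getElem.1 ht
  by_cases hne : u = vs[k]
  · rwa [hne]
  · exact (List.take_sublist_take_left (by omega)).subset (L.mem_take_of_desc hvs (by omega) hu hne)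

/-- The invariant concerns all nodes `t` that are unprocessed while their parents are processed.
Processing `vs[i]` turns its component into the one of each of its children. The other such `t` are
incomparable with `vs[i]`, so their label sets are disjoint from that of `vs[i]`, and their
components are not affected. -/
theorem process (hvs : T.IsOrdering vs) {i : ℕ} (hi : i ≤ vs.length) :
    (T.inputGraph b vs i).PrefixFree ∧
    ∀ t, t ∉ vs.take i → (∀ p, T.Child p t → p ∈ vs.take i) →
      ∃ e ρ, Comp (T.inputGraph b vs i) (L.CompLabel t) e ρ := by
  induction i with
  | zero =>
    refine ⟨?_, fun t _ ht => ?_⟩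
    · show CTree.initialGraph.PrefixFree
      rintro (_ | _) (_ | _) h
      · rfl
      · have : ([Sym.digit 1] : Str) <+: [Sym.digit 2] := h
        simp at this
      · have : ([Sym.digit 2] : Str) <+: [Sym.digit 1] := h
        simp at this
      · rfl
    · have htr : t = L.root := L.isRoot_iff.1 fun p hp => by simpa using ht p hp
      refine Comp.initialGraph fun x => ?_
      rw [L.compLabel_iff, htr, L.dep_root, L.rk_one]
      constructor
      · rintro ⟨h1, h2, -⟩
        obtain ⟨s, rfl⟩ := List.length_eq_one_iff.1 h2
        simpa using h1.1
      · intro h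
        refine ⟨?_, by rcases h with rfl | rfl <;> rfl, fun u hu _ hlt => ?_⟩
        · rcases h with rfl | rfl
          exacts [⟨Or.inl rfl, by simp⟩, ⟨Or.inr rfl, by simp⟩]
        · have := L.dep_pos u
          omega
  | succ i ih =>
    have hi' : i < vs.length := hi
    obtain ⟨hP, hC⟩ := ih hi'.le
    have htake : vs.take (i + 1) = vs.take i ++ [vs[i]] := List.take_succ_eq_append_getElem hi'
    have hnot : vs[i] ∉ vs.take i := fun h => by
      obtain ⟨k, hk, hk'⟩ := List.mem_take_iff_getElem.1 h
      have := hvs.1.getElem_inj_iff.1 hk'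
      omega
    obtain ⟨e, ρ, hCi⟩ := hC vs[i] hnot fun p hp => L.mem_take_of_desc hvs hi' (.single hp)
      fun h => by have := L.dep_child _ _ hp; rw [h] at this; omega
    have hlab := hCi.label _ (L.compLabel_label vs[i])
    have hG : T.inputGraph b vs (i + 1) = if T.IsReflect vs[i] then
        (T.inputGraph b vs i).reflect b (e (T.label vs[i])) else
        (T.inputGraph b vs i).split (e (T.label vs[i])) := by
      have h1 : T.inputGraph b vs (i + 1) = T.step b (T.inputGraph b vs i) vs[i] := by
        rw [inputGraph, htake, List.foldl_append]
        rfl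
      have h2 : ∃ x, (T.inputGraph b vs i).label x = T.label vs[i] := ⟨_, hlab⟩
      -- The node chosen by `step` is the one in the component, as labels are injective.
      have h3 : h2.choose = e (T.label vs[i]) := hP.injective (h2.choose_spec.trans hlab.symm)
      rw [h1, step, dif_pos h2, h3]
    refine ⟨?_, fun t ht hpar => ?_⟩
    · rw [hG]
      split_ifs
      exacts [hP.reflect, hP.split]
    · rw [htake, List.mem_append, not_or, List.mem_singleton] at ht
      by_cases hch : T.Child vs[i] t
      · rw [hG]
        by_cases hR : T.IsReflect vs[i]
        · rw [if_pos hR]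
          exact exists_comp_reflect (L.isReflect_iff.1 hR) hch hCi
        · rw [if_neg hR]
          exact exists_comp_split (fun h => hR (L.isReflect_iff.2 h)) hch hCi
      · have hpar' : ∀ p, T.Child p t → p ∈ vs.take i := fun p hp => by
          have := hpar p hp
          rw [htake, List.mem_append, List.mem_singleton] at this
          exact this.resolve_right fun h => hch (h ▸ hp)
        obtain ⟨e', ρ', hCt⟩ := hC t ht.1 hpar'
        -- Otherwise `vs[i]` would be above the processed parent of `t` and hence already processed.
        have h1 : ¬ T.Desc vs[i] t := fun h => by
          rcases h.eq_or_parent with h | ⟨p, h, hp⟩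
          · exact ht.2 h.symm
          · exact hnot (L.mem_take_of_desc_of_mem hvs h (hpar' p hp))
        have h2 : ¬ T.Desc t vs[i] := fun h => ht.1 (L.mem_take_of_desc hvs hi' h ht.2)
        rw [hG]
        by_cases hR : T.IsReflect vs[i]
        · rw [if_pos hR]
          exact hCi.reflect_other hCt (fun x hx => L.compLabel_disjoint h1 h2 hx)
            (L.compLabel_label _) b
        · rw [if_neg hR]
          refine ⟨e', ρ', hCt.split_other fun x hx hxe => ?_⟩
          have : x = T.label vs[i] := by rw [← hCt.label x hx, hxe, hlab]
          exact L.compLabel_disjoint h1 h2 (L.compLabel_label vs[i]) (this ▸ hx)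

theorem exists_comp (hvs : T.IsOrdering vs) {i : ℕ} (hi : i < vs.length) :
    ∃ e ρ, Comp (T.inputGraph b vs i) (L.CompLabel vs[i]) e ρ := by
  refine (L.process hvs hi.le).2 _ (fun h => ?_) fun p hp =>
    L.mem_take_of_desc hvs hi (.single hp) fun h => ?_
  · obtain ⟨k, hk, hk'⟩ := List.mem_take_iff_getElem.1 h
    have := hvs.1.getElem_inj_iff.1 hk'
    omega
  · have := L.dep_child _ _ hp
    rw [h] at this
    omega

theorem processWellDefined : T.ProcessWellDefined b := by
  intro vs hvs i hi
  obtain ⟨e, ρ, hC⟩ := L.exists_comp hvs hi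
  have hG := L.compLabel_label vs[i]
  have hlab := hC.label _ hG
  refine ⟨e (T.label vs[i]), hlab, fun y hy => ((L.process hvs hi.le).1).injective
    (hy.trans hlab.symm), hC.unmarked _ hG, fun hR => ?_, fun hR hpos => ?_⟩
  · exact hC.isLeaf (L.wf _) hG (L.no_star _ (L.isReflect_iff.1 hR))
  · have hR := L.isReflect_iff.1 hR
    refine (hC.isTwoLeaf_iff (L.wf _) hG).2 ⟨L.no_star _ hR,
      hG.getElem_zero_of_notMem_star (L.wf _) ?_ (L.no_star _ hR)⟩
    -- The root comes first in every ordering, and it is the only reflect node whose label may start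
    -- with `1`.
    have hne : L.root ≠ vs[i] := fun h => by
      have h0 : T.Desc vs[i] vs[0] := h ▸ L.desc_root _
      rcases List.pairwise_iff_getElem.1 hvs.2.2 0 i (by omega) hi hpos with h' | h'
      · have := L.eq_of_desc h0 (L.dep_le_of_desc h')
        have := hvs.1.getElem_inj_iff.1 this
        omega
      · exact h'.2 h0
    by_contra hr
    exact hne (L.eq_root_of_rk hR (by omega)).symm

/-! ### Distances -/

/-- A version of distance-`D`-correctness in terms of labels only. -/
def SplitFar (D : ℕ) : Prop :=
  ∀ t, ¬ L.R (L.dep t) → ∀ x, Sym.star ∉ x → x[0]? = some (Sym.digit 2) →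
    ∀ n, Near (L.CompLabel t) n (T.label t) x → D ≤ n

theorem exists_ordering : ∃ vs, T.IsOrdering vs := by
  have := L.fin
  have := Fintype.ofFinite T.V
  let r : T.V → T.V → Prop := fun u v => L.dep u ≤ L.dep v
  have hp := List.pairwise_mergeSort (le := fun u v => decide (L.dep u ≤ L.dep v))
    (fun a b c h h' => by simp at *; omega) (fun a b => by simp; omega)
    (Finset.univ : Finset T.V).toList
  refine ⟨(Finset.univ : Finset T.V).toList.mergeSort fun u v => decide (L.dep u ≤ L.dep v),
    ?_, fun v => ?_, ?_⟩
  · rw [(List.mergeSort_perm _ _).nodup_iff]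
    exact Finset.nodup_toList _
  · rw [(List.mergeSort_perm _ _).mem_iff]
    simp
  · refine hp.imp fun {u v} h => ?_
    have h : L.dep u ≤ L.dep v := by simpa using h
    by_cases huv : T.Desc u v
    · exact Or.inl huv
    · exact Or.inr ⟨huv, fun h' => huv (L.eq_of_desc h' h ▸ .refl _)⟩

/-- A path of strings gives a walk in the graph that is no longer, and a shortest walk in the whole
graph is folded to a path of strings. As the string graph of `t` does not depend on the ordering, a
single ordering suffices in one direction. -/
theorem distanceCorrect_iff (D : ℕ) : T.DistanceCorrect b D ↔ L.SplitFar D := by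
  constructor
  · intro h t ht x hxs hx0 n hn
    obtain ⟨vs, hvs⟩ := L.exists_ordering
    obtain ⟨i, hi, rfl⟩ := List.mem_iff_getElem.1 (hvs.2.1 t)
    obtain ⟨e, ρ, hC⟩ := L.exists_comp hvs hi
    obtain ⟨p, hp⟩ := hC.exists_walk_of_near hn
    refine le_trans (h vs hvs i hi (fun hh => ht (L.isReflect_iff.1 hh)) (e (T.label vs[i]))
      (hC.label _ hn.left) (e x) ?_ (hC.sameComp_of_near hn)) ((SimpleGraph.dist_le p).trans hp)
    exact (hC.isTwoLeaf_iff (L.wf _) hn.right).2 ⟨hxs, hx0⟩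
  · intro h vs hvs i hi hs x hx u hu hxu
    obtain ⟨e, ρ, hC⟩ := L.exists_comp hvs hi
    have hG := L.compLabel_label vs[i]
    have hxe : x = e (T.label vs[i]) :=
      ((L.process hvs hi.le).1).injective (hx.trans (hC.label _ hG).symm)
    subst hxe
    obtain ⟨y, hy, rfl⟩ := hC.exists_of_sameComp hG hxu
    obtain ⟨p, hp⟩ := hxu.reachable.exists_walk_length_eq_dist
    have hn := hC.near_of_walk p
    rw [hC.fold_self _ hG, hC.fold_self _ hy] at hn
    have h2 := (hC.isTwoLeaf_iff (L.wf _) hy).1 hu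
    rw [← hp]
    exact h _ (fun hh => hs (L.isReflect_iff.2 hh)) y h2.1 h2.2 _ hn

/-- A string that takes the same turns as the path to a leaf has a final substring among the
labels of the reflect nodes on this path. -/
theorem exists_prefix_of_leaf {z : T.V} (hz : L.dep z = L.M) {x : Str} (hx : x ∈ XStrMinus b)
    (hl : L.rk L.M + 1 ≤ x.length)
    (hxz : ∀ i, L.R i → L.φ i < L.M → x[L.rk i + 1]? = (T.label z)[L.rk i + 1]?) :
    ∃ u, L.R (L.dep u) ∧ T.Desc u z ∧ T.label u <+: x := by
  -- Clearing yields a reflect node `u`. If it were off the path to `z`, the digit at the split node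
  -- where the paths separate would differ from that of `x`.
  obtain ⟨u, hu, hux⟩ := L.clear x hx fun v hv => by
    rw [L.len_R v hv]
    have := L.rk_mono (L.dep_le v)
    omega
  refine ⟨u, hu, ?_, hux⟩
  by_contra h
  have h' : ¬ T.Desc z u := fun hh => h (by
    rw [L.eq_of_desc hh (by rw [hz]; exact L.dep_le u)]; exact .refl _)
  obtain ⟨i, s, hi, hs, -, -, hlt, hlt', hne⟩ := L.diverge h h'
  obtain ⟨d, -, -, hd⟩ := L.exists_digit_of_lt hi u hlt
  refine hne ?_
  rw [← hxz i hi (by omega)]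
  exact (prefix_iff_forall.1 hux _ (List.getElem?_eq_some_iff.1 hd).1).symm

/-- A split label contains a star, so it is not `x`, and strings starting with the same digit are
not adjacent. If the split label starts with `1`, its star is at position `1`, so its mate is the
root and `t` is in the last layer. Then there is no `x`: by clearing, a reflect label above `t` is a
final substring of `x`, which forces a star if open and is forbidden if closed. -/
theorem splitFar_two : L.SplitFar 2 := by
  intro t ht x hxs hx0 n hn
  have hx := hn.right
  have hG := L.compLabel_label t
  obtain ⟨u, hu, hut, hlt, hφ, hst, hpre⟩ := L.exists_mate t ht
  have hmem : Sym.star ∈ T.label t := List.mem_iff_getElem?.2 ⟨_, hst⟩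
  by_cases h0 : (T.label t)[0]? = some (Sym.digit 2)
  · cases hn with
    | refl => exact absurd hmem hxs
    | @step n _ z _ _ hz hn =>
      cases hn with
      | step => omega
      | refl =>
        rcases hz with rfl | hz
        · exact absurd hmem hxs
        · exact absurd (h0.trans hx0.symm) hz.1
  · exfalso
    have hpos : 0 < L.rk (L.dep t) := lt_of_le_of_lt (Nat.zero_le _) (L.rk_lt hu hlt)
    have h1 := hG.getElem_one (L.wf t) hpos (hG.mem.1.resolve_right h0)
    have h2 := hG.star_unique (L.wf t) h1 hst
    have h3 := L.eq_root_of_rk hu (by omega)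
    rw [h3, L.dep_root, L.φ_one] at hφ
    obtain ⟨-, hlen, hxu⟩ := L.compLabel_iff.1 hx
    obtain ⟨v, hv, hvt, hvx⟩ := L.exists_prefix_of_leaf hφ.symm ⟨hx.mem, hxs⟩
      (by rw [hlen, hφ]) fun i hi hlt => by
        have := L.φ_lt i hi
        obtain ⟨h5, h6⟩ := L.anc_spec t i (L.R_pos i hi) (by omega)
        have := (hxu (L.anc t i) (h6.symm ▸ hi) h5 (by omega)).2 (by rw [h6]; omega)
        rw [h6] at this
        exact this.2
    have hlt' : L.dep v < L.dep t := (L.dep_le_of_desc hvt).lt_of_ne fun h => ht (h ▸ hv)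
    rcases lt_or_ge (L.φ (L.dep v)) (L.dep t) with h | h
    · exact ((hxu v hv hvt hlt').2 h).1 hvx
    · exact star_notMem_iff.1 hxs _ (((hxu v hv hvt hlt').1 h).1 hvx)

end Layering

end CTree

/-! ### The depth-first traversal: order of the visits, early ranks, free positions. -/

namespace CTree

open scoped Classical
open LTree

theorem idxOf_lt_idxOf_iff {α : Type*} [BEq α] [LawfulBEq α] {l : List α} {r : α → α → Prop} (hl : l.Pairwise r)
    (hr : ∀ x y, r x y → ¬ r y x) {x y : α} (hx : x ∈ l) (hy : y ∈ l) :
    l.idxOf x < l.idxOf y ↔ r x y := by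
  have h1 : ∀ {x y : α}, x ∈ l → y ∈ l → l.idxOf x < l.idxOf y → r x y := fun hx hy h => by
    have := List.pairwise_iff_getElem.1 hl _ _ (List.idxOf_lt_length_of_mem hx)
      (List.idxOf_lt_length_of_mem hy) h
    simpa using this
  refine ⟨h1 hx hy, fun h => ?_⟩
  by_contra hlt
  rcases (not_lt.1 hlt).lt_or_eq with h' | h'
  · exact hr _ _ h (h1 hy hx h')
  · rw [(List.idxOf_inj hy).1 h'] at h
    exact hr _ _ h h

set_option linter.unusedSectionVars false

namespace Layering

variable {T : LTree} {b : ℕ} (L : Layering T b)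

/-- `u` and `v` lie below different children of a split node, that of `u` coming first. -/
def Left (u v : T.V) : Prop :=
  ∃ s i d d', L.R i ∧ L.dep s = L.φ i ∧ T.Desc s u ∧ T.Desc s v ∧ L.φ i < L.dep u ∧
    L.φ i < L.dep v ∧ (T.label u)[L.rk i + 1]? = some (Sym.digit d) ∧
    (T.label v)[L.rk i + 1]? = some (Sym.digit d') ∧ d < d'

/-- The order in which the traversal makes its early and late visits. -/
def Before (q q' : T.V × Bool) : Prop :=
  (q.1 = q'.1 ∧ q.2 = false ∧ q'.2 = true) ∨ (q.1 ≠ q'.1 ∧ T.Desc q.1 q'.1 ∧ q.2 = false) ∨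
    (q.1 ≠ q'.1 ∧ T.Desc q'.1 q.1 ∧ q'.2 = true) ∨ L.Left q.1 q'.1

section

variable {L} {u v : T.V}

theorem Left.not_desc (h : L.Left u v) : ¬ T.Desc u v := fun huv => by
  obtain ⟨s, i, d, d', hi, hs, hsu, hsv, hu, hv, hd, hd', hlt⟩ := h
  have := L.digit_eq_of_desc hi hu huv
  rw [hd, hd'] at this
  simp at this
  omega

theorem Left.not_desc' (h : L.Left u v) : ¬ T.Desc v u := fun huv => by
  obtain ⟨s, i, d, d', hi, hs, hsu, hsv, hu, hv, hd, hd', hlt⟩ := h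
  have := L.digit_eq_of_desc hi hv huv
  rw [hd, hd'] at this
  simp at this
  omega

theorem Left.ne (h : L.Left u v) : u ≠ v := fun huv => h.not_desc (huv ▸ .refl _)

/-- Compare the two separating split nodes. If one is deeper, it lies below a single child of the
other and cannot see two digits at its position; at equal depth the two inequalities of digits
contradict each other. -/
theorem Left.asymm (h : L.Left u v) : ¬ L.Left v u := by
  have key : ∀ {u v : T.V} {i : ℕ} {d d' : ℕ} {s' : T.V}, L.R i → T.Desc s' u → T.Desc s' v →
      (T.label u)[L.rk i + 1]? = some (Sym.digit d) →
      (T.label v)[L.rk i + 1]? = some (Sym.digit d') → d < d' → L.φ i < L.dep s' → False := by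
    intro u v i d d' s' hi hu hv hd hd' hlt h
    have h1 := L.digit_eq_of_desc hi h hu
    have h2 := L.digit_eq_of_desc hi h hv
    rw [← h2, hd, hd'] at h1
    simp at h1
    omega
  obtain ⟨s, i, d, d', hi, hs, hsu, hsv, hu, hv, hd, hd', hlt⟩ := h
  rintro ⟨s', i', k, k', hi', hs', hsv', hsu', hv', hu', hk, hk', hlt'⟩
  rcases lt_trichotomy (L.φ i) (L.φ i') with hh | hh | hh
  · exact key hi hsu' hsv' hd hd' hlt (by omega)
  · obtain rfl := L.φ_inj _ _ hi hi' hh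
    rw [hd] at hk'
    rw [hd'] at hk
    simp at hk hk'
    omega
  · exact key hi' hsv hsu hk hk' hlt' (by omega)

theorem Before.asymm {q q' : T.V × Bool} (h : L.Before q q') : ¬ L.Before q' q := by
  obtain ⟨u, β⟩ := q
  obtain ⟨v, γ⟩ := q'
  have hd : ∀ {u v : T.V}, u ≠ v → T.Desc u v → ¬ T.Desc v u := fun hne h h' =>
    hne (L.eq_of_desc h (L.dep_le_of_desc h'))
  rcases h with ⟨h1, h2, h3⟩ | ⟨h1, h2, h3⟩ | ⟨h1, h2, h3⟩ | h <;>
    rintro (⟨h1', h2', h3'⟩ | ⟨h1', h2', h3'⟩ | ⟨h1', h2', h3'⟩ | h') <;> dsimp only at *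
  · simp_all
  · exact h1' h1.symm
  · exact h1' h1.symm
  · exact h'.ne h1.symm
  · exact h1 h1'.symm
  · exact hd h1 h2 h2'
  · simp_all
  · exact h'.not_desc' h2
  · exact h1 h1'.symm
  · simp_all
  · exact hd h1 h2' h2
  · exact h'.not_desc h2
  · exact h.ne h1'.symm
  · exact h.not_desc' h2'
  · exact h.not_desc h2'
  · exact h.asymm h'

theorem Before.ne {q q' : T.V × Bool} (h : L.Before q q') : q ≠ q' := fun hh => by
  subst hh
  exact h.asymm h

end

include L

theorem isNthChild_iff {v w : T.V} {j : ℕ} : T.IsNthChild v j w ↔ T.Child v w ∧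
    ∃ i, L.R i ∧ L.dep v = L.φ i ∧ (T.label w)[L.rk i + 1]? = some (Sym.digit j) := by
  refine and_congr_right fun _ => ⟨?_, ?_⟩
  · rintro ⟨_, hs, h⟩
    obtain ⟨i, hi, hv, rfl⟩ := L.inSplitLayer_iff.1 hs
    exact ⟨i, hi, hv, h⟩
  · rintro ⟨i, hi, hv, h⟩
    exact ⟨_, L.inSplitLayer_iff.2 ⟨i, hi, hv, rfl⟩, h⟩

theorem mem_orderedChildren {v w : T.V} : w ∈ T.orderedChildren b v ↔ T.Child v w := by
  unfold orderedChildren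
  split_ifs with hR h
  · obtain ⟨c, hc⟩ := L.reflect_child v (L.isReflect_iff.1 hR)
    rw [List.mem_singleton, hc w, (hc _).1 h.choose_spec]
  · exact ⟨fun hh => by simp at hh, fun hh => absurd ⟨w, hh⟩ h⟩
  · rw [List.mem_filterMap]
    constructor
    · rintro ⟨j, -, hj⟩
      split_ifs at hj with h
      rw [← Option.some.inj hj]
      exact h.choose_spec.1
    · intro h
      have h1 := L.dep_child _ _ h
      have h2 := L.dep_le w
      obtain ⟨i, hi, hv⟩ := L.φ_surj _ (L.dep_pos v) (L.dep_le v) fun hh => hR (L.isReflect_iff.2 hh)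
      obtain ⟨d, hd1, hd2, hd⟩ := L.exists_digit hi w (by omega)
      have hd := hd w (.refl _)
      have hex : ∃ w, T.IsNthChild v d w := ⟨w, L.isNthChild_iff.2 ⟨h, i, hi, hv.symm, hd⟩⟩
      refine ⟨d, List.mem_range'_1.2 (by omega), ?_⟩
      rw [dif_pos hex]
      obtain ⟨h3, i', hi', hv', hd'⟩ := L.isNthChild_iff.1 hex.choose_spec
      obtain rfl := L.φ_inj _ _ hi hi' (hv.trans hv')
      exact congrArg some (L.digit_injective hi hv' h3 h (hd'.trans hd.symm))

theorem pairwise_orderedChildren (v : T.V) : (T.orderedChildren b v).Pairwise L.Left := by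
  unfold orderedChildren
  split_ifs with hR h
  · exact List.pairwise_singleton _ _
  · exact List.Pairwise.nil
  · rw [List.pairwise_filterMap]
    refine (List.pairwise_lt_range' 1).imp fun {j k} hjk w hw w' hw' => ?_
    split_ifs at hw with h
    split_ifs at hw' with h'
    obtain ⟨h1, i, hi, hv, hd⟩ := L.isNthChild_iff.1 h.choose_spec
    obtain ⟨h1', i', hi', hv', hd'⟩ := L.isNthChild_iff.1 h'.choose_spec
    obtain rfl := L.φ_inj _ _ hi hi' (hv.symm.trans hv')
    rw [Option.some.inj hw] at h1 hd
    rw [Option.some.inj hw'] at h1' hd'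
    have := L.dep_child _ _ h1
    have := L.dep_child _ _ h1'
    exact ⟨v, i, j, k, hi, hv, .single h1, .single h1', by omega, by omega, hd, hd', hjk⟩

/-- The hypothesis says that the recursion bound `n` exceeds the number of layers below `v`, so the
traversal is never cut short. -/
theorem visit_spec (n : ℕ) (v : T.V) (h : L.M + 1 ≤ L.dep v + n) :
    (∀ q, q ∈ T.visit b n v ↔ L.R (L.dep q.1) ∧ T.Desc v q.1) ∧
      (T.visit b n v).Pairwise L.Before := by
  induction n generalizing v with
  | zero =>
    have := L.dep_le v
    omega
  | succ n ih =>
    have ih : ∀ w, T.Child v w → (∀ q, q ∈ T.visit b n w ↔ L.R (L.dep q.1) ∧ T.Desc w q.1) ∧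
        (T.visit b n w).Pairwise L.Before := fun w hw => ih w (by
      have := L.dep_child _ _ hw
      omega)
    have hmem : ∀ q, q ∈ (T.orderedChildren b v).flatMap (T.visit b n) ↔
        L.R (L.dep q.1) ∧ T.Desc v q.1 ∧ v ≠ q.1 := by
      intro q
      rw [List.mem_flatMap]
      constructor
      · rintro ⟨w, hw, hq⟩
        have hw := L.mem_orderedChildren.1 hw
        obtain ⟨h1, h2⟩ := ((ih w hw).1 q).1 hq
        refine ⟨h1, (Desc.single hw).trans h2, fun hh => ?_⟩
        have := L.dep_child _ _ hw
        have := L.dep_le_of_desc h2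
        rw [← hh] at this
        omega
      · rintro ⟨h1, h2, h3⟩
        obtain ⟨w, hw, hwq⟩ := h2.eq_or_child.resolve_left h3
        exact ⟨w, L.mem_orderedChildren.2 hw, ((ih w hw).1 q).2 ⟨h1, hwq⟩⟩
    have hpair : ((T.orderedChildren b v).flatMap (T.visit b n)).Pairwise L.Before := by
      rw [List.pairwise_flatMap]
      refine ⟨fun w hw => (ih w (L.mem_orderedChildren.1 hw)).2, ?_⟩
      refine (L.pairwise_orderedChildren v).imp_of_mem fun {w w'} hw hw' hl q hq q' hq' => ?_
      obtain ⟨s, i, d, d', hi, hs, hsu, hsv, hu, hv, hd, hd', hlt⟩ := hl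
      have h1 := ((ih w (L.mem_orderedChildren.1 hw)).1 q).1 hq
      have h2 := ((ih w' (L.mem_orderedChildren.1 hw')).1 q').1 hq'
      refine Or.inr (Or.inr (Or.inr ⟨s, i, d, d', hi, hs, hsu.trans h1.2, hsv.trans h2.2,
        hu.trans_le (L.dep_le_of_desc h1.2), hv.trans_le (L.dep_le_of_desc h2.2), ?_, ?_, hlt⟩))
      · rw [L.digit_eq_of_desc hi hu h1.2, hd]
      · rw [L.digit_eq_of_desc hi hv h2.2, hd']
    unfold visit
    split_ifs with hR
    · constructor
      · rintro ⟨u, β⟩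
        rw [List.mem_cons, List.mem_append, hmem, List.mem_singleton]
        constructor
        · rintro (h | h | h)
          · obtain rfl := (Prod.ext_iff.1 h).1
            exact ⟨L.isReflect_iff.1 hR, .refl _⟩
          · exact ⟨h.1, h.2.1⟩
          · obtain rfl := (Prod.ext_iff.1 h).1
            exact ⟨L.isReflect_iff.1 hR, .refl _⟩
        · rintro ⟨h1, h2⟩
          by_cases hvu : v = u
          · subst hvu
            cases β <;> simp
          · exact Or.inr (Or.inl ⟨h1, h2, hvu⟩)
      · rw [List.pairwise_cons, List.pairwise_append]
        refine ⟨fun q hq => ?_, hpair, List.pairwise_singleton _ _, fun q hq q' hq' => ?_⟩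
        · rw [List.mem_append, hmem, List.mem_singleton] at hq
          rcases hq with hq | rfl
          · exact Or.inr (Or.inl ⟨hq.2.2, hq.2.1, rfl⟩)
          · exact Or.inl ⟨rfl, rfl, rfl⟩
        · rw [List.mem_singleton] at hq'
          subst hq'
          have := (hmem q).1 hq
          exact Or.inr (Or.inr (Or.inl ⟨this.2.2.symm, this.2.1, rfl⟩))
    · refine ⟨fun q => ?_, hpair⟩
      rw [hmem]
      refine ⟨fun h => ⟨h.1, h.2.1⟩, fun h => ⟨h.1, h.2, fun hh => hR (L.isReflect_iff.2 ?_)⟩⟩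
      rw [hh]
      exact h.1

theorem M_le_card : L.M ≤ Nat.card T.V := by
  have := L.fin
  obtain ⟨z, hz⟩ := L.exists_dep_eq L.M L.one_lt_M.le le_rfl
  have hinj : Function.Injective fun i : Fin L.M => L.anc z (i + 1) := by
    intro i j hij
    have h1 := (L.anc_spec z (i + 1) (by omega) (by omega)).2
    have h2 := (L.anc_spec z (j + 1) (by omega) (by omega)).2
    have hij : L.anc z (i + 1) = L.anc z (j + 1) := hij
    rw [hij, h2] at h1
    exact Fin.ext (by omega)
  simpa using Nat.card_le_card_of_injective _ hinj

/-- Since `Before` is asymmetric, sortedness turns positions in `Q` into relations between nodes of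
the tree; `M_le_card` ensures that the traversal is complete. -/
theorem Q_spec : (∀ q, q ∈ T.Q b ↔ L.R (L.dep q.1)) ∧ (T.Q b).Pairwise L.Before := by
  have hex : ∃ r, T.IsRoot r := ⟨L.root, L.isRoot_iff.2 rfl⟩
  have hr : hex.choose = L.root := L.isRoot_iff.1 hex.choose_spec
  have hQ : T.Q b = T.visit b (Nat.card T.V) L.root := by
    rw [Q, dif_pos hex, hr]
  rw [hQ]
  obtain ⟨h1, h2⟩ := L.visit_spec (Nat.card T.V) L.root (by
    rw [L.dep_root]
    have := L.M_le_card
    omega)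
  exact ⟨fun q => (h1 q).trans (and_iff_left (L.desc_root _)), h2⟩

theorem mem_Q {q : T.V × Bool} : q ∈ T.Q b ↔ L.R (L.dep q.1) := L.Q_spec.1 q

theorem Q_nodup : (T.Q b).Nodup := L.Q_spec.2.imp Before.ne

theorem R_Q {p : ℕ} (hp : p < (T.Q b).length) : L.R (L.dep (T.Q b)[p].1) :=
  L.mem_Q.1 (List.getElem_mem hp)

theorem mem_take_Q {p : ℕ} (hp : p < (T.Q b).length) {q : T.V × Bool} (hq : L.R (L.dep q.1)) :
    q ∈ (T.Q b).take p ↔ L.Before q (T.Q b)[p] := by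
  have hq := L.mem_Q.2 hq
  rw [← idxOf_lt_idxOf_iff L.Q_spec.2 (fun _ _ => Before.asymm) hq (List.getElem_mem hp),
    L.Q_nodup.idxOf_getElem p hp]
  constructor
  · intro h
    obtain ⟨k, hk, rfl⟩ := List.mem_take_iff_getElem.1 h
    rw [L.Q_nodup.idxOf_getElem k]
    omega
  · intro h
    exact List.mem_take_iff_getElem.2 ⟨_, by rw [lt_min_iff]; exact ⟨h, by omega⟩, by simp⟩

omit L in
theorem mem_of_mem_take {p : ℕ} {q : T.V × Bool} (L : Layering T b) (h : q ∈ (T.Q b).take p) :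
    L.R (L.dep q.1) := L.mem_Q.1 (List.mem_of_mem_take h)

/-- The nodes whose early, but not late, visit takes place before the visit `q`. -/
def Open (q : T.V × Bool) (u : T.V) : Prop :=
  L.R (L.dep u) ∧ T.Desc u q.1 ∧ (u ≠ q.1 ∨ q.2 = true)

theorem Open.not_mem {p : ℕ} (hp : p < (T.Q b).length) {u : T.V} (h : L.Open (T.Q b)[p] u) :
    (u, true) ∉ (T.Q b).take p := by
  rw [L.mem_take_Q hp h.1]
  rintro (⟨h1, h2, h3⟩ | ⟨h1, h2, h3⟩ | ⟨h1, h2, h3⟩ | h')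
  · simp at h2
  · simp at h3
  · exact h1 (L.eq_of_desc h.2.1 (L.dep_le_of_desc h2))
  · exact h'.not_desc h.2.1

theorem early_mem_take_iff {p : ℕ} (hp : p < (T.Q b).length) {u : T.V} (hu : L.R (L.dep u)) :
    (u, false) ∈ (T.Q b).take p ↔ L.Open (T.Q b)[p] u ∨ (u, true) ∈ (T.Q b).take p := by
  rw [L.mem_take_Q hp hu, L.mem_take_Q hp hu]
  constructor
  · rintro (⟨h1, h2, h3⟩ | ⟨h1, h2, h3⟩ | ⟨h1, h2, h3⟩ | h')
    · exact Or.inl ⟨hu, h1 ▸ .refl _, Or.inr h3⟩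
    · exact Or.inl ⟨hu, h2, Or.inl h1⟩
    · exact Or.inr (Or.inr (Or.inr (Or.inl ⟨h1, h2, h3⟩)))
    · exact Or.inr (Or.inr (Or.inr (Or.inr h')))
  · rintro (⟨-, h1, h2⟩ | ⟨h1, h2, h3⟩ | ⟨h1, h2, h3⟩ | ⟨h1, h2, h3⟩ | h')
    · by_cases hne : u = (T.Q b)[p].1
      · exact Or.inl ⟨hne, rfl, h2.resolve_left fun h => h hne⟩
      · exact Or.inr (Or.inl ⟨hne, h1, rfl⟩)
    · simp at h2
    · simp at h3
    · exact Or.inr (Or.inr (Or.inl ⟨h1, h2, h3⟩))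
    · exact Or.inr (Or.inr (Or.inr h'))

/-! ### Early ranks -/

omit L in
/-- The number of early visits among the first `p` visits. -/
noncomputable def earlyCount (T : LTree) (b p : ℕ) : ℕ :=
  (((T.Q b).take p).filter fun q => !q.2).length

theorem mem_early {l : List (T.V × Bool)} {u : T.V} :
    u ∈ (l.filter fun q => !q.2).map Prod.fst ↔ (u, false) ∈ l := by
  simp

theorem early_pairwise : (((T.Q b).filter fun q => !q.2).map Prod.fst).Pairwise
    fun u v => L.Before (u, false) (v, false) := by
  rw [List.pairwise_map]
  refine (L.Q_spec.2.filter _).imp_of_mem fun {q q'} hq hq' h => ?_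
  obtain ⟨u, β⟩ := q
  obtain ⟨v, γ⟩ := q'
  have h1 := (List.mem_filter.1 hq).2
  have h2 := (List.mem_filter.1 hq').2
  simp only [Bool.not_eq_eq_eq_not, Bool.not_true] at h1 h2
  subst h1 h2
  exact h

theorem earlyRank_lt_iff {u v : T.V} (hu : L.R (L.dep u)) (hv : L.R (L.dep v)) :
    T.earlyRank b u < T.earlyRank b v ↔ L.Before (u, false) (v, false) := by
  rw [earlyRank, earlyRank, Nat.add_lt_add_iff_right]
  exact idxOf_lt_idxOf_iff L.early_pairwise (fun _ _ => Before.asymm)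
    (L.mem_early.2 (L.mem_Q.2 hu)) (L.mem_early.2 (L.mem_Q.2 hv))

theorem earlyRank_inj {u v : T.V} (hu : L.R (L.dep u))
    (h : T.earlyRank b u = T.earlyRank b v) : u = v := by
  rw [earlyRank, earlyRank, Nat.add_right_cancel_iff] at h
  exact (List.idxOf_inj (L.mem_early.2 (L.mem_Q.2 hu))).1 h

theorem earlyRank_le_iff {p : ℕ} {u : T.V} :
    T.earlyRank b u ≤ earlyCount T b p ↔ (u, false) ∈ (T.Q b).take p := by
  rw [earlyRank, earlyCount, Nat.succ_le_iff]
  have hsplit : ((T.Q b).filter fun q => !q.2) =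
      (((T.Q b).take p).filter fun q => !q.2) ++ ((T.Q b).drop p).filter fun q => !q.2 := by
    rw [← List.filter_append, List.take_append_drop]
  rw [hsplit, List.map_append, List.idxOf_append, ← L.mem_early]
  split_ifs with h
  · have := List.idxOf_lt_length_of_mem h
    rw [List.length_map] at this
    simpa [h] using this
  · simp only [h, iff_false, not_lt]
    rw [List.length_map]
    omega

theorem exists_earlyRank_eq {p n : ℕ} (hn : 1 ≤ n) (h : n ≤ earlyCount T b p) :
    ∃ u, L.R (L.dep u) ∧ T.earlyRank b u = n := by
  have hlt : n - 1 < ((((T.Q b).filter fun q => !q.2).map Prod.fst)).length := by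
    rw [List.length_map]
    have := ((List.take_sublist p (T.Q b)).filter fun q => !q.2).length_le
    unfold earlyCount at h
    omega
  refine ⟨((((T.Q b).filter fun q => !q.2).map Prod.fst))[n - 1], ?_, ?_⟩
  · exact L.mem_Q.1 (L.mem_early.1 (List.getElem_mem hlt))
  · have hnd : ((((T.Q b).filter fun q => !q.2).map Prod.fst)).Nodup :=
      L.early_pairwise.imp fun {u v} h huv => h.ne (by rw [huv])
    rw [earlyRank, hnd.idxOf_getElem]
    omega

theorem earlyRank_pos (u : T.V) : 1 ≤ T.earlyRank b u := Nat.le_add_left _ _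

theorem earlyCount_succ {p : ℕ} (hp : p < (T.Q b).length) :
    earlyCount T b (p + 1) = earlyCount T b p + if (T.Q b)[p].2 then 0 else 1 := by
  rw [earlyCount, earlyCount, List.take_succ_eq_append_getElem hp, List.filter_append,
    List.length_append]
  cases h : (T.Q b)[p].2 <;> simp [h]

theorem earlyRank_getElem {p : ℕ} (hp : p < (T.Q b).length) (h : (T.Q b)[p].2 = false) :
    T.earlyRank b (T.Q b)[p].1 = earlyCount T b p + 1 := by
  have hq : ((T.Q b)[p].1, false) = (T.Q b)[p] := by rw [← h]
  have h1 := L.earlyRank_le_iff (p := p) (u := (T.Q b)[p].1)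
  have h2 := L.earlyRank_le_iff (p := p + 1) (u := (T.Q b)[p].1)
  rw [hq] at h1 h2
  have h3 : (T.Q b)[p] ∉ (T.Q b).take p := by
    rw [L.mem_take_Q hp (L.R_Q hp)]
    exact fun h => h.ne rfl
  have h4 : (T.Q b)[p] ∈ (T.Q b).take (p + 1) :=
    List.mem_take_iff_getElem.2 ⟨p, by omega, rfl⟩
  have h5 := h2.2 h4
  have h6 := mt h1.1 h3
  rw [L.earlyCount_succ hp, h] at h5
  simp at h5
  omega

theorem mem_lateRanks {p n : ℕ} :
    n ∈ T.lateRanks b p ↔ ∃ u, (u, true) ∈ (T.Q b).take p ∧ T.earlyRank b u = n := by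
  simp [lateRanks, List.mem_toFinset]

theorem earlyRank_mem_lateRanks {p : ℕ} {u : T.V} (hu : L.R (L.dep u)) :
    T.earlyRank b u ∈ T.lateRanks b p ↔ (u, true) ∈ (T.Q b).take p := by
  rw [L.mem_lateRanks]
  refine ⟨?_, fun h => ⟨u, h, rfl⟩⟩
  rintro ⟨v, hv, h⟩
  rwa [L.earlyRank_inj hu h.symm]

theorem zero_notMem_lateRanks {p : ℕ} : 0 ∉ T.lateRanks b p := fun h => by
  obtain ⟨u, -, h⟩ := L.mem_lateRanks.1 h
  have := L.earlyRank_pos u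
  omega

theorem early_of_late_mem_take {p : ℕ} {u : T.V} (h : (u, true) ∈ (T.Q b).take p) :
    (u, false) ∈ (T.Q b).take p := by
  have hu : L.R (L.dep u) := L.mem_of_mem_take h
  rcases lt_or_ge p (T.Q b).length with hp | hp
  · exact (L.early_mem_take_iff hp hu).2 (Or.inr h)
  · rw [List.take_of_length_le hp]
    exact L.mem_Q.2 hu

theorem le_earlyCount_of_mem_lateRanks {p n : ℕ} (h : n ∈ T.lateRanks b p) :
    n ≤ earlyCount T b p := by
  obtain ⟨u, hu, rfl⟩ := L.mem_lateRanks.1 h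
  exact L.earlyRank_le_iff.2 (L.early_of_late_mem_take hu)

theorem lateRanks_mono {p p' : ℕ} (h : p ≤ p') : T.lateRanks b p ⊆ T.lateRanks b p' := fun n hn => by
  obtain ⟨u, hu, rfl⟩ := L.mem_lateRanks.1 hn
  exact L.mem_lateRanks.2 ⟨u, (List.take_sublist_take_left h).subset hu, rfl⟩

/-- The positions `0` and the early ranks of the proper ancestors of `v` among the reflect nodes. -/
theorem card_ranks_above (v : T.V) {s : Finset ℕ} (hs : ∀ n, n ∈ s ↔ n = 0 ∨
    ∃ u, L.R (L.dep u) ∧ T.Desc u v ∧ u ≠ v ∧ T.earlyRank b u = n) :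
    s.card = L.rk (L.dep v) + 1 := by
  have hlt : ∀ {u}, T.Desc u v → u ≠ v → L.dep u < L.dep v := fun {u} h hne =>
    (L.dep_le_of_desc h).lt_of_ne fun hh => hne (L.eq_of_desc h hh.ge)
  have hfin : s = insert 0 ((Finset.range (L.rk (L.dep v))).image
      fun j => T.earlyRank b (L.anc v (L.nthR j))) := by
    ext n
    rw [hs, Finset.mem_insert, Finset.mem_image]
    refine or_congr_right ⟨?_, ?_⟩
    · rintro ⟨u, hu, huv, hne, rfl⟩
      refine ⟨L.rk (L.dep u), Finset.mem_range.2 (L.rk_lt hu (hlt huv hne)), ?_⟩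
      rw [L.nthR_rk hu, L.eq_anc huv]
    · rintro ⟨j, hj, rfl⟩
      obtain ⟨u, hu, huv, hlt, rfl⟩ := L.exists_reflect_of_lt_rk (Finset.mem_range.1 hj)
      refine ⟨u, hu, huv, fun h => by rw [h] at hlt; omega, ?_⟩
      rw [L.nthR_rk hu, L.eq_anc huv]
  rw [hfin, Finset.card_insert_of_notMem, Finset.card_image_of_injOn, Finset.card_range]
  · intro i hi j hj hij
    obtain ⟨u, hu, huv, -, rfl⟩ := L.exists_reflect_of_lt_rk (Finset.mem_range.1 hi)
    obtain ⟨w, hw, hwv, -, rfl⟩ := L.exists_reflect_of_lt_rk (Finset.mem_range.1 hj)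
    dsimp only at hij
    rw [L.nthR_rk hu, L.nthR_rk hw, L.eq_anc huv, L.eq_anc hwv] at hij
    rw [L.earlyRank_inj hu hij]
  · rw [Finset.mem_image]
    rintro ⟨j, -, h⟩
    have := L.earlyRank_pos (L.anc v (L.nthR j))
    omega

/-- Why spreading out works: the non-free positions before the early rank of an open node `w` are
`0` and the ranks of the reflect nodes above `w`. So the rank of `w` receives the symbol that `w`
owns in the unspread label. -/
theorem card_range_sdiff {p : ℕ} (hp : p < (T.Q b).length) {w : T.V}
    (hw : L.Open (T.Q b)[p] w) :
    (Finset.range (T.earlyRank b w) \ T.lateRanks b p).card = L.rk (L.dep w) + 1 := by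
  refine L.card_ranks_above w fun n => ?_
  have hwp := L.earlyRank_le_iff.2 ((L.early_mem_take_iff hp hw.1).2 (Or.inl hw))
  rw [Finset.mem_sdiff, Finset.mem_range]
  constructor
  · rintro ⟨h1, h2⟩
    refine n.eq_zero_or_pos.imp id fun hn => ?_
    -- A node visited early but not late is an ancestor of the current node, hence comparable with
    -- `w`; having the smaller rank, it is above `w`.
    obtain ⟨u, hu, rfl⟩ := L.exists_earlyRank_eq (p := p) hn (by omega)
    rw [L.earlyRank_mem_lateRanks hu] at h2
    have h3 := ((L.early_mem_take_iff hp hu).1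
      (L.earlyRank_le_iff.1 (by omega))).resolve_right h2
    have hne : u ≠ w := fun h => by rw [h] at h1; omega
    refine ⟨u, hu, ?_, hne, rfl⟩
    rcases le_total (L.dep u) (L.dep w) with h | h
    · exact L.desc_comparable h3.2.1 hw.2.1 h
    · have := L.desc_comparable hw.2.1 h3.2.1 h
      have h4 := (L.earlyRank_lt_iff hu hw.1).1 h1
      exact absurd (Or.inr (Or.inl ⟨hne.symm, this, rfl⟩)) h4.asymm
  · rintro (rfl | ⟨u, hu, huw, hne, rfl⟩)
    · exact ⟨L.earlyRank_pos w, L.zero_notMem_lateRanks⟩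
    · refine ⟨(L.earlyRank_lt_iff hu hw.1).2 (Or.inr (Or.inl ⟨hne, huw, rfl⟩)), ?_⟩
      rw [L.earlyRank_mem_lateRanks hu]
      refine Open.not_mem L hp ⟨hu, huw.trans hw.2.1, Or.inl fun h => hne ?_⟩
      refine L.eq_of_desc huw ?_
      rw [h]
      exact L.dep_le_of_desc hw.2.1

/-- The non-free positions up to the number of early visits are `0` and the ranks of the open nodes:
the reflect nodes properly above the current one and, at a late visit, the node itself, which takes
the extra star. -/
theorem length_add_card {p : ℕ} (hp : p < (T.Q b).length) :
    L.rk (L.dep (T.Q b)[p].1) + 1 + (if (T.Q b)[p].2 then 1 else 0) + (T.lateRanks b p).card =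
      earlyCount T b p + 1 := by
  have hsub : T.lateRanks b p ⊆ Finset.range (earlyCount T b p + 1) := fun n hn =>
    Finset.mem_range.2 (Nat.lt_succ_of_le (L.le_earlyCount_of_mem_lateRanks hn))
  have h1 := Finset.card_sdiff_add_card_eq_card hsub
  rw [Finset.card_range] at h1
  rw [← h1, Nat.add_right_cancel_iff]
  have hmem : ∀ n, n ∈ Finset.range (earlyCount T b p + 1) \ T.lateRanks b p ↔ n = 0 ∨
      ∃ u, L.Open (T.Q b)[p] u ∧ T.earlyRank b u = n := by
    intro n
    rw [Finset.mem_sdiff, Finset.mem_range, Nat.lt_succ_iff]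
    constructor
    · rintro ⟨h1, h2⟩
      refine n.eq_zero_or_pos.imp id fun hn => ?_
      obtain ⟨u, hu, rfl⟩ := L.exists_earlyRank_eq hn h1
      rw [L.earlyRank_mem_lateRanks hu] at h2
      exact ⟨u, ((L.early_mem_take_iff hp hu).1 (L.earlyRank_le_iff.1 h1)).resolve_right h2, rfl⟩
    · rintro (rfl | ⟨u, hu, rfl⟩)
      · exact ⟨Nat.zero_le _, L.zero_notMem_lateRanks⟩
      · exact ⟨L.earlyRank_le_iff.2 ((L.early_mem_take_iff hp hu.1).2 (Or.inl hu)),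
          fun h => Open.not_mem L hp hu ((L.earlyRank_mem_lateRanks hu.1).1 h)⟩
  cases hβ : (T.Q b)[p].2
  · rw [if_neg (by simp), add_zero]
    refine (L.card_ranks_above (T.Q b)[p].1 fun n => (hmem n).trans (or_congr_right ?_)).symm
    simp only [Open, hβ, Bool.false_eq_true, or_false, and_assoc]
  -- `card_ranks_above` counts proper ancestors only, so the rank of the node itself is set aside
  -- and added again.
  · rw [if_pos rfl]
    have hv : L.Open (T.Q b)[p] (T.Q b)[p].1 := ⟨L.R_Q hp, .refl _, Or.inr hβ⟩
    have h2 := L.card_ranks_above (T.Q b)[p].1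
      (s := (Finset.range (earlyCount T b p + 1) \ T.lateRanks b p).erase
        (T.earlyRank b (T.Q b)[p].1)) fun n => ?_
    · rw [← h2, Finset.card_erase_add_one]
      exact (hmem _).2 (Or.inr ⟨_, hv, rfl⟩)
    · rw [Finset.mem_erase, hmem]
      constructor
      · rintro ⟨h3, h4⟩
        refine h4.imp id ?_
        rintro ⟨u, hu, rfl⟩
        exact ⟨u, hu.1, hu.2.1, fun h => h3 (by rw [h]), rfl⟩
      · rintro (rfl | ⟨u, hu, huv, hne, rfl⟩)
        · exact ⟨by have := L.earlyRank_pos (T.Q b)[p].1; omega, Or.inl rfl⟩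
        · exact ⟨fun h => hne (L.earlyRank_inj hu h), Or.inr ⟨u, ⟨hu, huv, Or.inl hne⟩, rfl⟩⟩

/-- Padding and filling in terms of the tree. The listed positions (zero, ranks of proper ancestors,
own rank at a late visit, ranks of finished nodes) are all positions of the string. -/
theorem mem_layerLabels {p : Fin (T.Q b).length} {s : Str} : s ∈ T.layerLabels b p ↔
    s.length = earlyCount T b p + 1 ∧ s[0]? = (T.label (T.Q b)[p].1)[0]? ∧
    (∀ w, L.R (L.dep w) → T.Desc w (T.Q b)[p].1 → w ≠ (T.Q b)[p].1 →
      s[T.earlyRank b w]? = (T.label (T.Q b)[p].1)[L.rk (L.dep w) + 1]?) ∧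
    ((T.Q b)[p].2 = true → s[T.earlyRank b (T.Q b)[p].1]? = some Sym.star) ∧
    ∀ u, (u, true) ∈ (T.Q b).take p →
      ∃ d, 1 ≤ d ∧ d ≤ b ∧ s[T.earlyRank b u]? = some (Sym.digit d) := by
  have hp := p.2
  set v := (T.Q b)[p].1 with hv
  set y : Str := if (T.Q b)[p].2 then T.label v ++ [Sym.star] else T.label v with hy
  have hlab : T.layerLabels b p = fillings b (padded (T.lateRanks b p) y) := rfl
  have hvl : (T.label v).length = L.rk (L.dep v) + 1 := L.len_label v
  have hlen : y.length + (T.lateRanks b p).card = earlyCount T b p + 1 := by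
    rw [← L.length_add_card hp, hy]
    congr 1
    show _ = L.rk (L.dep v) + 1 + if (T.Q b)[p].2 then 1 else 0
    rw [← hvl]
    split_ifs <;> simp
  have hpad : ∀ n, (padded (T.lateRanks b p) y)[n]? = if n < earlyCount T b p + 1 then
      some (if n ∈ T.lateRanks b p then none else y[(Finset.range n \ T.lateRanks b p).card]?)
      else none := by
    intro n
    rw [padded, hlen, List.getElem?_map]
    by_cases h : n < earlyCount T b p + 1
    · rw [if_pos h, List.getElem?_range h]
      rfl
    · rw [if_neg h, List.getElem?_eq_none (by simpa using h)]
      rfl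
  have hyl : ∀ k < (T.label v).length, y[k]? = (T.label v)[k]? := by
    intro k hk
    rw [hy]
    split_ifs
    · exact List.getElem?_append_left hk
    · rfl
  have hv0 : ∃ c, (T.label v)[0]? = some c := ⟨_, List.getElem?_eq_getElem (by omega)⟩
  have hopen : ∀ w, L.Open (T.Q b)[p] w → T.earlyRank b w < earlyCount T b p + 1 ∧
      T.earlyRank b w ∉ T.lateRanks b p := fun w hw =>
    ⟨Nat.lt_succ_of_le (L.earlyRank_le_iff.2 ((L.early_mem_take_iff hp hw.1).2 (Or.inl hw))),
      fun h => Open.not_mem L hp hw ((L.earlyRank_mem_lateRanks hw.1).1 h)⟩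
  have hpo : ∀ w, L.Open (T.Q b)[p] w → (padded (T.lateRanks b p) y)[T.earlyRank b w]? =
      some (y[L.rk (L.dep w) + 1]?) := fun w hw => by
    rw [hpad, if_pos (hopen w hw).1, if_neg (hopen w hw).2, L.card_range_sdiff hp hw]
  have hanc : ∀ w, L.R (L.dep w) → T.Desc w v → w ≠ v →
      (padded (T.lateRanks b p) y)[T.earlyRank b w]? =
        some ((T.label v)[L.rk (L.dep w) + 1]?) ∧ L.rk (L.dep w) + 1 < (T.label v).length := by
    intro w hw hwv hne
    have hlt : L.dep w < L.dep v :=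
      (L.dep_le_of_desc hwv).lt_of_ne fun hh => hne (L.eq_of_desc hwv hh.ge)
    have := L.rk_lt hw hlt
    rw [hpo w ⟨hw, hwv, Or.inl hne⟩, hyl _ (by omega)]
    exact ⟨rfl, by omega⟩
  have hself : (T.Q b)[p].2 = true → (padded (T.lateRanks b p) y)[T.earlyRank b v]? =
      some (some Sym.star) := by
    intro hβ
    rw [hpo v ⟨L.R_Q hp, .refl _, Or.inr hβ⟩, hy, if_pos hβ, ← hvl, List.getElem?_concat_length]
  have hzero : (padded (T.lateRanks b p) y)[0]? = some ((T.label v)[0]?) := by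
    rw [hpad, if_pos (by omega), if_neg L.zero_notMem_lateRanks]
    simp only [Finset.range_zero, Finset.empty_sdiff, Finset.card_empty]
    rw [hyl 0 (by omega)]
  rw [hlab]
  constructor
  · rintro ⟨h1, h2, h3⟩
    refine ⟨?_, ?_, fun w hw hwv hne => ?_, fun hβ => h2 _ _ (hself hβ), fun u hu => h3 _ ?_⟩
    · rw [h1, padded, List.length_map, List.length_range, hlen]
    · obtain ⟨c, hc⟩ := hv0
      rw [hc] at hzero ⊢
      exact h2 _ _ hzero
    · obtain ⟨h4, h5⟩ := hanc w hw hwv hne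
      rw [List.getElem?_eq_getElem h5] at h4 ⊢
      exact h2 _ _ h4
    · rw [hpad, if_pos (Nat.lt_succ_of_le (L.earlyRank_le_iff.2 (L.early_of_late_mem_take hu))),
        if_pos ((L.earlyRank_mem_lateRanks (L.mem_of_mem_take hu)).2 hu)]
  · rintro ⟨h1, h2, h3, h4, h5⟩
    have hcases : ∀ (n : ℕ) (z : Option Sym), (padded (T.lateRanks b p) y)[n]? = some z →
        (z = s[n]? ∧ z ≠ none) ∨ (z = none ∧ ∃ d, 1 ≤ d ∧ d ≤ b ∧ s[n]? = some (Sym.digit d)) := by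
      intro n z hz
      have hn : n < earlyCount T b p + 1 := by
        by_contra hn
        rw [hpad, if_neg hn] at hz
        cases hz
      rcases n.eq_zero_or_pos with rfl | hpos
      · rw [hzero, Option.some_inj] at hz
        obtain ⟨c, hc⟩ := hv0
        exact Or.inl ⟨by rw [h2, hz], by rw [← hz, hc]; simp⟩
      · obtain ⟨u, hu, rfl⟩ := L.exists_earlyRank_eq hpos (Nat.lt_succ_iff.1 hn)
        rcases (L.early_mem_take_iff hp hu).1 (L.earlyRank_le_iff.1 (Nat.lt_succ_iff.1 hn)) with
          h | h
        · left
          by_cases huv : u = v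
          · subst huv
            have hβ := h.2.2.resolve_left fun h => h rfl
            rw [hself hβ, Option.some_inj] at hz
            rw [h4 hβ, ← hz]
            simp
          · obtain ⟨h6, h7⟩ := hanc u hu h.2.1 huv
            rw [h6, Option.some_inj] at hz
            rw [h3 u hu h.2.1 huv, ← hz, List.getElem?_eq_getElem h7]
            simp
        · right
          rw [hpad, if_pos hn, if_pos ((L.earlyRank_mem_lateRanks hu).2 h), Option.some_inj] at hz
          exact ⟨hz.symm, h5 u h⟩
    refine ⟨?_, fun n c hc => ?_, fun n hn => ?_⟩
    · rw [h1, padded, List.length_map, List.length_range, hlen]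
    · rcases hcases n _ hc with ⟨h, -⟩ | ⟨h, -⟩
      · exact h.symm
      · cases h
    · rcases hcases n _ hn with ⟨-, h⟩ | ⟨-, h⟩
      · exact absurd rfl h
      · exact h

end Layering

end CTree

/-! ### Positions of visits and the layers of `F(T)`. -/

namespace CTree

open scoped Classical
open LTree

set_option linter.unusedSectionVars false

namespace Layering

variable {T : LTree} {b : ℕ} (L : Layering T b)

/-- The position of a visit in `Q`. -/
noncomputable def pos (_ : Layering T b) (q : T.V × Bool) : ℕ := (T.Q b).idxOf q

/-- The indices of the reflect layers of `F(T)`. -/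
def RF (_ : Layering T b) (i : ℕ) : Prop :=
  ∃ p, ∃ h : p < (T.Q b).length, i = p + 1 ∧ (T.Q b)[p].2 = false

/-- The nesting of `F(T)`. -/
noncomputable def φF (i : ℕ) : ℕ :=
  if h : i - 1 < (T.Q b).length then L.pos ((T.Q b)[i - 1].1, true) + 1 else 0

include L

theorem pos_lt {q : T.V × Bool} (hq : L.R (L.dep q.1)) : L.pos q < (T.Q b).length :=
  List.idxOf_lt_length_of_mem (L.mem_Q.2 hq)

theorem getElem_pos {q : T.V × Bool} (hq : L.R (L.dep q.1)) :
    (T.Q b)[L.pos q]'(L.pos_lt hq) = q := List.getElem_idxOf _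

theorem pos_getElem {p : ℕ} (hp : p < (T.Q b).length) : L.pos (T.Q b)[p] = p :=
  L.Q_nodup.idxOf_getElem p hp

theorem pos_lt_iff {q q' : T.V × Bool} (hq : L.R (L.dep q.1)) (hq' : L.R (L.dep q'.1)) :
    L.pos q < L.pos q' ↔ L.Before q q' :=
  idxOf_lt_idxOf_iff L.Q_spec.2 (fun _ _ => Before.asymm) (L.mem_Q.2 hq) (L.mem_Q.2 hq')

theorem eq_of_pos_eq {q q' : T.V × Bool} (hq : L.R (L.dep q.1)) (h : L.pos q = L.pos q') :
    q = q' := (List.idxOf_inj (L.mem_Q.2 hq)).1 h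

theorem R_root : L.R (L.dep L.root) := by
  rw [L.dep_root]
  exact L.R_one

theorem pos_root : L.pos (L.root, false) = 0 := by
  have h0 : 0 < (T.Q b).length := (Nat.zero_le _).trans_lt (L.pos_lt (q := (_, false)) L.R_root)
  by_contra hne
  have h := (L.pos_lt_iff (q := (T.Q b)[0]) (L.R_Q h0) (q' := (L.root, false)) L.R_root).1 (by
    rw [L.pos_getElem h0]
    omega)
  rcases h with ⟨-, -, h⟩ | ⟨h1, h2, -⟩ | ⟨-, -, h⟩ | h
  · cases h
  · exact h1 (L.eq_of_desc h2 (L.dep_le_of_desc (L.desc_root _)))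
  · cases h
  · exact h.not_desc' (L.desc_root _)

theorem pos_root_late : L.pos (L.root, true) + 1 = (T.Q b).length := by
  have h0 := L.pos_lt (q := (L.root, true)) L.R_root
  by_contra hne
  have h1 : (T.Q b).length - 1 < (T.Q b).length := by omega
  have h := (L.pos_lt_iff (q := (L.root, true)) (q' := (T.Q b)[(T.Q b).length - 1]) L.R_root
      (L.R_Q h1)).1 (by
    rw [L.pos_getElem h1]
    omega)
  rcases h with ⟨-, h, -⟩ | ⟨-, -, h⟩ | ⟨h1, h2, -⟩ | h
  · cases h
  · cases h
  · exact h1 (L.eq_of_desc h2 (L.dep_le_of_desc (L.desc_root _))).symm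
  · exact h.not_desc (L.desc_root _)

theorem RF_succ {p : ℕ} (hp : p < (T.Q b).length) : L.RF (p + 1) ↔ (T.Q b)[p].2 = false := by
  constructor
  · rintro ⟨p', hp', h, h'⟩
    obtain rfl : p = p' := by omega
    exact h'
  · exact fun h => ⟨p, hp, rfl, h⟩

theorem φF_succ {p : ℕ} (hp : p < (T.Q b).length) :
    L.φF (p + 1) = L.pos ((T.Q b)[p].1, true) + 1 := by
  rw [φF]
  simp only [Nat.add_sub_cancel]
  rw [dif_pos hp]

theorem exists_of_RF {i : ℕ} (hi : L.RF i) : ∃ u, L.R (L.dep u) ∧ i = L.pos (u, false) + 1 ∧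
    L.φF i = L.pos (u, true) + 1 := by
  obtain ⟨p, hp, rfl, h⟩ := hi
  have hq : ((T.Q b)[p].1, false) = (T.Q b)[p] := by rw [← h]
  exact ⟨(T.Q b)[p].1, L.R_Q hp, by rw [hq, L.pos_getElem], L.φF_succ hp⟩

theorem RF_pos_early {u : T.V} (hu : L.R (L.dep u)) : L.RF (L.pos (u, false) + 1) :=
  (L.RF_succ (L.pos_lt (q := (u, false)) hu)).2 (by rw [L.getElem_pos (q := (u, false)) hu])

/-- Depth in `F(T)` is position plus one, so the reflect layers above depth `p + 1` are the early
visits among the first `p` visits. -/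
theorem count_RF {p : ℕ} (hp : p ≤ (T.Q b).length) :
    Nat.count L.RF (p + 1) = earlyCount T b p := by
  induction p with
  | zero =>
    rw [Nat.count_succ, Nat.count_zero, if_neg]
    · simp [earlyCount]
    · rintro ⟨p, -, h, -⟩
      omega
  | succ p ih =>
    rw [Nat.count_succ, ih (by omega), L.earlyCount_succ (by omega)]
    simp only [L.RF_succ (show p < (T.Q b).length by omega)]
    cases (T.Q b)[p].2 <;> simp

/-- The symbol owned by the reflect layer of the early visit of `u` is thus the one at the early
rank of `u`. -/
theorem count_RF_pos {u : T.V} (hu : L.R (L.dep u)) :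
    Nat.count L.RF (L.pos (u, false) + 1) + 1 = T.earlyRank b u := by
  have h := L.pos_lt (q := (u, false)) hu
  have h1 := L.getElem_pos (q := (u, false)) hu
  rw [L.count_RF h.le, ← L.earlyRank_getElem h (by rw [h1]), h1]

theorem before_late {u : T.V} (hu : L.R (L.dep u)) : L.pos (u, false) < L.pos (u, true) :=
  (L.pos_lt_iff (q := (u, false)) (q' := (u, true)) hu hu).2 (Or.inl ⟨rfl, rfl, rfl⟩)

theorem lateRanks_zero : T.lateRanks b 0 = ∅ := by
  simp [lateRanks]

theorem mem_lateRanks_succ {p n : ℕ} (hp : p < (T.Q b).length) : n ∈ T.lateRanks b (p + 1) ↔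
    n ∈ T.lateRanks b p ∨ (T.Q b)[p].2 = true ∧ n = T.earlyRank b (T.Q b)[p].1 := by
  rw [L.mem_lateRanks, L.mem_lateRanks]
  constructor
  · rintro ⟨u, hu, rfl⟩
    rw [List.take_succ_eq_append_getElem hp, List.mem_append, List.mem_singleton] at hu
    rcases hu with hu | hu
    · exact Or.inl ⟨u, hu, rfl⟩
    · exact Or.inr ⟨by rw [← hu], by rw [← hu]⟩
  · rintro (⟨u, hu, rfl⟩ | ⟨h, rfl⟩)
    · exact ⟨u, (List.take_sublist_take_left (by omega)).subset hu, rfl⟩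
    · refine ⟨_, List.mem_take_iff_getElem.2 ⟨p, by omega, ?_⟩, rfl⟩
      rw [← h]

/-! ### The labels of a layer -/

section

variable {p : Fin (T.Q b).length} {s s' : Str}

theorem length_of_mem (hs : s ∈ T.layerLabels b p) : s.length = earlyCount T b p + 1 :=
  (L.mem_layerLabels.1 hs).1

theorem getElem_of_open (hs : s ∈ T.layerLabels b p) {w : T.V} (hw : L.R (L.dep w))
    (hwp : T.Desc w (T.Q b)[p].1) (hne : w ≠ (T.Q b)[p].1) :
    s[T.earlyRank b w]? = (T.label (T.Q b)[p].1)[L.rk (L.dep w) + 1]? :=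
  (L.mem_layerLabels.1 hs).2.2.1 w hw hwp hne

theorem exists_digit_of_mem_lateRanks (hs : s ∈ T.layerLabels b p) {n : ℕ}
    (hn : n ∈ T.lateRanks b p) : ∃ d, 1 ≤ d ∧ d ≤ b ∧ s[n]? = some (Sym.digit d) := by
  obtain ⟨u, hu, rfl⟩ := L.mem_lateRanks.1 hn
  exact (L.mem_layerLabels.1 hs).2.2.2.2 u hu

theorem cases_of_le {n : ℕ} (hn : n ≤ earlyCount T b p) : n = 0 ∨
    (∃ w, L.R (L.dep w) ∧ T.Desc w (T.Q b)[p].1 ∧ w ≠ (T.Q b)[p].1 ∧ T.earlyRank b w = n) ∨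
    ((T.Q b)[p].2 = true ∧ n = T.earlyRank b (T.Q b)[p].1) ∨ n ∈ T.lateRanks b p := by
  refine n.eq_zero_or_pos.imp id fun hpos => ?_
  obtain ⟨u, hu, rfl⟩ := L.exists_earlyRank_eq hpos hn
  rcases (L.early_mem_take_iff p.2 hu).1 (L.earlyRank_le_iff.1 hn) with h | h
  · by_cases hne : u = (T.Q b)[p].1
    · exact Or.inr (Or.inl ⟨h.2.2.resolve_left fun h => h hne, by rw [← hne]⟩)
    · exact Or.inl ⟨u, hu, h.2.1, hne, rfl⟩
  · exact Or.inr (Or.inr ((L.earlyRank_mem_lateRanks hu).2 h))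

theorem layerLabels_ext (hs : s ∈ T.layerLabels b p) (hs' : s' ∈ T.layerLabels b p)
    (h : ∀ n ∈ T.lateRanks b p, s[n]? = s'[n]?) : s = s' := by
  refine List.ext_getElem? fun n => ?_
  have h1 := L.mem_layerLabels.1 hs
  have h2 := L.mem_layerLabels.1 hs'
  rcases lt_or_ge (earlyCount T b p) n with hn | hn
  · rw [List.getElem?_eq_none (by omega), List.getElem?_eq_none (by omega)]
  · rcases L.cases_of_le hn with rfl | ⟨w, hw, hwp, hne, rfl⟩ | ⟨hβ, hn⟩ | hn
    · rw [h1.2.1, h2.2.1]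
    · rw [L.getElem_of_open hs hw hwp hne, L.getElem_of_open hs' hw hwp hne]
    · rw [hn, h1.2.2.2.1 hβ, h2.2.2.2.1 hβ]
    · exact h n hn

/-- With `layerLabels_ext`: the nodes of a layer correspond to the choices of digits in the free
positions. -/
theorem exists_mem_layerLabels (p : Fin (T.Q b).length) (g : ℕ → Sym)
    (hg : ∀ n ∈ T.lateRanks b p, ∃ d, 1 ≤ d ∧ d ≤ b ∧ g n = Sym.digit d) :
    ∃ s ∈ T.layerLabels b p, ∀ n ∈ T.lateRanks b p, s[n]? = some (g n) := by
  set v := (T.Q b)[p].1 with hv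
  -- The last default is intended: at a late visit, the rank of the node itself is the one position
  -- that falls through, and it needs a star. The other defaults are never reached at positions that
  -- matter.
  let h : ℕ → Sym := fun n => if n ∈ T.lateRanks b p then g n else
    if n = 0 then ((T.label v)[0]?).getD Sym.star else
      if hw : ∃ w, L.R (L.dep w) ∧ T.Desc w v ∧ w ≠ v ∧ T.earlyRank b w = n then
        ((T.label v)[L.rk (L.dep hw.choose) + 1]?).getD Sym.star else Sym.star
  have hget : ∀ n, n ≤ earlyCount T b p →
      ((List.range (earlyCount T b p + 1)).map h)[n]? = some (h n) := fun n hn => by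
    rw [List.getElem?_map, List.getElem?_range (by omega), Option.map_some]
  have hlate : ∀ n ∈ T.lateRanks b p,
      ((List.range (earlyCount T b p + 1)).map h)[n]? = some (g n) := fun n hn => by
    rw [hget n (L.le_earlyCount_of_mem_lateRanks hn)]
    simp only [h, if_pos hn]
  have hopen : ∀ w, L.Open (T.Q b)[p] w → T.earlyRank b w ≤ earlyCount T b p ∧
      T.earlyRank b w ∉ T.lateRanks b p := fun w hw =>
    ⟨L.earlyRank_le_iff.2 ((L.early_mem_take_iff p.2 hw.1).2 (Or.inl hw)),
      fun h => Open.not_mem L p.2 hw ((L.earlyRank_mem_lateRanks hw.1).1 h)⟩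
  have hlen : (T.label v).length = L.rk (L.dep v) + 1 := L.len_label v
  refine ⟨(List.range (earlyCount T b p + 1)).map h, L.mem_layerLabels.2
    ⟨by simp, ?_, fun w hw hwv hne => ?_, fun hβ => ?_, fun u hu => ?_⟩, hlate⟩
  · rw [hget 0 (Nat.zero_le _)]
    simp only [h, if_neg L.zero_notMem_lateRanks, if_true]
    rw [← hv, List.getElem?_eq_getElem (by omega)]
    rfl
  · obtain ⟨h1, h2⟩ := hopen w ⟨hw, hwv, Or.inl hne⟩
    have h3 := L.earlyRank_pos w
    have hex : ∃ w', L.R (L.dep w') ∧ T.Desc w' v ∧ w' ≠ v ∧ T.earlyRank b w' = T.earlyRank b w :=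
      ⟨w, hw, hwv, hne, rfl⟩
    have h4 : hex.choose = w := L.earlyRank_inj hex.choose_spec.1 hex.choose_spec.2.2.2
    have h5 := L.rk_lt (j := L.dep v) hw ((L.dep_le_of_desc hwv).lt_of_ne fun hh =>
      hne (L.eq_of_desc hwv hh.ge))
    rw [hget _ h1]
    simp only [h, if_neg h2, if_neg (show T.earlyRank b w ≠ 0 by omega), dif_pos hex]
    rw [h4, ← hv, List.getElem?_eq_getElem (by rw [hlen]; omega)]
    rfl
  · obtain ⟨h1, h2⟩ := hopen v ⟨L.R_Q p.2, .refl _, Or.inr hβ⟩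
    have h3 := L.earlyRank_pos v
    rw [hget _ h1]
    simp only [h, if_neg h2, if_neg (show T.earlyRank b v ≠ 0 by omega)]
    rw [dif_neg]
    rintro ⟨w, hw, -, hne, hh⟩
    exact hne (L.earlyRank_inj hw hh)
  · have hu' := (L.earlyRank_mem_lateRanks (L.mem_of_mem_take hu)).2 hu
    obtain ⟨d, h1, h2, h3⟩ := hg _ hu'
    exact ⟨d, h1, h2, by rw [hlate _ hu', h3]⟩

theorem exists_mem_layerLabels_agree (p : Fin (T.Q b).length)
    (hs : ∀ n ∈ T.lateRanks b p, ∃ d, 1 ≤ d ∧ d ≤ b ∧ s[n]? = some (Sym.digit d)) :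
    ∃ s' ∈ T.layerLabels b p, ∀ n ∈ T.lateRanks b p, s'[n]? = s[n]? := by
  obtain ⟨s', h, h'⟩ := L.exists_mem_layerLabels p (fun n => (s[n]?).getD Sym.star) fun n hn => by
    obtain ⟨d, h1, h2, h3⟩ := hs n hn
    exact ⟨d, h1, h2, by rw [h3]; rfl⟩
  refine ⟨s', h, fun n hn => ?_⟩
  obtain ⟨d, h1, h2, h3⟩ := hs n hn
  rw [h' n hn, h3]
  rfl

theorem getElem_eq_star_iff (hs : s ∈ T.layerLabels b p) {n : ℕ} : s[n]? = some Sym.star ↔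
    (T.Q b)[p].2 = true ∧ n = T.earlyRank b (T.Q b)[p].1 := by
  have h1 := L.mem_layerLabels.1 hs
  constructor
  · intro h
    have hn : n ≤ earlyCount T b p := by
      have := (List.getElem?_eq_some_iff.1 h).1
      omega
    rcases L.cases_of_le hn with rfl | ⟨w, hw, hwp, hne, rfl⟩ | h' | hn
    · rw [h1.2.1] at h
      exact absurd h (star_notMem_iff.1 (L.no_star _ (L.R_Q p.2)) _)
    · rw [L.getElem_of_open hs hw hwp hne] at h
      exact absurd h (star_notMem_iff.1 (L.no_star _ (L.R_Q p.2)) _)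
    · exact h'
    · obtain ⟨d, -, -, h2⟩ := L.exists_digit_of_mem_lateRanks hs hn
      rw [h2] at h
      cases h
  · rintro ⟨hβ, rfl⟩
    exact h1.2.2.2.1 hβ

theorem mem_XStr_of_mem (hs : s ∈ T.layerLabels b p) : s ∈ XStr b := by
  have h1 := L.mem_layerLabels.1 hs
  have hX := L.mem_X (T.Q b)[p].1
  refine mem_XStr_iff.2 ⟨h1.2.1 ▸ hX.1, fun j c hc => ?_⟩
  have hn : j + 1 ≤ earlyCount T b p := by
    have := (List.getElem?_eq_some_iff.1 hc).1
    omega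
  rcases L.cases_of_le hn with h | ⟨w, hw, hwp, hne, h⟩ | ⟨hβ, h⟩ | hn
  · omega
  · rw [← h, L.getElem_of_open hs hw hwp hne] at hc
    exact (mem_XStr_iff.1 hX).2 _ _ hc
  · rw [h, h1.2.2.2.1 hβ] at hc
    exact Or.inl (Option.some.inj hc).symm
  · obtain ⟨d, h2, h3, h4⟩ := L.exists_digit_of_mem_lateRanks hs hn
    rw [h4] at hc
    exact Or.inr ⟨d, h2, h3, (Option.some.inj hc).symm⟩

theorem finite_layerLabels (p : Fin (T.Q b).length) : Finite (T.layerLabels b p) := by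
  have hf : ∀ (s : T.layerLabels b p) (n : T.lateRanks b p), ∃ d : Set.Icc 1 b,
      s.1[n.1]? = some (Sym.digit d) := fun s n => by
    obtain ⟨d, h1, h2, h3⟩ := L.exists_digit_of_mem_lateRanks s.2 n.2
    exact ⟨⟨d, h1, h2⟩, h3⟩
  choose f hf using hf
  refine Finite.of_injective f fun s s' h => Subtype.ext (L.layerLabels_ext s.2 s'.2 fun n hn => ?_)
  rw [hf s ⟨n, hn⟩, hf s' ⟨n, hn⟩, h]

end

/-- A reflect node is reached by prescribing the `0`-th symbol of its label and, for each reflect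
node above it, the symbol at the index of that node. -/
theorem exists_guided (f : T.V → ℕ) (hf : ∀ v, 1 ≤ f v ∧ f v ≤ b) {a : Sym}
    (ha : a = Sym.digit 1 ∨ a = Sym.digit 2) :
    ∃ u, L.R (L.dep u) ∧ (T.label u)[0]? = some a ∧ ∀ w, L.R (L.dep w) → T.Desc w u → w ≠ u →
      (T.label u)[L.rk (L.dep w) + 1]? = some (Sym.digit (f w)) := by
  -- Descend to the last layer; at the split node that matches `w`, take the child with digit `f w`.
  have hz : ∀ n, 1 ≤ n → n ≤ L.M → ∃ z, L.dep z = n ∧ ∀ w, L.R (L.dep w) → T.Desc w z →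
      L.φ (L.dep w) < n → (T.label z)[L.rk (L.dep w) + 1]? = some (Sym.digit (f w)) := by
    intro n hn
    induction n, hn using Nat.le_induction with
    | base =>
      refine fun _ => ⟨L.root, L.dep_root, fun w hw _ h => ?_⟩
      have := L.φ_lt _ hw
      have := L.dep_pos w
      omega
    | succ n hn ih =>
      intro hM
      obtain ⟨z, rfl, hz⟩ := ih (by omega)
      have key : ∀ c, T.Child z c → ∀ w, L.R (L.dep w) → T.Desc w c → L.φ (L.dep w) < L.dep z →
          (T.label c)[L.rk (L.dep w) + 1]? = some (Sym.digit (f w)) := fun c hc w hw hwc h => by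
        have h1 := L.φ_lt _ hw
        rw [L.digit_eq_of_desc hw h (.single hc)]
        exact hz w hw (L.desc_comparable hwc (.single hc) (by omega)) h
      by_cases hR : L.R (L.dep z)
      · obtain ⟨c, hc⟩ := L.exists_child z (by omega)
        refine ⟨c, L.dep_child _ _ hc, fun w hw hwc h => key c hc w hw hwc ?_⟩
        have : L.φ (L.dep w) ≠ L.dep z := fun hh => L.φ_not _ hw (hh ▸ hR)
        omega
      · obtain ⟨i, hi, hiz⟩ := L.φ_surj _ (L.dep_pos z) (L.dep_le z) hR
        obtain ⟨ρ, hρ, hd⟩ := L.split_child z i hi hiz.symm (by omega)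
        obtain ⟨c, hc, hc'⟩ := hρ.surjOn (hf (L.anc z i))
        refine ⟨c, L.dep_child _ _ hc, fun w hw hwc h => ?_⟩
        rcases (Nat.lt_succ_iff.1 h).lt_or_eq with h | h
        · exact key c hc w hw hwc h
        · obtain rfl := L.φ_inj _ _ hw hi (h.trans hiz.symm)
          have h1 := L.φ_lt _ hw
          have h2 := L.desc_comparable hwc (.single hc) (by omega)
          rw [hd c hc c (.refl _), hc', L.eq_anc h2]
  obtain ⟨z, hzM, hz⟩ := hz L.M L.one_lt_M.le le_rfl
  -- The instructions along the branch to `z`, written as a string. By clearing, the label of some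
  -- reflect node on this branch is a final substring of it, and that node is `u`.
  set x : Str := a :: (List.range (L.rk L.M)).map fun j =>
    Sym.digit (f (L.anc z (L.nthR j))) with hx
  have hget : ∀ j < L.rk L.M, x[j + 1]? = some (Sym.digit (f (L.anc z (L.nthR j)))) :=
    fun j hj => by
      rw [hx, List.getElem?_cons_succ, List.getElem?_map, List.getElem?_range hj, Option.map_some]
  have hxm : x ∈ XStrMinus b := by
    refine ⟨⟨?_, fun c hc => ?_⟩, fun h => ?_⟩
    · rcases ha with rfl | rfl
      · exact Or.inl rfl
      · exact Or.inr rfl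
    · obtain ⟨j, -, rfl⟩ := List.mem_map.1 hc
      exact Or.inr ⟨_, (hf _).1, (hf _).2, rfl⟩
    · rcases List.mem_cons.1 h with h | h
      · rcases ha with rfl | rfl <;> cases h
      · obtain ⟨j, -, h⟩ := List.mem_map.1 h
        cases h
  obtain ⟨u, hu, huz, hux⟩ := L.exists_prefix_of_leaf hzM hxm (by simp [hx]) fun i hi hlt => by
    have h1 := L.φ_lt i hi
    obtain ⟨h2, h3⟩ := L.anc_spec z i (L.R_pos i hi) (by omega)
    have h4 := hz _ (h3.symm ▸ hi) h2 (by rw [h3]; exact hlt)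
    rw [h3] at h4
    rw [h4, hget _ (L.rk_lt hi (by omega)), L.nthR_rk hi]
  have hux := prefix_iff_forall.1 hux
  rw [L.len_R u hu] at hux
  refine ⟨u, hu, ?_, fun w hw hwu hne => ?_⟩
  · rw [← hux 0 (by omega)]
    rfl
  · have h1 : L.dep w < L.dep u :=
      (L.dep_le_of_desc hwu).lt_of_ne fun hh => hne (L.eq_of_desc hwu hh.ge)
    have h2 := L.rk_lt hw h1
    have h3 := L.rk_mono (L.dep_le u)
    rw [← hux _ (by omega), hget _ (by omega), L.nthR_rk hw, L.eq_anc (hwu.trans huz)]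

end Layering

end CTree

/-! ### `F(T)` is a construction tree. -/

namespace CTree

open scoped Classical
open LTree

namespace Layering

variable {T : LTree} {b : ℕ} (L : Layering T b)

/-- A free position stays free in later layers, and children inherit its digit. -/
theorem F_desc_agree {x y : (T.F b).V} (h : (T.F b).Desc x y) (L : Layering T b) :
    x.1.1 ≤ y.1.1 ∧ ∀ n ∈ T.lateRanks b x.1, x.2.1[n]? = y.2.1[n]? := by
  induction h with
  | refl => exact ⟨le_rfl, fun _ _ => rfl⟩
  | @tail y z _ hyz ih =>
    obtain ⟨h1, h2⟩ := hyz
    exact ⟨by omega, fun n hn => (ih.2 n hn).trans (h2 n (L.lateRanks_mono ih.1 hn))⟩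

include L

theorem F_ext {x y : (T.F b).V} (h : x.1.1 = y.1.1)
    (h' : ∀ n ∈ T.lateRanks b x.1, x.2.1[n]? = y.2.1[n]?) : x = y := by
  obtain ⟨p, s, hs⟩ := x
  obtain ⟨p', s', hs'⟩ := y
  obtain rfl : p = p' := Fin.ext h
  obtain rfl := L.layerLabels_ext hs hs' h'
  rfl

theorem F_exists (p : ℕ) (hp : p < (T.Q b).length) : ∃ x : (T.F b).V, x.1.1 = p := by
  obtain ⟨s, hs, -⟩ := L.exists_mem_layerLabels ⟨p, hp⟩ (fun _ => Sym.digit 1) fun _ _ =>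
    ⟨1, le_rfl, by have := L.three_le; omega, rfl⟩
  exact ⟨⟨⟨p, hp⟩, s, hs⟩, rfl⟩

/-- Let the visited nodes be `u` and `v`, with `u` first. If `u` is above `v`, the common positions
spell out the label of `u` as a final substring of that of `v`, against independence in `T`. If `u`
is left of `v`, the digits at the rank of the mate of the separating split node differ. -/
theorem F_indep {x y : (T.F b).V} (hx : (T.Q b)[x.1.1].2 = false) (hy : (T.Q b)[y.1.1].2 = false)
    (h : x.2.1 <+: y.2.1) : x = y := by
  obtain ⟨⟨p, hp⟩, s, hs⟩ := x
  obtain ⟨⟨q, hq⟩, s', hs'⟩ := y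
  dsimp only at hx hy h
  have hrp := L.earlyRank_getElem hp hx
  have hrq := L.earlyRank_getElem hq hy
  have hls := L.length_of_mem hs
  have hls' := L.length_of_mem hs'
  have hle := h.length_le
  have hag : ∀ n ≤ earlyCount T b p, s'[n]? = s[n]? := fun n hn =>
    prefix_iff_forall.1 h n (by rw [hls]; exact Nat.lt_succ_of_le hn)
  have hep : (T.Q b)[p] = ((T.Q b)[p].1, false) := by rw [← hx]
  have heq : (T.Q b)[q] = ((T.Q b)[q].1, false) := by rw [← hy]
  have hRp := L.R_Q hp
  have hRq := L.R_Q hq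
  have hle' : ∀ w, T.Desc w (T.Q b)[p].1 → L.R (L.dep w) → w ≠ (T.Q b)[p].1 →
      T.earlyRank b w ≤ earlyCount T b p := fun w h1 h2 h3 => by
    have := (L.earlyRank_lt_iff h2 hRp).2 (Or.inr (Or.inl ⟨h3, h1, rfl⟩))
    omega
  by_cases huv : (T.Q b)[p].1 = (T.Q b)[q].1
  · have hpq : p = q := by
      rw [← L.pos_getElem hp, ← L.pos_getElem hq, hep, heq, huv]
    subst hpq
    obtain rfl : s = s' := h.eq_of_length (by rw [hls, hls'])
    rfl
  exfalso
  -- The shorter label belongs to the smaller rank.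
  have hlt : T.earlyRank b (T.Q b)[p].1 < T.earlyRank b (T.Q b)[q].1 := by
    have h1 : T.earlyRank b (T.Q b)[p].1 ≠ T.earlyRank b (T.Q b)[q].1 := fun h1 =>
      huv (L.earlyRank_inj hRp h1)
    dsimp only at hls hls'
    omega
  rcases (L.earlyRank_lt_iff hRp hRq).1 hlt with ⟨-, -, h1⟩ | ⟨-, h1, -⟩ | ⟨-, -, h1⟩ | h1
  · cases h1
  · refine huv (L.indep _ _ hRp hRq (prefix_iff_forall.2 fun k hk => ?_))
    rw [L.len_R _ hRp] at hk
    rcases k with _ | k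
    · have h2 := (L.mem_layerLabels.1 hs).2.1
      have h3 := (L.mem_layerLabels.1 hs').2.1
      exact h3.symm.trans ((hag 0 (Nat.zero_le _)).trans h2)
    · obtain ⟨w, hw, hwp, hlt, rfl⟩ := L.exists_reflect_of_lt_rk (Nat.lt_of_succ_lt_succ hk)
      have hne : w ≠ (T.Q b)[p].1 := fun hh => by rw [hh] at hlt; omega
      have hne' : w ≠ (T.Q b)[q].1 := fun hh => by
        have : L.dep (T.Q b)[p].1 ≤ L.dep (T.Q b)[q].1 := L.dep_le_of_desc h1
        rw [← hh] at this
        omega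
      have h2 := L.getElem_of_open hs hw hwp hne
      have h3 := L.getElem_of_open hs' hw (hwp.trans h1) hne'
      exact h3.symm.trans ((hag _ (hle' w hwp hw hne)).trans h2)
  · cases h1
  · obtain ⟨t, i, d, d', hi, ht, htu, htv, hu, hv, hd, hd', hdd⟩ := h1
    have hφ := L.φ_lt i hi
    dsimp only at htu htv hu hv hd hd'
    obtain ⟨w, hwt, rfl⟩ := L.exists_anc t i (L.R_pos i hi) (by omega)
    have hne : w ≠ (T.Q b)[p].1 := fun hh => by rw [hh] at hφ hu; omega
    have hne' : w ≠ (T.Q b)[q].1 := fun hh => by rw [hh] at hφ hv; omega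
    have h2 := L.getElem_of_open hs hi (hwt.trans htu) hne
    have h3 := L.getElem_of_open hs' hi (hwt.trans htv) hne'
    have h4 := hag _ (hle' w (hwt.trans htu) hi hne)
    have h5 := h2.symm.trans (h4.symm.trans h3)
    have h6 := hd.symm.trans (h5.trans hd')
    simp at h6
    omega

/-- Follow `x` as instructions to a reflect node `u`. Cut to the length used at the early visit of
`u`, the string `x` is itself a label of that layer. -/
theorem F_clear {x : Str} (hx : x ∈ XStrMinus b)
    (hl : ∀ y : (T.F b).V, (T.Q b)[y.1.1].2 = false → y.2.1.length ≤ x.length) :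
    ∃ y : (T.F b).V, (T.Q b)[y.1.1].2 = false ∧ y.2.1 <+: x := by
  have h3 := L.three_le
  -- Shifted by one because ranks start at `1`; the digit `1` is a default beyond the end of `x`.
  have hd : ∀ n : ℕ, ∃ d, 1 ≤ d ∧ d ≤ b ∧ (n + 1 < x.length → x[n + 1]? = some (Sym.digit d)) := by
    intro n
    by_cases hn : n + 1 < x.length
    · obtain ⟨d, h1, h2, h3⟩ := exists_digit_of_mem_XStr hx.1 hn (star_notMem_iff.1 hx.2 _)
      exact ⟨d, h1, h2, fun _ => h3⟩
    · exact ⟨1, le_rfl, by omega, fun h => absurd h hn⟩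
  choose g hg1 hg2 hg using hd
  have hx0 : ∃ a, x[0]? = some a ∧ (a = Sym.digit 1 ∨ a = Sym.digit 2) := by
    rcases hx.1.1 with h | h
    · exact ⟨_, h, Or.inl rfl⟩
    · exact ⟨_, h, Or.inr rfl⟩
  obtain ⟨a, ha, ha'⟩ := hx0
  obtain ⟨u, hu, hu0, huw⟩ := L.exists_guided (fun w => g (T.earlyRank b w - 1))
    (fun w => ⟨hg1 _, hg2 _⟩) ha'
  have hp := L.pos_lt (q := (u, false)) hu
  have hq := L.getElem_pos (q := (u, false)) hu
  obtain ⟨y, hy⟩ := L.F_exists _ hp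
  have hle := hl y (by simp only [hy, hq])
  rw [L.length_of_mem y.2.2, hy] at hle
  have hget : ∀ n ≤ earlyCount T b (L.pos (u, false)),
      (x.take (earlyCount T b (L.pos (u, false)) + 1))[n]? = x[n]? := fun n hn =>
    List.getElem?_take_of_lt (Nat.lt_succ_of_le hn)
  have hr : ∀ w, T.earlyRank b w ≤ earlyCount T b (L.pos (u, false)) →
      x[T.earlyRank b w]? = some (Sym.digit (g (T.earlyRank b w - 1))) := fun w hw => by
    have h1 := L.earlyRank_pos w
    have := hg (T.earlyRank b w - 1) (by omega)
    rwa [Nat.sub_add_cancel h1] at this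
  have hrk := L.earlyRank_getElem hp (by rw [hq])
  have hmem : x.take (earlyCount T b (L.pos (u, false)) + 1) ∈ T.layerLabels b ⟨_, hp⟩ := by
    refine L.mem_layerLabels.2 ⟨?_, ?_, fun w hw hwu hne => ?_, fun h => ?_, fun w hw => ?_⟩
    · rw [List.length_take, min_eq_left hle]
    · rw [hget 0 (Nat.zero_le _)]
      simp only [Fin.getElem_fin, hq]
      rw [ha, hu0]
    · simp only [Fin.getElem_fin, hq] at hwu hne hrk ⊢
      have h1 := (L.earlyRank_lt_iff hw hu).2 (Or.inr (Or.inl ⟨hne, hwu, rfl⟩))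
      rw [hget _ (by omega), hr w (by omega), huw w hw hwu hne]
    · simp only [Fin.getElem_fin, hq] at h
      cases h
    · have h1 := L.earlyRank_le_iff.2 (L.early_of_late_mem_take hw)
      exact ⟨_, hg1 _, hg2 _, by rw [hget _ h1, hr w h1]⟩
  exact ⟨⟨⟨_, hp⟩, _, hmem⟩, by simp only [hq], List.take_prefix _ _⟩

theorem F_star {x w : (T.F b).V} {u : T.V} (hu : L.R (L.dep u)) (hx : x.1.1 = L.pos (u, true))
    (hw : w.1.1 = L.pos (u, false)) (h : (T.F b).Desc w x) :
    x.2.1[T.earlyRank b u]? = some Sym.star ∧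
      ∀ k < T.earlyRank b u, x.2.1[k]? = w.2.1[k]? := by
  have hag := (F_desc_agree h L).2
  obtain ⟨⟨p, hp⟩, s, hs⟩ := x
  obtain ⟨⟨q, hq⟩, s', hs'⟩ := w
  dsimp only at hx hw hag ⊢
  subst hx hw
  have h1 := L.getElem_pos (q := (u, true)) hu
  have h2 := L.getElem_pos (q := (u, false)) hu
  have hrk := L.earlyRank_getElem hq (by rw [h2])
  have hs1 := L.mem_layerLabels.1 hs
  have hs2 := L.mem_layerLabels.1 hs'
  simp only [Fin.getElem_fin, h1, h2] at hs1 hs2 hrk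
  refine ⟨hs1.2.2.2.1 trivial, fun k hk => ?_⟩
  rcases L.cases_of_le (p := ⟨_, hq⟩) (n := k) (by dsimp only; omega) with
    rfl | ⟨w, hw, hwp, hne, rfl⟩ | ⟨hβ, -⟩ | hn
  · rw [hs1.2.1, hs2.2.1]
  · simp only [Fin.getElem_fin, h2] at hwp hne
    rw [hs1.2.2.1 w hw hwp hne, hs2.2.2.1 w hw hwp hne]
  · simp only [Fin.getElem_fin, h2] at hβ
    cases hβ
  · exact (hag k hn).symm

/-- Passing the late visit of `u` makes one new position free, its early rank, and children differ
in this digit only. -/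
theorem F_split_child (x : (T.F b).V) {u : T.V} (hu : L.R (L.dep u))
    (hx : x.1.1 = L.pos (u, true)) (hlt : x.1.1 + 1 < (T.Q b).length) :
    ∃ ρ : (T.F b).V → ℕ, Set.BijOn ρ {w | (T.F b).Child x w} (Set.Icc 1 b) ∧
      ∀ w, (T.F b).Child x w → ∀ y, (T.F b).Desc w y →
        y.2.1[T.earlyRank b u]? = some (Sym.digit (ρ w)) := by
  have hq := L.getElem_pos (q := (u, true)) hu
  have hlate : ∀ n, n ∈ T.lateRanks b (L.pos (u, true) + 1) ↔
      n ∈ T.lateRanks b (L.pos (u, true)) ∨ n = T.earlyRank b u := fun n => by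
    rw [L.mem_lateRanks_succ (L.pos_lt (q := (u, true)) hu), hq]
    simp
  have hnot : T.earlyRank b u ∉ T.lateRanks b (L.pos (u, true)) := fun h => by
    have h := (L.earlyRank_mem_lateRanks hu).1 h
    have := (L.mem_take_Q (L.pos_lt (q := (u, true)) hu) (q := (u, true)) hu).1 h
    rw [hq] at this
    exact this.ne rfl
  have hd : ∀ w : (T.F b).V, ∃ d, (T.F b).Child x w →
      1 ≤ d ∧ d ≤ b ∧ w.2.1[T.earlyRank b u]? = some (Sym.digit d) := fun w => by
    by_cases h : (T.F b).Child x w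
    · obtain ⟨h1, -⟩ := h
      obtain ⟨d, hd⟩ := L.exists_digit_of_mem_lateRanks w.2.2 (n := T.earlyRank b u)
        (by rw [h1, hx, hlate]; exact Or.inr rfl)
      exact ⟨d, fun _ => hd⟩
    · exact ⟨0, fun h' => absurd h' h⟩
  choose ρ hρ using hd
  refine ⟨ρ, ⟨fun w hw => ⟨(hρ w hw).1, (hρ w hw).2.1⟩, fun w hw w' hw' h => ?_, fun d hd => ?_⟩,
    fun w hw y hy => ?_⟩
  · have h1 := (hρ w hw).2.2
    have h2 := (hρ w' hw').2.2
    obtain ⟨h3, h4⟩ := hw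
    obtain ⟨h5, h6⟩ := hw'
    refine L.F_ext (h3.trans h5.symm) fun n hn => ?_
    rw [h3, hx, hlate] at hn
    rcases hn with hn | rfl
    · rw [← hx] at hn
      rw [← h4 n hn, ← h6 n hn]
    · rw [h1, h2, h]
  -- Keep the free digits of `x` and set the new one to `d`.
  · have hg : ∀ n ∈ T.lateRanks b (x.1.1 + 1), ∃ e, 1 ≤ e ∧ e ≤ b ∧
        (if n = T.earlyRank b u then Sym.digit d else (x.2.1[n]?).getD Sym.star) =
          Sym.digit e := fun n hn => by
      by_cases hnu : n = T.earlyRank b u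
      · exact ⟨d, hd.1, hd.2, by rw [if_pos hnu]⟩
      · rw [hx, hlate] at hn
        have hn := hn.resolve_right hnu
        rw [← hx] at hn
        obtain ⟨e, h1, h2, h3⟩ := L.exists_digit_of_mem_lateRanks x.2.2 hn
        exact ⟨e, h1, h2, by rw [if_neg hnu, h3]; rfl⟩
    obtain ⟨s, hs, hsg⟩ := L.exists_mem_layerLabels ⟨x.1.1 + 1, hlt⟩ _ hg
    have hc : (T.F b).Child x ⟨⟨x.1.1 + 1, hlt⟩, s, hs⟩ := by
      refine ⟨rfl, fun n hn => ?_⟩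
      obtain ⟨e, h1, h2, h3⟩ := L.exists_digit_of_mem_lateRanks x.2.2 hn
      have hne : n ≠ T.earlyRank b u := fun h => hnot (by rw [← h, ← hx]; exact hn)
      have h4 := hsg n (L.lateRanks_mono (Nat.le_succ _) hn)
      rw [if_neg hne, h3] at h4
      rw [h3]
      exact h4.symm
    refine ⟨_, hc, ?_⟩
    have h1 := (hρ _ hc).2.2
    have h2 := hsg (T.earlyRank b u) (by
      have := (hlate _).2 (Or.inr rfl)
      rwa [← hx] at this)
    rw [if_pos rfl] at h2
    have := h1.symm.trans h2
    simpa using this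
  · have h1 := (hρ w hw).2.2
    rw [← (F_desc_agree hy L).2 _ (by rw [hw.1, hx]; exact (hlate _).2 (Or.inr rfl)), h1]

/-- Early and late visits are nested like brackets: a node first visited between the two visits of
`u` lies below `u`. -/
theorem nested_F {u v : T.V} (hu : L.R (L.dep u)) (hv : L.R (L.dep v))
    (h1 : L.pos (u, false) < L.pos (v, false)) (h2 : L.pos (v, false) < L.pos (u, true)) :
    L.pos (v, true) < L.pos (u, true) := by
  have h1 := (L.pos_lt_iff (q := (u, false)) (q' := (v, false)) hu hv).1 h1
  have h2 := (L.pos_lt_iff (q := (v, false)) (q' := (u, true)) hv hu).1 h2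
  refine (L.pos_lt_iff (q := (v, true)) (q' := (u, true)) hv hu).2 ?_
  rcases h1 with ⟨-, -, h1⟩ | ⟨hne, h1, -⟩ | ⟨-, -, h1⟩ | h1
  · cases h1
  · exact Or.inr (Or.inr (Or.inl ⟨hne.symm, h1, rfl⟩))
  · cases h1
  · rcases h2 with ⟨h2, -, -⟩ | ⟨-, h2, -⟩ | ⟨-, h2, -⟩ | h2
    · exact absurd h2.symm h1.ne
    · exact absurd h2 h1.not_desc'
    · exact absurd h2 h1.not_desc
    · exact absurd h2 h1.asymm

theorem lt_of_early {p : ℕ} (hp : p < (T.Q b).length) (h : (T.Q b)[p].2 = false) :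
    p + 1 < (T.Q b).length := by
  have h1 := L.before_late (L.R_Q hp)
  have h2 := L.pos_lt (q := ((T.Q b)[p].1, true)) (L.R_Q hp)
  have hq : ((T.Q b)[p].1, false) = (T.Q b)[p] := by rw [← h]
  rw [hq, L.pos_getElem hp] at h1
  omega

/-- After an early visit no position becomes free, so the free digits determine the child. -/
theorem exists_F_child {x : (T.F b).V} (h : (T.Q b)[x.1.1].2 = false) :
    ∃ w, ∀ y, (T.F b).Child x y ↔ y = w := by
  have hlt := L.lt_of_early x.1.2 h
  have hK : ∀ n, n ∈ T.lateRanks b (x.1.1 + 1) ↔ n ∈ T.lateRanks b x.1.1 := fun n => by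
    rw [L.mem_lateRanks_succ x.1.2, h]
    simp
  obtain ⟨s, hs, hag⟩ := L.exists_mem_layerLabels_agree (s := x.2.1) ⟨x.1.1 + 1, hlt⟩
    fun n hn => L.exists_digit_of_mem_lateRanks x.2.2 ((hK n).1 hn)
  refine ⟨⟨⟨x.1.1 + 1, hlt⟩, s, hs⟩, fun y => ⟨fun hy => ?_, fun hy => ?_⟩⟩
  · obtain ⟨h1, h2⟩ := hy
    refine L.F_ext h1 fun n hn => ?_
    rw [h1, hK] at hn
    exact (h2 n hn).symm.trans (hag n ((hK n).2 hn)).symm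
  · subst hy
    exact ⟨rfl, fun n hn => (hag n ((hK n).2 hn)).symm⟩

theorem exists_F_parent {x : (T.F b).V} (h : 0 < x.1.1) : ∃ y, (T.F b).Child y x := by
  have hlt : x.1.1 - 1 < (T.Q b).length := by have := x.1.2; omega
  obtain ⟨s, hs, hag⟩ := L.exists_mem_layerLabels_agree (s := x.2.1) ⟨x.1.1 - 1, hlt⟩
    fun n hn => L.exists_digit_of_mem_lateRanks x.2.2 (L.lateRanks_mono (Nat.sub_le _ _) hn)
  exact ⟨⟨⟨x.1.1 - 1, hlt⟩, s, hs⟩, by show x.1.1 = x.1.1 - 1 + 1; omega, hag⟩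

omit L in
/-- The layers of `F(T)`. -/
theorem exists_layering_F (L : Layering T b) : ∃ L' : Layering (T.F b) b,
    L'.M = (T.Q b).length ∧ (∀ x, L'.dep x = x.1.1 + 1) ∧ L'.R = L.RF ∧ L'.φ = L.φF := by
  have h0 : 0 < (T.Q b).length := (Nat.zero_le _).trans_lt (L.pos_lt (q := (L.root, false)) L.R_root)
  obtain ⟨r, hr⟩ := L.F_exists 0 h0
  have hR : ∀ x : (T.F b).V, L.RF (x.1.1 + 1) ↔ (T.Q b)[x.1.1].2 = false := fun x => L.RF_succ x.1.2
  have hrk : ∀ x : (T.F b).V, Nat.count L.RF (x.1.1 + 1) = earlyCount T b x.1.1 :=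
    fun x => L.count_RF x.1.2.le
  have hfin : ∀ p, Finite (T.layerLabels b p) := L.finite_layerLabels
  have hlen : ∀ x : (T.F b).V, x.2.1.length = Nat.count L.RF (x.1.1 + 1) + 1 := fun x => by
    rw [hrk]
    exact L.length_of_mem x.2.2
  exact ⟨
    { M := (T.Q b).length
      dep := fun x => x.1.1 + 1
      root := r
      R := L.RF
      φ := L.φF
      rk := Nat.count L.RF
      rk_eq := fun _ => rfl
      three_le := L.three_le
      fin := inferInstanceAs (Finite ((p : Fin (T.Q b).length) × T.layerLabels b p))
      dep_root := by rw [hr]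
      eq_root := fun v hv => L.F_ext (by omega) fun n hn => by
        rw [show v.1.1 = 0 by omega, L.lateRanks_zero] at hn
        simp at hn
      dep_pos := fun _ => Nat.le_add_left _ _
      dep_le := fun v => v.1.2
      dep_child := fun v w h => by rw [h.1]
      parent := fun w hw => L.exists_F_parent (by omega)
      parent_unique := fun u v w hu hv => by
        have h1 := hu.1
        have h2 := hv.1
        have h3 : u.1.1 = v.1.1 := by omega
        exact L.F_ext h3 fun n hn => (hu.2 n hn).trans (hv.2 n (h3 ▸ hn)).symm
      reflect_child := fun v hv => L.exists_F_child ((hR v).1 hv)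
      R_pos := by
        rintro _ ⟨p, hp, rfl, h⟩
        omega
      R_lt := by
        rintro _ ⟨p, hp, rfl, h⟩
        exact L.lt_of_early hp h
      R_one := by
        have := L.RF_pos_early L.R_root
        rwa [L.pos_root] at this
      φ_not := fun i hi hφ => by
        obtain ⟨u, hu, rfl, h⟩ := L.exists_of_RF hi
        rw [h, L.RF_succ (L.pos_lt (q := (u, true)) hu), L.getElem_pos (q := (u, true)) hu] at hφ
        cases hφ
      φ_le := fun i hi => by
        obtain ⟨u, hu, rfl, h⟩ := L.exists_of_RF hi
        rw [h]
        exact L.pos_lt (q := (u, true)) hu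
      φ_inj := fun i j hi hj hij => by
        obtain ⟨u, hu, rfl, h⟩ := L.exists_of_RF hi
        obtain ⟨v, hv, rfl, h'⟩ := L.exists_of_RF hj
        rw [h, h'] at hij
        have := L.eq_of_pos_eq (q := (u, true)) hu (Nat.succ_inj.1 hij)
        have huv : u = v := (Prod.ext_iff.1 this).1
        rw [huv]
      φ_surj := fun s hs hs' hsR => by
        obtain ⟨p, rfl⟩ : ∃ p, s = p + 1 := ⟨s - 1, by omega⟩
        have hp : p < (T.Q b).length := hs'
        rw [L.RF_succ hp, Bool.not_eq_false] at hsR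
        have hu := L.R_Q hp
        refine ⟨_, L.RF_pos_early hu, ?_⟩
        rw [L.φF_succ (L.pos_lt (q := ((T.Q b)[p].1, false)) hu),
          L.getElem_pos (q := ((T.Q b)[p].1, false)) hu]
        have hq : ((T.Q b)[p].1, true) = (T.Q b)[p] := by rw [← hsR]
        rw [hq, L.pos_getElem hp]
      φ_one := by
        have h := L.φF_succ h0
        have hq : (T.Q b)[0] = (L.root, false) := by
          have := L.getElem_pos (q := (L.root, false)) L.R_root
          simpa only [L.pos_root] using this
        rw [hq, L.pos_root_late] at h
        exact h
      φ_lt := fun i hi => by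
        obtain ⟨u, hu, rfl, h⟩ := L.exists_of_RF hi
        rw [h]
        exact Nat.succ_lt_succ (L.before_late hu)
      nested := fun i j hi hj hij hji => by
        obtain ⟨u, hu, rfl, h⟩ := L.exists_of_RF hi
        obtain ⟨v, hv, rfl, h'⟩ := L.exists_of_RF hj
        rw [h] at hji ⊢
        rw [h']
        exact Nat.succ_lt_succ (L.nested_F hu hv (by omega) (by omega))
      mem_X := fun v => L.mem_XStr_of_mem v.2.2
      label_root := by
        have h1 := L.mem_layerLabels.1 r.2.2
        have h2 : (T.Q b)[r.1].1 = L.root := by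
          have := L.getElem_pos (q := (L.root, false)) L.R_root
          simp only [L.pos_root] at this
          simp only [Fin.getElem_fin, hr, this]
        rw [h2, L.label_root] at h1
        have h3 : earlyCount T b r.1 = 0 := by rw [hr]; simp [earlyCount]
        rw [h3] at h1
        obtain ⟨c, hc⟩ := List.length_eq_one_iff.1 h1.1
        show r.2.1 = _
        have h4 := h1.2.1
        rw [hc] at h4 ⊢
        simpa using h4
      len_R := fun v _ => hlen v
      inj_R := fun v w hv hw h =>
        L.F_indep ((hR v).1 hv) ((hR w).1 hw) (by
          have h : v.2.1 = w.2.1 := h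
          rw [h])
      no_star := fun v hv => star_notMem_iff.2 fun n hn => by
        have := ((L.getElem_eq_star_iff v.2.2).1 hn).1
        have h := (hR v).1 hv
        rw [Fin.getElem_fin, h] at this
        cases this
      indep := fun v w hv hw h => L.F_indep ((hR v).1 hv) ((hR w).1 hw) h
      clear := fun x hx hl => by
        obtain ⟨y, hy, hyx⟩ := L.F_clear hx fun y hy => hl y ((hR y).2 hy)
        exact ⟨y, (hR y).2 hy, hyx⟩
      len_S := fun v _ => hlen v
      star_S := fun v w i hi hv hw h => by
        obtain ⟨u, hu, rfl, hφ⟩ := L.exists_of_RF hi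
        rw [L.count_RF_pos hu]
        exact L.F_star hu (by omega) (by omega) h
      star_unique := fun v hv => by
        rw [hR, Bool.not_eq_false] at hv
        exact ⟨_, (L.getElem_eq_star_iff v.2.2).2 ⟨hv, rfl⟩, fun k hk =>
          ((L.getElem_eq_star_iff v.2.2).1 hk).2⟩
      split_child := fun v i hi hv hlt => by
        obtain ⟨u, hu, rfl, hφ⟩ := L.exists_of_RF hi
        rw [L.count_RF_pos hu]
        exact L.F_split_child v hu (by omega) (by omega) }, rfl, fun _ => rfl, rfl, rfl⟩

end Layering

end CTree

/-! ### Doubling the distance. -/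

namespace CTree

open scoped Classical
open LTree

set_option linter.unusedSectionVars false

namespace Layering

variable {T : LTree} {b : ℕ} (L : Layering T b)

/-- `y` has the `0`-th symbol of the label of `u` and, at the early ranks of the reflect nodes
above `u`, the symbols that the label of `u` has at the indices of these nodes. -/
def Guided (u : T.V) (y : Str) : Prop :=
  y[0]? = (T.label u)[0]? ∧ ∀ w, L.R (L.dep w) → T.Desc w u → w ≠ u →
    y[T.earlyRank b w]? = (T.label u)[L.rk (L.dep w) + 1]?

/-- The symbols of `y` at position `0` and at the early ranks of the reflect nodes above `s`. -/
noncomputable def restrict (s : T.V) (y : Str) : Str :=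
  (y[0]?).getD Sym.star :: (List.range (L.rk (L.dep s))).map fun j =>
    (y[T.earlyRank b (L.anc s (L.nthR j))]?).getD Sym.star

include L

theorem mem_take_iff_pos_lt {p : ℕ} (hp : p < (T.Q b).length) {q : T.V × Bool}
    (hq : L.R (L.dep q.1)) : q ∈ (T.Q b).take p ↔ L.pos q < p := by
  rw [L.mem_take_Q hp hq, ← L.pos_lt_iff hq (L.R_Q hp), L.pos_getElem hp]

theorem restrict_rk {s w : T.V} {y : Str} (hw : L.R (L.dep w)) (hws : T.Desc w s)
    (hlt : L.dep w < L.dep s) (hy : T.earlyRank b w < y.length) :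
    (L.restrict s y)[L.rk (L.dep w) + 1]? = y[T.earlyRank b w]? := by
  rw [restrict, List.getElem?_cons_succ, List.getElem?_map,
    List.getElem?_range (L.rk_lt hw hlt), Option.map_some, L.nthR_rk hw, L.eq_anc hws,
    List.getElem?_eq_getElem hy]
  rfl

theorem restrict_zero {s : T.V} {y : Str} (hy : 0 < y.length) :
    (L.restrict s y)[0]? = y[0]? := by
  rw [List.getElem?_eq_getElem hy, restrict, List.getElem?_cons_zero, List.getElem?_eq_getElem hy]
  rfl

theorem length_restrict (s : T.V) (y : Str) : (L.restrict s y).length = L.rk (L.dep s) + 1 := by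
  simp [restrict]

theorem restrict_eq_take {s u : T.V} {y : Str} (hsu : T.Desc s u)
    (hy : 0 < y.length) (h0 : y[0]? = (T.label u)[0]?)
    (h : ∀ w, L.R (L.dep w) → T.Desc w s → L.dep w < L.dep s → T.earlyRank b w < y.length ∧
      y[T.earlyRank b w]? = (T.label u)[L.rk (L.dep w) + 1]?) :
    L.restrict s y = (T.label u).take (L.rk (L.dep s) + 1) := by
  refine List.ext_getElem? fun k => ?_
  rcases lt_or_ge k (L.rk (L.dep s) + 1) with hk | hk
  · rw [List.getElem?_take_of_lt hk]
    rcases k with _ | k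
    · rw [L.restrict_zero hy, h0]
    · obtain ⟨w, hw, hws, hlt, rfl⟩ := L.exists_reflect_of_lt_rk (Nat.lt_of_succ_lt_succ hk)
      rw [L.restrict_rk hw hws hlt (h w hw hws hlt).1, (h w hw hws hlt).2]
  · have := L.rk_mono (L.dep_le_of_desc hsu)
    rw [List.getElem?_eq_none (by rw [L.length_restrict]; exact hk),
      List.getElem?_eq_none (by rw [List.length_take]; omega)]

/-- The conditions at `s` hold because the label of `u` is star-free and independent of the labels
above `s`, and because it has the digits of the closed sides. -/
theorem compLabel_take {s u : T.V} (hu : L.R (L.dep u))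
    (hsu : T.Desc s u) : L.CompLabel s ((T.label u).take (L.rk (L.dep s) + 1)) := by
  have hle := L.dep_le_of_desc hsu
  have hrk := L.rk_mono hle
  have hlen := L.len_label u
  have hget : ∀ k < L.rk (L.dep s) + 1,
      ((T.label u).take (L.rk (L.dep s) + 1))[k]? = (T.label u)[k]? := fun k hk =>
    List.getElem?_take_of_lt hk
  have hX := L.mem_X u
  refine L.compLabel_iff.2 ⟨mem_XStr_iff.2 ⟨?_, fun j c hc => ?_⟩, ?_, fun w hw hws hlt => ?_⟩
  · rw [hget 0 (Nat.succ_pos _)]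
    exact hX.1
  · rw [hget _ ?_] at hc
    · exact (mem_XStr_iff.1 hX).2 j c hc
    · have := (List.getElem?_eq_some_iff.1 hc).1
      rw [List.length_take] at this
      omega
  · rw [List.length_take]
    omega
  · have h1 := L.rk_lt hw hlt
    have hp : ¬ T.label w <+: (T.label u).take (L.rk (L.dep s) + 1) := fun h => by
      rw [L.indep w u hw hu (h.trans (List.take_prefix _ _))] at hlt
      omega
    refine ⟨fun _ => ⟨fun h => absurd h hp, fun h => ?_⟩, fun h => ⟨hp, ?_⟩⟩
    · rw [hget _ (by omega)] at h
      exact absurd h (star_notMem_iff.1 (L.no_star u hu) _)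
    · rw [hget _ (by omega), L.digit_eq_of_desc hw h hsu]

section

variable {L} {L' : Layering (T.F b) b} (hdep : ∀ x, L'.dep x = x.1.1 + 1) (hR : L'.R = L.RF)
  (hφ : L'.φ = L.φF) {t : (T.F b).V} {y : Str}

include hdep hR hφ

theorem length_of_compLabel_F (hy : L'.CompLabel t y) : y.length = earlyCount T b t.1.1 + 1 := by
  rw [(L'.compLabel_iff.1 hy).2.1, L'.rk_eq, hR, hdep, L.count_RF t.1.2.le]

/-- `compLabel_iff` for the ancestor of `t` in the layer of the early visit of `u`; it is closed
exactly if the late visit of `u` precedes `t`. -/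
theorem compLabel_F_iff_aux (hy : L'.CompLabel t y) {u : T.V} (hu : L.R (L.dep u))
    (hut : (u, false) ∈ (T.Q b).take t.1.1) : ∃ x : (T.F b).V, (T.F b).Desc x t ∧
      x.1.1 = L.pos (u, false) ∧
      ((u, true) ∉ (T.Q b).take t.1.1 →
        (x.2.1 <+: y ↔ y[T.earlyRank b u]? = some Sym.star)) ∧
      ((u, true) ∈ (T.Q b).take t.1.1 →
        ¬ x.2.1 <+: y ∧ y[T.earlyRank b u]? = t.2.1[T.earlyRank b u]?) := by
  rw [L.mem_take_iff_pos_lt t.1.2 (q := (u, false)) hu] at hut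
  rw [L.mem_take_iff_pos_lt t.1.2 (q := (u, true)) hu]
  have hpu := L.pos_lt (q := (u, false)) hu
  obtain ⟨h1, h2⟩ := L'.anc_spec t (L.pos (u, false) + 1) (by omega) (by rw [hdep]; omega)
  have h3 := L.getElem_pos (q := (u, false)) hu
  have h4 := (L'.compLabel_iff.1 hy).2.2 _ (by rw [h2, hR]; exact L.RF_pos_early hu) h1
    (by rw [h2, hdep]; omega)
  have h5 : L'.φ (L.pos (u, false) + 1) = L.pos (u, true) + 1 := by
    rw [hφ, L.φF_succ hpu, h3]
  rw [h2, h5, hdep, L'.rk_eq, hR, L.count_RF_pos hu] at h4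
  refine ⟨_, h1, ?_, fun h => h4.1 (by omega), fun h => h4.2 (by omega)⟩
  rw [hdep] at h2
  omega

theorem getElem_of_mem_lateRanks (hy : L'.CompLabel t y) {n : ℕ} (hn : n ∈ T.lateRanks b t.1.1) :
    y[n]? = t.2.1[n]? := by
  obtain ⟨u, hu, rfl⟩ := L.mem_lateRanks.1 hn
  obtain ⟨x, -, -, -, h⟩ := compLabel_F_iff_aux hdep hR hφ hy (L.mem_of_mem_take hu)
    (L.early_of_late_mem_take hu)
  exact (h hu).2

/-- The free positions in the label of that ancestor agree with those of `y` automatically. What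
remains of the final-substring condition concerns only position `0` and the ranks of the nodes above
`u`. -/
theorem guided_iff (hy : L'.CompLabel t y) {u : T.V} (hu : L.R (L.dep u))
    (hut : (u, false) ∈ (T.Q b).take t.1.1) :
    ((u, true) ∉ (T.Q b).take t.1.1 →
      (L.Guided u y ↔ y[T.earlyRank b u]? = some Sym.star)) ∧
    ((u, true) ∈ (T.Q b).take t.1.1 → ¬ L.Guided u y) := by
  obtain ⟨x, hxt, hxp, h1, h2⟩ := compLabel_F_iff_aux hdep hR hφ hy hu hut
  have hpu := L.pos_lt (q := (u, false)) hu
  have hq := L.getElem_pos (q := (u, false)) hu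
  have hrk := L.earlyRank_getElem hpu (by rw [hq])
  obtain ⟨hle, hag⟩ := F_desc_agree hxt L
  have hlate := fun n hn => getElem_of_mem_lateRanks hdep hR hφ hy (n := n) hn
  have key : L.Guided u y ↔ x.2.1 <+: y := by
    clear h1 h2
    obtain ⟨⟨p, hp⟩, s, hs⟩ := x
    dsimp only at hxp hle hag ⊢
    subst hxp
    have hs1 := L.mem_layerLabels.1 hs
    simp only [Fin.getElem_fin, hq] at hs1 hrk
    rw [prefix_iff_forall]
    constructor
    · rintro ⟨h0, h⟩ k hk
      rw [hs1.1] at hk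
      rcases L.cases_of_le (p := ⟨_, hp⟩) (n := k) (Nat.lt_succ_iff.1 hk) with
        rfl | ⟨w, hw, hwp, hne, rfl⟩ | ⟨hβ, -⟩ | hn
      · rw [hs1.2.1, h0]
      · simp only [Fin.getElem_fin, hq] at hwp hne
        rw [hs1.2.2.1 w hw hwp hne, h w hw hwp hne]
      · simp only [Fin.getElem_fin, hq] at hβ
        cases hβ
      · rw [hag k hn, hlate k (L.lateRanks_mono hle hn)]
    · intro h
      refine ⟨by rw [h 0 (by omega), hs1.2.1], fun w hw hwu hne => ?_⟩
      have := (L.earlyRank_lt_iff hw hu).2 (Or.inr (Or.inl ⟨hne, hwu, rfl⟩))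
      rw [h _ (by omega), hs1.2.2.1 w hw hwu hne]
  rw [key]
  exact ⟨h1, fun h => (h2 h).1⟩

/-- All reflect nodes strictly above `s` are still open at the visit `t`, even if their split layers
in `T` lie above `s`. So the restriction lands in the string graph of `s` with all positions open,
and a further fold is needed to close some of them. -/
theorem compLabel_F_restrict {s : T.V} (hs : T.Desc s (T.Q b)[t.1.1].1)
    (hy : L'.CompLabel t y) :
    Gam b (L.rk (L.dep s)) (L.wt s) (fun _ => none) (L.restrict s y) := by
  have hlen := length_of_compLabel_F hdep hR hφ hy
  have hopen : ∀ w, L.R (L.dep w) → T.Desc w s → L.dep w < L.dep s →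
      L.Open (T.Q b)[t.1.1] w := fun w hw hws hlt => by
    refine ⟨hw, hws.trans hs, Or.inl fun h => ?_⟩
    have := L.dep_le_of_desc hs
    rw [← h] at this
    omega
  have hearly : ∀ w, L.R (L.dep w) → T.Desc w s → L.dep w < L.dep s →
      (w, false) ∈ (T.Q b).take t.1.1 := fun w hw hws hlt =>
    (L.early_mem_take_iff t.1.2 hw).2 (Or.inl (hopen w hw hws hlt))
  have hlt : ∀ w, L.R (L.dep w) → T.Desc w s → L.dep w < L.dep s →
      T.earlyRank b w < y.length := fun w hw hws hlt => by
    rw [hlen]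
    exact Nat.lt_succ_of_le (L.earlyRank_le_iff.2 (hearly w hw hws hlt))
  have hX := mem_XStr_iff.1 (L'.compLabel_iff.1 hy).1
  refine ⟨mem_XStr_iff.2 ⟨?_, fun j c hc => ?_⟩, L.length_restrict s y, fun j hj _ => ?_,
    fun j hj s hs => by cases hs⟩
  · rw [L.restrict_zero (by omega)]
    exact hX.1
  · have hj : j < L.rk (L.dep s) := by
      have := (List.getElem?_eq_some_iff.1 hc).1
      rw [L.length_restrict] at this
      omega
    obtain ⟨w, hw, hws, hws', rfl⟩ := L.exists_reflect_of_lt_rk hj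
    rw [L.restrict_rk hw hws hws' (hlt w hw hws hws')] at hc
    have h1 := L.earlyRank_pos w
    exact hX.2 (T.earlyRank b w - 1) c (by rwa [Nat.sub_add_cancel h1])
  · obtain ⟨w, hw, hws, hws', rfl⟩ := L.exists_reflect_of_lt_rk hj
    rw [L.restrict_rk hw hws hws' (hlt w hw hws hws'), L.wt_rk hw hws,
      ← (guided_iff hdep hR hφ hy hw (hearly w hw hws hws')).1
        (Open.not_mem L t.1.2 (hopen w hw hws hws')), prefix_iff_forall, L.len_R w hw]
    have hanc : ∀ u, T.Desc u w → u ≠ w → T.Desc u s ∧ L.dep u < L.dep s ∧ L.dep u < L.dep w :=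
      fun u h hne => by
        have := (L.dep_le_of_desc h).lt_of_ne fun hh => hne (L.eq_of_desc h hh.ge)
        exact ⟨h.trans hws, by omega, this⟩
    constructor
    · refine fun h => ⟨?_, fun u hu huw hne => ?_⟩
      · rw [← h 0 (by omega), L.restrict_zero (by omega)]
      · obtain ⟨h1, h2, h3⟩ := hanc u huw hne
        have := L.rk_lt hu h3
        rw [← h _ (by omega), L.restrict_rk hu h1 h2 (hlt u hu h1 h2)]
    · rintro ⟨h0, h⟩ k hk
      rcases k with _ | k
      · rw [L.restrict_zero (by omega), h0]
      · obtain ⟨u, hu, huw, huw', rfl⟩ := L.exists_reflect_of_lt_rk (Nat.lt_of_succ_lt_succ hk)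
        have hne : u ≠ w := fun hh => by rw [hh] at huw'; omega
        obtain ⟨h1, h2, -⟩ := hanc u huw hne
        rw [L.restrict_rk hu h1 h2 (hlt u hu h1 h2), h u hu huw hne]

end

theorem getElem_zero_of_ne_root {v : T.V} (hv : L.R (L.dep v)) (hne : v ≠ L.root) :
    (T.label v)[0]? = some (Sym.digit 2) := by
  refine (L.mem_X v).1.resolve_left fun h => hne (L.indep L.root v L.R_root hv ?_).symm
  rw [L.label_root, prefix_iff_forall]
  intro k hk
  obtain rfl : k = 0 := by simpa using hk
  exact h

/-- On a path of the component of `s` between parts of labels of reflect nodes that lie below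
different children of `s`, the node `s` itself has to be crossed. -/
theorem two_mul_le_of_near {D n : ℕ} (hD : L.SplitFar D) {s u v : T.V} {i : ℕ} (hi : L.R i)
    (hs : L.dep s = L.φ i) (hu : L.R (L.dep u))
    (hv : L.R (L.dep v)) (hu0 : (T.label u)[0]? = some (Sym.digit 2))
    (hv0 : (T.label v)[0]? = some (Sym.digit 2))
    (hne : (T.label v)[L.rk i + 1]? ≠ (T.label u)[L.rk i + 1]?)
    (hn : Near (L.CompLabel s) n ((T.label v).take (L.rk (L.dep s) + 1))
      ((T.label u).take (L.rk (L.dep s) + 1))) : 2 * D ≤ n := by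
  have hsR : ¬ L.R (L.dep s) := hs ▸ L.φ_not i hi
  have hlt := L.φ_lt i hi
  obtain ⟨w, hws, rfl⟩ := L.exists_anc s i (L.R_pos i hi) (by omega)
  have hrk := L.rk_lt hi hlt
  rw [← hs] at hrk
  -- The ends differ in the symbol owned by the mate `w` of `s`.
  obtain ⟨z, m, l, hz, hm, hl, rfl⟩ := hn.crossing (L.rk (L.dep w)) (by
    rwa [List.getElem?_take_of_lt (by omega), List.getElem?_take_of_lt (by omega)])
  -- By nestedness the reflect layers between `w` and `s` are closed, so `eq_of_star` applies.
  obtain rfl : z = T.label s := by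
    refine Gam.eq_of_star hm.right (L.compLabel_label s) hrk (L.ct_rk_of_le hi hs.le)
      (fun k hk hjk => ?_) ((L.wf s).len _ hrk) hz (L.star_S s w _ hi hs rfl hws).1
    obtain ⟨x, hx, hxs, hxs', rfl⟩ := L.exists_reflect_of_lt_rk hk
    have := L.nested _ _ hi hx (L.lt_of_rk_lt hjk) (by omega)
    rw [L.ct_rk_of_lt hx (by omega)]
    obtain ⟨d, -, -, hd⟩ := L.exists_digit_of_lt hx s (by omega)
    rw [hd]
    simp
  have key : ∀ {x : T.V} {m : ℕ}, L.R (L.dep x) → (T.label x)[0]? = some (Sym.digit 2) →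
      Near (L.CompLabel s) m (T.label s) ((T.label x).take (L.rk (L.dep s) + 1)) → D ≤ m :=
    fun {x m} hx hx0 h => hD s hsR _ (fun hh => L.no_star x hx (List.mem_of_mem_take hh))
      (by rw [List.getElem?_take_of_lt (Nat.succ_pos _), hx0]) m h
  have h1 := key hv hv0 hm.symm
  have h2 := key hu hu0 hl
  omega

/-- Follow the star-free end `x` down `T` to `u`, show that `u` has not been visited yet, and
project the path to the component of the split node where the paths to `u` and to the current node
`v` separate. -/
theorem splitFar_F {L' : Layering (T.F b) b} (hdep : ∀ x, L'.dep x = x.1.1 + 1) (hR : L'.R = L.RF)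
    (hφ : L'.φ = L.φF) {D : ℕ} (hD : L.SplitFar D) : L'.SplitFar (2 * D) := by
  intro t ht x hxs hx0 n hn
  rw [hdep, hR, L.RF_succ t.1.2, Bool.not_eq_false] at ht
  have hx := hn.right
  have hlen := length_of_compLabel_F hdep hR hφ hx
  have hb := L.three_le
  have hd : ∀ w : T.V, ∃ d, (1 ≤ d ∧ d ≤ b) ∧ (T.earlyRank b w ≤ earlyCount T b t.1.1 →
      x[T.earlyRank b w]? = some (Sym.digit d)) := fun w => by
    by_cases hw : T.earlyRank b w ≤ earlyCount T b t.1.1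
    · have h1 := L.earlyRank_pos w
      obtain ⟨d, h2, h3, h4⟩ := exists_digit_of_mem_XStr hx.mem (j := T.earlyRank b w - 1)
        (by omega) (star_notMem_iff.1 hxs _)
      rw [Nat.sub_add_cancel h1] at h4
      exact ⟨d, ⟨h2, h3⟩, fun _ => h4⟩
    · exact ⟨1, ⟨le_rfl, by omega⟩, fun h => absurd h hw⟩
  choose f hf hfx using hd
  obtain ⟨u, hu, hu0, huw⟩ := L.exists_guided f hf (a := Sym.digit 2) (Or.inr rfl)
  set v := (T.Q b)[t.1.1].1 with hv
  have hvR : L.R (L.dep v) := L.R_Q t.1.2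
  -- If `u` had been visited, `x` would be guided by it: a star at its rank if `u` is open,
  -- impossible if it is finished.
  have hut : (u, false) ∉ (T.Q b).take t.1.1 := fun hut => by
    have hg : L.Guided u x := ⟨hx0.trans hu0.symm, fun w hw hwu hne => by
      have h1 := (L.earlyRank_lt_iff hw hu).2 (Or.inr (Or.inl ⟨hne, hwu, rfl⟩))
      have h2 := L.earlyRank_le_iff.2 hut
      rw [hfx w (by omega), huw w hw hwu hne]⟩
    obtain ⟨h1, h2⟩ := guided_iff hdep hR hφ hx hu hut
    by_cases h : (u, true) ∈ (T.Q b).take t.1.1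
    · exact h2 h hg
    · exact star_notMem_iff.1 hxs _ ((h1 h).1 hg)
  -- As `t` is a late visit, the reflect nodes above `v`, those below it, and `v` itself have all
  -- been visited early.
  have huv : ¬ T.Desc u v := fun h =>
    hut ((L.early_mem_take_iff t.1.2 hu).2 (Or.inl ⟨hu, h, Or.inr ht⟩))
  have hvu : ¬ T.Desc v u := fun h => by
    refine hut ((L.mem_take_Q t.1.2 (q := (u, false)) hu).2 (Or.inr (Or.inr (Or.inl ⟨?_, h, ht⟩))))
    exact fun hh => huv (by rw [show u = v from hh]; exact .refl _)
  obtain ⟨i, s, hi, hs, hsv, hsu, hiv, hiu, hne⟩ := L.diverge hvu huv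
  have hsR : ¬ L.R (L.dep s) := hs ▸ L.φ_not i hi
  have hle : ∀ w, L.R (L.dep w) → T.Desc w s → L.dep w < L.dep s →
      T.earlyRank b w ≤ earlyCount T b t.1.1 := fun w hw hws hlt => by
    refine L.earlyRank_le_iff.2 ((L.early_mem_take_iff t.1.2 hw).2
      (Or.inl ⟨hw, hws.trans hsv, Or.inr ht⟩))
  have hlt := L.length_of_mem t.2.2
  have hanc : ∀ {w y}, T.Desc s y → L.dep w < L.dep s → w ≠ y := fun {w y} h1 h2 h3 => by
    have := L.dep_le_of_desc h1
    rw [← h3] at this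
    omega
  have h1 := L.restrict_eq_take hsv (by omega) (L.mem_layerLabels.1 t.2.2).2.1 fun w hw hws h =>
    ⟨by have := hle w hw hws h; omega,
      L.getElem_of_open t.2.2 hw (hws.trans hsv) (hanc hsv h)⟩
  have h2 := L.restrict_eq_take hsu (by omega) (hx0.trans hu0.symm) fun w hw hws h =>
    ⟨by have := hle w hw hws h; omega, by
      rw [hfx w (hle w hw hws h), huw w hw (hws.trans hsu) (hanc hsu h)]⟩
  -- Closes the positions whose split layers lie above `s`; the two ends are fixed, as they already
  -- lie in the component of `s`.
  obtain ⟨r, hr1, hr2, hr3⟩ := exists_retraction (L.wf s) (c := fun _ => none) fun _ _ => Or.inl rfl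
  have hn' := (hn.map (P' := Gam b (L.rk (L.dep s)) (L.wt s) fun _ => none) (f := L.restrict s)
    (fun y hy => compLabel_F_restrict hdep hR hφ hsv hy) fun y y' hy hy' hc => ?_).map hr1 hr3
  · rw [show (T.F b).label t = t.2.1 from rfl, h1, h2, hr2 _ (L.compLabel_take hvR hsv),
      hr2 _ (L.compLabel_take hu hsu)] at hn'
    refine L.two_mul_le_of_near hD hi hs hu hvR hu0 (L.getElem_zero_of_ne_root hvR ?_)
      hne hn'
    exact fun h => hvu (h ▸ L.desc_root u)
  · right
    have hy1 := length_of_compLabel_F hdep hR hφ hy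
    have hy2 := length_of_compLabel_F hdep hR hφ hy'
    refine ⟨by rw [L.restrict_zero (by omega), L.restrict_zero (by omega)]; exact hc.1, fun j => ?_⟩
    rcases lt_or_ge j (L.rk (L.dep s)) with hj | hj
    · obtain ⟨w, hw, hws, hws', rfl⟩ := L.exists_reflect_of_lt_rk hj
      have h3 := hle w hw hws hws'
      rw [L.restrict_rk hw hws hws' (by omega), L.restrict_rk hw hws hws' (by omega)]
      have h4 := hc.2 (T.earlyRank b w - 1)
      rwa [Nat.sub_add_cancel (L.earlyRank_pos w)] at h4
    · left
      rw [List.getElem?_eq_none (by rw [L.length_restrict]; omega),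
        List.getElem?_eq_none (by rw [L.length_restrict]; omega)]

end Layering

end CTree

/-! ### The initial tree: its labels and layers. -/

namespace CTree

open scoped Classical
open LTree

theorem finite_lists_of_forall_mem {α : Type*} {A : Set α} (hA : A.Finite) (n : ℕ) :
    {l : List α | l.length ≤ n ∧ ∀ x ∈ l, x ∈ A}.Finite := by
  induction n with
  | zero =>
    refine (Set.finite_singleton []).subset fun l hl => ?_
    exact List.length_eq_zero_iff.1 (Nat.le_zero.1 hl.1)
  | succ n ih =>
    refine ((Set.finite_singleton []).union (hA.image2 List.cons ih)).subset fun l hl => ?_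
    rcases l with _ | ⟨a, l⟩
    · exact Or.inl rfl
    · refine Or.inr ⟨a, hl.2 a (by simp), l, ⟨?_, fun x hx => hl.2 x (by simp [hx])⟩, rfl⟩
      have := hl.1
      simp only [List.length_cons] at this
      omega

theorem map_digit_injective : Function.Injective (List.map Sym.digit) :=
  List.map_injective_iff.2 fun _ _ h => Sym.digit.inj h

theorem exists_word {b : ℕ} {l : Str} (hl : ∀ c ∈ l, ∃ d, 1 ≤ d ∧ d ≤ b ∧ c = Sym.digit d) :
    ∃ w, IsWord b w ∧ l = w.map Sym.digit := by
  induction l with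
  | nil => exact ⟨[], by simp [IsWord], rfl⟩
  | cons c l ih =>
    obtain ⟨w, hw, rfl⟩ := ih fun c hc => hl c (by simp [hc])
    obtain ⟨d, h1, h2, rfl⟩ := hl c (by simp)
    refine ⟨d :: w, fun e he => ?_, rfl⟩
    rcases List.mem_cons.1 he with rfl | he
    · exact ⟨h1, h2⟩
    · exact hw e he

namespace Initial

/-- Here `m` and `w` are independent, because `InitialChild` does not tie them together; `label_iff`
does. -/
def refl (m : ℕ) (w : List ℕ) : Str := [Sym.digit 2, Sym.digit m] ++ w.map Sym.digit

def spl (m : ℕ) (w : List ℕ) : Str := [Sym.digit 2, Sym.digit m] ++ w.map Sym.digit ++ [Sym.star]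

def leaf (w : List ℕ) : Str := [Sym.digit 1, Sym.star] ++ w.map Sym.digit

@[simp] theorem refl_inj {m m' : ℕ} {w w' : List ℕ} : refl m w = refl m' w' ↔ m = m' ∧ w = w' := by
  simp [refl, map_digit_injective.eq_iff]

@[simp] theorem spl_inj {m m' : ℕ} {w w' : List ℕ} : spl m w = spl m' w' ↔ m = m' ∧ w = w' := by
  simp [spl, map_digit_injective.eq_iff]

@[simp] theorem leaf_inj {w w' : List ℕ} : leaf w = leaf w' ↔ w = w' := by
  simp [leaf, map_digit_injective.eq_iff]

theorem star_notMem_refl (m : ℕ) (w : List ℕ) : Sym.star ∉ refl m w := by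
  simp [refl]

theorem star_mem_spl (m : ℕ) (w : List ℕ) : Sym.star ∈ spl m w := by
  simp [spl]

@[simp] theorem refl_ne_spl {m m' : ℕ} {w w' : List ℕ} : refl m w ≠ spl m' w' := fun h =>
  star_notMem_refl m w (h ▸ star_mem_spl m' w')

@[simp] theorem spl_ne_refl {m m' : ℕ} {w w' : List ℕ} : spl m w ≠ refl m' w' :=
  refl_ne_spl.symm

@[simp] theorem refl_ne_leaf {m : ℕ} {w w' : List ℕ} : refl m w ≠ leaf w' := by
  simp [refl, leaf]

@[simp] theorem spl_ne_leaf {m : ℕ} {w w' : List ℕ} : spl m w ≠ leaf w' := by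
  simp [spl, leaf]

@[simp] theorem leaf_ne_refl {m : ℕ} {w w' : List ℕ} : leaf w ≠ refl m w' := refl_ne_leaf.symm

@[simp] theorem leaf_ne_spl {m : ℕ} {w w' : List ℕ} : leaf w ≠ spl m w' := spl_ne_leaf.symm

@[simp] theorem root_ne_refl {m : ℕ} {w : List ℕ} : [Sym.digit 1] ≠ refl m w := by simp [refl]

@[simp] theorem root_ne_spl {m : ℕ} {w : List ℕ} : [Sym.digit 1] ≠ spl m w := by simp [spl]

@[simp] theorem root_ne_leaf {w : List ℕ} : [Sym.digit 1] ≠ leaf w := by simp [leaf]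

theorem child_iff {Δ : ℕ} {s t : Str} : InitialChild Δ s t ↔
    (s = [Sym.digit 1] ∧ t = refl 1 []) ∨ (∃ m w, s = refl m w ∧ t = spl m w) ∨
    (∃ m w j, m < Δ ∧ s = spl m w ∧ t = refl (m + 1) (w ++ [j])) ∨
    ∃ w j, s = spl Δ w ∧ t = leaf (w ++ [j]) := by
  constructor
  · rintro (_ | ⟨m, w⟩ | ⟨m, w, j, hm⟩ | ⟨w, j⟩)
    · exact Or.inl ⟨rfl, rfl⟩
    · exact Or.inr (Or.inl ⟨m, w, rfl, rfl⟩)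
    · exact Or.inr (Or.inr (Or.inl ⟨m, w, j, hm, rfl, by simp [refl]⟩))
    · exact Or.inr (Or.inr (Or.inr ⟨w, j, rfl, by simp [leaf]⟩))
  · rintro (⟨rfl, rfl⟩ | ⟨m, w, rfl, rfl⟩ | ⟨m, w, j, hm, rfl, rfl⟩ | ⟨w, j, rfl, rfl⟩)
    · exact .root
    · exact .reflect m w
    · have := InitialChild.split m w j hm
      simpa [refl, spl] using this
    · have := InitialChild.leaf (Δ := Δ) w j
      simpa [leaf, spl] using this

theorem label_iff {Δ : ℕ} {s : Str} : InitialLabel Δ s ↔ s = [Sym.digit 1] ∨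
    (∃ w, IsWord Δ w ∧ w.length < Δ ∧ s = refl (w.length + 1) w) ∨
    (∃ w, IsWord Δ w ∧ w.length < Δ ∧ s = spl (w.length + 1) w) ∨
    ∃ w, IsWord Δ w ∧ w.length = Δ ∧ s = leaf w := by
  constructor
  · rintro (_ | ⟨m, w, hm, hm', hw, hl⟩ | ⟨m, w, hm, hm', hw, hl⟩ | ⟨w, hw, hl⟩)
    · exact Or.inl rfl
    · obtain rfl : m = w.length + 1 := by omega
      exact Or.inr (Or.inl ⟨w, hw, hm', rfl⟩)
    · obtain rfl : m = w.length + 1 := by omega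
      exact Or.inr (Or.inr (Or.inl ⟨w, hw, hm', rfl⟩))
    · exact Or.inr (Or.inr (Or.inr ⟨w, hw, hl, rfl⟩))
  · rintro (rfl | ⟨w, hw, hl, rfl⟩ | ⟨w, hw, hl, rfl⟩ | ⟨w, hw, hl, rfl⟩)
    · exact .root
    · exact .reflect _ w (by omega) hl hw rfl
    · exact .split _ w (by omega) hl hw rfl
    · exact .leaf w hw hl

/-- The depth of the node with a given label. -/
noncomputable def dep (Δ : ℕ) (s : Str) : ℕ :=
  if s[0]? = some (Sym.digit 1) then (if s.length = 1 then 1 else 2 * Δ + 2)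
  else if Sym.star ∈ s then 2 * s.length - 3 else 2 * s.length - 2

@[simp] theorem dep_root (Δ : ℕ) : dep Δ [Sym.digit 1] = 1 := by simp [dep]

@[simp] theorem dep_refl (Δ m : ℕ) (w : List ℕ) : dep Δ (refl m w) = 2 * w.length + 2 := by
  rw [dep, if_neg (by simp [refl]), if_neg (star_notMem_refl m w)]
  simp [refl]
  omega

@[simp] theorem dep_spl (Δ m : ℕ) (w : List ℕ) : dep Δ (spl m w) = 2 * w.length + 3 := by
  rw [dep, if_neg (by simp [spl]), if_pos (star_mem_spl m w)]
  simp [spl]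
  omega

@[simp] theorem dep_leaf (Δ : ℕ) (w : List ℕ) : dep Δ (leaf w) = 2 * Δ + 2 := by
  rw [dep, if_pos (by simp [leaf]), if_neg (by simp [leaf])]

/-- The indices of the reflect layers. -/
def R (Δ i : ℕ) : Prop := i = 1 ∨ ∃ k < Δ, i = 2 * k + 2

/-- The root is matched with the leaf layer, and every other reflect layer with the split layer
right below it. -/
def φ (Δ i : ℕ) : ℕ := if i = 1 then 2 * Δ + 2 else i + 1

@[simp] theorem φ_one (Δ : ℕ) : φ Δ 1 = 2 * Δ + 2 := rfl

@[simp] theorem φ_even (Δ k : ℕ) : φ Δ (2 * k + 2) = 2 * k + 3 := if_neg (by omega)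

theorem R_even {Δ k : ℕ} : R Δ (2 * k + 2) ↔ k < Δ := by
  constructor
  · rintro (h | ⟨l, hl, h⟩) <;> omega
  · exact fun h => Or.inr ⟨k, h, rfl⟩

theorem not_R_odd {Δ k : ℕ} : ¬ R Δ (2 * k + 3) := by
  rintro (h | ⟨l, hl, h⟩) <;> omega

theorem count_one (Δ : ℕ) : Nat.count (R Δ) 1 = 0 := by
  rw [Nat.count_succ, Nat.count_zero, if_neg]
  rintro (h | ⟨l, hl, h⟩) <;> omega

theorem count_even {Δ k : ℕ} (hk : k ≤ Δ) : Nat.count (R Δ) (2 * k + 2) = k + 1 := by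
  induction k with
  | zero => rw [Nat.count_succ, count_one, if_pos (show R Δ 1 from Or.inl rfl)]
  | succ k ih =>
    rw [show 2 * (k + 1) + 2 = 2 * k + 2 + 1 + 1 by ring, Nat.count_succ, Nat.count_succ,
      ih (by omega), if_pos (R_even.2 hk), if_neg not_R_odd]

theorem count_odd {Δ k : ℕ} (hk : k < Δ) : Nat.count (R Δ) (2 * k + 3) = k + 2 := by
  rw [Nat.count_succ, count_even hk.le, if_pos (R_even.2 hk)]

theorem refl_getElem (m : ℕ) (w : List ℕ) (k : ℕ) :
    (refl m w)[k + 2]? = (w[k]?).map Sym.digit := by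
  simp [refl]

theorem leaf_getElem (w : List ℕ) (k : ℕ) : (leaf w)[k + 2]? = (w[k]?).map Sym.digit := by
  simp [leaf]

theorem spl_getElem_of_lt (m : ℕ) {w : List ℕ} {k : ℕ} (hk : k < w.length) :
    (spl m w)[k + 2]? = (w[k]?).map Sym.digit := by
  rw [spl, List.getElem?_append_left (by simpa using hk)]
  exact refl_getElem m w k

theorem spl_getElem_length (m : ℕ) (w : List ℕ) :
    (spl m w)[w.length + 2]? = some Sym.star := by
  simp [spl]

theorem length_refl (m : ℕ) (w : List ℕ) : (refl m w).length = w.length + 2 := by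
  simp [refl]

theorem length_spl (m : ℕ) (w : List ℕ) : (spl m w).length = w.length + 3 := by
  simp [spl]

theorem length_leaf (w : List ℕ) : (leaf w).length = w.length + 2 := by
  simp [leaf]

theorem lt_of_spl_getElem {m : ℕ} {w : List ℕ} {k d : ℕ}
    (h : (spl m w)[k + 2]? = some (Sym.digit d)) : k < w.length := by
  by_contra hk
  rcases (not_lt.1 hk).lt_or_eq with hk | rfl
  · rw [List.getElem?_eq_none (by rw [length_spl]; omega)] at h
    cases h
  · rw [spl_getElem_length] at h
    cases h

theorem getElem_concat {w : List ℕ} {k : ℕ} (j : ℕ) (hk : k < w.length) : (w ++ [j])[k]? = w[k]? :=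
  List.getElem?_append_left hk

/-- From position `2` on, the word `w` is only ever extended; the last edge changes symbols `0` and
`1` only, apart from replacing the star. -/
theorem getElem_child {Δ : ℕ} {s t : Str} (h : InitialChild Δ s t) {k d : ℕ}
    (hs : s[k + 2]? = some (Sym.digit d)) : t[k + 2]? = some (Sym.digit d) := by
  rcases child_iff.1 h with ⟨rfl, rfl⟩ | ⟨m, w, rfl, rfl⟩ | ⟨m, w, j, hm, rfl, rfl⟩ | ⟨w, j, rfl, rfl⟩
  · simp at hs
  · rw [spl, ← refl, List.getElem?_append_left (List.getElem?_eq_some_iff.1 hs).1]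
    exact hs
  · have hk := lt_of_spl_getElem hs
    rwa [refl_getElem, getElem_concat j hk, ← spl_getElem_of_lt m hk]
  · have hk := lt_of_spl_getElem hs
    rwa [leaf_getElem, getElem_concat j hk, ← spl_getElem_of_lt Δ hk]

theorem dep_child {Δ : ℕ} {s t : Str} (hs : InitialLabel Δ s) (h : InitialChild Δ s t) :
    dep Δ t = dep Δ s + 1 := by
  rcases child_iff.1 h with ⟨rfl, rfl⟩ | ⟨m, w, rfl, rfl⟩ | ⟨m, w, j, hm, rfl, rfl⟩ | ⟨w, j, rfl, rfl⟩
  · simp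
  · simp
  · simp
    omega
  -- For the last kind of edge, only `hs` yields that `w` has length `Δ - 1`.
  · rcases label_iff.1 hs with h | ⟨w, hw, hl, h⟩ | ⟨w, hw, hl, h⟩ | ⟨w, hw, hl, h⟩
    · exact absurd h.symm root_ne_spl
    · simp at h
    · simp at h ⊢
      obtain ⟨h, rfl⟩ := h
      omega
    · simp at h

theorem parent_unique {Δ : ℕ} {s s' t : Str} (h : InitialChild Δ s t) (h' : InitialChild Δ s' t) :
    s = s' := by
  rcases child_iff.1 h with ⟨rfl, rfl⟩ | ⟨m, w, rfl, rfl⟩ | ⟨m, w, j, hm, rfl, rfl⟩ |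
      ⟨w, j, rfl, rfl⟩ <;>
    rcases child_iff.1 h' with ⟨rfl, h⟩ | ⟨m', w', rfl, h⟩ | ⟨m', w', j', hm', rfl, h⟩ |
      ⟨w', j', rfl, h⟩ <;> simp_all

theorem exists_concat {w : List ℕ} (hw : w ≠ []) : ∃ w' j, w = w' ++ [j] :=
  ⟨w.dropLast, w.getLast hw, (List.dropLast_concat_getLast hw).symm⟩

theorem isWord_concat {Δ : ℕ} {w : List ℕ} {j : ℕ} :
    IsWord Δ (w ++ [j]) ↔ IsWord Δ w ∧ 1 ≤ j ∧ j ≤ Δ := by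
  simp only [IsWord, List.mem_append, List.mem_singleton]
  constructor
  · exact fun h => ⟨fun d hd => h d (Or.inl hd), h j (Or.inr rfl)⟩
  · rintro ⟨h, h'⟩ d (hd | rfl)
    · exact h d hd
    · exact h'

theorem exists_parent {Δ : ℕ} (hΔ : 0 < Δ) {t : Str} (ht : InitialLabel Δ t) (h1 : 1 < dep Δ t) :
    ∃ s, InitialLabel Δ s ∧ InitialChild Δ s t := by
  rcases label_iff.1 ht with rfl | ⟨w, hw, hl, rfl⟩ | ⟨w, hw, hl, rfl⟩ | ⟨w, hw, hl, rfl⟩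
  · simp at h1
  · by_cases hw0 : w = []
    · subst hw0
      exact ⟨_, .root, .root⟩
    · obtain ⟨w, j, rfl⟩ := exists_concat hw0
      rw [List.length_append, List.length_singleton] at hl ⊢
      exact ⟨spl (w.length + 1) w, label_iff.2 (Or.inr (Or.inr (Or.inl
        ⟨w, (isWord_concat.1 hw).1, by omega, rfl⟩))), child_iff.2 (Or.inr (Or.inr (Or.inl
        ⟨_, w, j, hl, rfl, rfl⟩)))⟩
  · exact ⟨refl (w.length + 1) w, label_iff.2 (Or.inr (Or.inl ⟨w, hw, hl, rfl⟩)),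
      child_iff.2 (Or.inr (Or.inl ⟨_, w, rfl, rfl⟩))⟩
  · obtain ⟨w, j, rfl⟩ := exists_concat (w := w) (fun h => by simp [h] at hl; omega)
    rw [List.length_append, List.length_singleton] at hl
    exact ⟨spl Δ w, label_iff.2 (Or.inr (Or.inr (Or.inl
      ⟨w, (isWord_concat.1 hw).1, by omega, by rw [hl]⟩))), child_iff.2 (Or.inr (Or.inr (Or.inr
      ⟨w, j, rfl, rfl⟩)))⟩

theorem exists_child_refl {Δ : ℕ} {t : Str} (ht : InitialLabel Δ t) (hΔ : 0 < Δ)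
    (hR : R Δ (dep Δ t)) : ∃ s, InitialLabel Δ s ∧ ∀ u, InitialChild Δ t u ↔ u = s := by
  rcases label_iff.1 ht with rfl | ⟨w, hw, hl, rfl⟩ | ⟨w, hw, hl, rfl⟩ | ⟨w, hw, hl, rfl⟩
  · refine ⟨refl 1 [], label_iff.2 (Or.inr (Or.inl ⟨[], by simp [IsWord], hΔ, rfl⟩)), fun u => ?_⟩
    rw [child_iff]
    simp
  · refine ⟨spl (w.length + 1) w, label_iff.2 (Or.inr (Or.inr (Or.inl ⟨w, hw, hl, rfl⟩))),
      fun u => ?_⟩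
    rw [child_iff]
    simp [(root_ne_refl (m := w.length + 1) (w := w)).symm]
  · rw [dep_spl] at hR
    exact absurd hR not_R_odd
  · rw [dep_leaf, R_even] at hR
    omega

theorem length_eq {Δ : ℕ} {t : Str} (ht : InitialLabel Δ t) :
    t.length = Nat.count (R Δ) (dep Δ t) + 1 := by
  rcases label_iff.1 ht with rfl | ⟨w, hw, hl, rfl⟩ | ⟨w, hw, hl, rfl⟩ | ⟨w, hw, hl, rfl⟩
  · rw [dep_root, count_one]
    rfl
  · rw [dep_refl, count_even hl.le, length_refl]
  · rw [dep_spl, count_odd hl, length_spl]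
  · rw [dep_leaf, count_even le_rfl, length_leaf, hl]

theorem mem_XStr {Δ : ℕ} {t : Str} (ht : InitialLabel Δ t) : t ∈ XStr Δ := by
  have hmap : ∀ {w : List ℕ}, IsWord Δ w → ∀ c ∈ w.map Sym.digit,
      c = Sym.star ∨ ∃ d, 1 ≤ d ∧ d ≤ Δ ∧ c = Sym.digit d := fun {w} hw c hc => by
    obtain ⟨d, hd, rfl⟩ := List.mem_map.1 hc
    exact Or.inr ⟨d, (hw d hd).1, (hw d hd).2, rfl⟩
  rcases label_iff.1 ht with rfl | ⟨w, hw, hl, rfl⟩ | ⟨w, hw, hl, rfl⟩ | ⟨w, hw, hl, rfl⟩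
  · exact ⟨Or.inl rfl, by simp⟩
  · refine ⟨Or.inr rfl, fun c hc => ?_⟩
    rcases List.mem_cons.1 (show c ∈ Sym.digit (w.length + 1) :: w.map Sym.digit from hc) with
      rfl | hc
    · exact Or.inr ⟨_, by omega, hl, rfl⟩
    · exact hmap hw c hc
  · refine ⟨Or.inr rfl, fun c hc => ?_⟩
    rcases List.mem_cons.1 (show c ∈ Sym.digit (w.length + 1) :: (w.map Sym.digit ++ [Sym.star])
      from hc) with rfl | hc
    · exact Or.inr ⟨_, by omega, hl, rfl⟩
    · rcases List.mem_append.1 hc with hc | hc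
      · exact hmap hw c hc
      · exact Or.inl (List.mem_singleton.1 hc)
  · refine ⟨Or.inl rfl, fun c hc => ?_⟩
    rcases List.mem_cons.1 (show c ∈ Sym.star :: w.map Sym.digit from hc) with rfl | hc
    · exact Or.inl rfl
    · exact hmap hw c hc

/-- The reflect nodes. -/
theorem reflect_cases {Δ : ℕ} {t : Str} (ht : InitialLabel Δ t) (hR : R Δ (dep Δ t)) :
    t = [Sym.digit 1] ∨ ∃ w, IsWord Δ w ∧ w.length < Δ ∧ t = refl (w.length + 1) w := by
  rcases label_iff.1 ht with rfl | h | ⟨w, hw, hl, rfl⟩ | ⟨w, hw, hl, rfl⟩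
  · exact Or.inl rfl
  · exact Or.inr h
  · rw [dep_spl] at hR
    exact absurd hR not_R_odd
  · rw [dep_leaf, R_even] at hR
    omega

/-- The split nodes. -/
theorem split_cases {Δ : ℕ} {t : Str} (ht : InitialLabel Δ t) (hR : ¬ R Δ (dep Δ t)) :
    (∃ w, IsWord Δ w ∧ w.length < Δ ∧ t = spl (w.length + 1) w) ∨
      ∃ w, IsWord Δ w ∧ w.length = Δ ∧ t = leaf w := by
  rcases label_iff.1 ht with rfl | ⟨w, hw, hl, rfl⟩ | h | h
  · rw [dep_root] at hR
    exact absurd (Or.inl rfl) hR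
  · rw [dep_refl, R_even] at hR
    exact absurd hl hR
  · exact Or.inl h
  · exact Or.inr h

theorem star_notMem {Δ : ℕ} {t : Str} (ht : InitialLabel Δ t) (hR : R Δ (dep Δ t)) :
    Sym.star ∉ t := by
  rcases reflect_cases ht hR with rfl | ⟨w, -, -, rfl⟩
  · simp
  · exact star_notMem_refl _ _

/-- Symbol `1` of a reflect label other than the root announces its length. -/
theorem indep {Δ : ℕ} {s t : Str} (hs : InitialLabel Δ s) (ht : InitialLabel Δ t)
    (hsR : R Δ (dep Δ s)) (htR : R Δ (dep Δ t)) (h : s <+: t) : s = t := by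
  have h' := prefix_iff_forall.1 h
  rcases reflect_cases hs hsR with rfl | ⟨w, hw, hl, rfl⟩ <;>
    rcases reflect_cases ht htR with rfl | ⟨w', hw', hl', rfl⟩
  · rfl
  · have := h' 0 (by simp)
    simp [refl] at this
  · have := h' 0 (by simp [refl])
    simp [refl] at this
  · have := h' 1 (by simp [refl])
    simp [refl] at this
    exact h.eq_of_length (by rw [length_refl, length_refl, this])

/-- For a string ending in `m 2`, the final substring of length `m + 1` is a reflect label. -/
theorem clear {Δ : ℕ} (hΔ : 0 < Δ) {x : Str} (hx : x ∈ XStrMinus Δ)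
    (hl : ∀ y, InitialLabel Δ y → R Δ (dep Δ y) → y.length ≤ x.length) :
    ∃ y, InitialLabel Δ y ∧ R Δ (dep Δ y) ∧ y <+: x := by
  obtain ⟨⟨h0, htl⟩, hxs⟩ := hx
  rcases x with _ | ⟨a, x⟩
  · simp at h0
  rcases h0 with h0 | h0
  · obtain rfl : a = Sym.digit 1 := by simpa using h0
    exact ⟨_, .root, by rw [dep_root]; exact Or.inl rfl, x, rfl⟩
  obtain rfl : a = Sym.digit 2 := by simpa using h0
  obtain ⟨w, hw, rfl⟩ := exists_word (b := Δ) (l := x) fun c hc =>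
    (htl c hc).resolve_left fun h => hxs (by rw [← h]; exact List.mem_cons_of_mem _ hc)
  -- One of the longest reflect labels, used to see that `x` has length at least `Δ + 1`.
  have hlen := hl (refl Δ (List.replicate (Δ - 1) 1)) (label_iff.2 (Or.inr (Or.inl
    ⟨List.replicate (Δ - 1) 1, fun d hd => by
      rw [List.eq_of_mem_replicate hd]
      omega, by rw [List.length_replicate]; omega,
      by rw [List.length_replicate, Nat.sub_add_cancel hΔ]⟩)))
    (by rw [dep_refl, R_even, List.length_replicate]; omega)
  rw [length_refl, List.length_replicate, List.length_cons, List.length_map] at hlen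
  rcases w with _ | ⟨m, w⟩
  · simp at hlen
  have hm := hw m (by simp)
  rw [List.length_cons] at hlen
  have htake : (w.take (m - 1)).length = m - 1 := by
    rw [List.length_take]
    omega
  refine ⟨refl m (w.take (m - 1)), label_iff.2 (Or.inr (Or.inl ⟨w.take (m - 1), fun d hd =>
    hw d (List.mem_cons_of_mem _ (List.mem_of_mem_take hd)), by omega, ?_⟩)), ?_, ?_⟩
  · rw [htake, Nat.sub_add_cancel hm.1]
  · rw [dep_refl, R_even]
    omega
  · show Sym.digit 2 :: Sym.digit m :: (w.take (m - 1)).map Sym.digit <+: _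
    rw [List.map_cons, List.cons_prefix_cons, List.cons_prefix_cons]
    exact ⟨rfl, rfl, (List.take_prefix _ _).map _⟩

theorem star_unique {Δ : ℕ} {t : Str} (ht : InitialLabel Δ t) (hR : ¬ R Δ (dep Δ t)) :
    ∃! k : ℕ, t[k]? = some Sym.star := by
  rcases split_cases ht hR with ⟨w, hw, hl, rfl⟩ | ⟨w, hw, hl, rfl⟩
  · refine ⟨w.length + 2, spl_getElem_length _ w, fun k hk => ?_⟩
    rcases k with _ | _ | k
    · simp [spl] at hk
    · simp [spl] at hk
    · have h1 := (List.getElem?_eq_some_iff.1 hk).1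
      rw [length_spl] at h1
      by_contra hne
      have h2 : k < w.length := by omega
      rw [spl_getElem_of_lt _ h2] at hk
      simp at hk
  · refine ⟨1, rfl, fun k hk => ?_⟩
    rcases k with _ | _ | k
    · simp [leaf] at hk
    · rfl
    · rw [leaf_getElem] at hk
      simp at hk

end Initial

end CTree

/-! ### The initial tree is a construction tree. -/

namespace CTree

open scoped Classical
open LTree

namespace Initial

theorem desc_getElem {Δ : ℕ} {u v : (initialTree Δ).V} (h : (initialTree Δ).Desc u v) {k d : ℕ}
    (hu : u.1[k + 2]? = some (Sym.digit d)) : v.1[k + 2]? = some (Sym.digit d) := by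
  induction h with
  | refl => exact hu
  | tail _ h ih => exact getElem_child h ih

theorem dep_desc {Δ : ℕ} {u v : (initialTree Δ).V} (h : (initialTree Δ).Desc u v) :
    dep Δ u.1 ≤ dep Δ v.1 := by
  induction h with
  | refl => exact le_rfl
  | @tail v w _ h ih => have := dep_child v.2 h; omega

theorem star_S {Δ : ℕ} {u v : (initialTree Δ).V} {w : List ℕ} {m : ℕ}
    (h : (initialTree Δ).Desc u v) (hv : v.1 = spl m w) (hu : dep Δ u.1 + 1 = dep Δ v.1) :
    u.1 = refl m w := by
  rcases h.eq_or_parent with rfl | ⟨p, hp, hc⟩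
  · omega
  have h1 := dep_child p.2 hc
  obtain rfl : u = p := by
    rcases hp.eq_or_parent with h | ⟨q, hq, hc'⟩
    · exact h
    · have := dep_child q.2 hc'
      have := dep_desc hq
      omega
  have hc : InitialChild Δ u.1 v.1 := hc
  rw [hv, child_iff] at hc
  simpa using hc

theorem split_child {Δ : ℕ} {v : (initialTree Δ).V} {w : List ℕ} (hw : IsWord Δ w)
    (hl : w.length < Δ) (hv : v.1 = spl (w.length + 1) w) :
    ∃ ρ : (initialTree Δ).V → ℕ,
      Set.BijOn ρ {u | (initialTree Δ).Child v u} (Set.Icc 1 Δ) ∧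
      ∀ u, (initialTree Δ).Child v u → ∀ x, (initialTree Δ).Desc u x →
        x.1[w.length + 2]? = some (Sym.digit (ρ u)) := by
  have hlast : ∀ j, (w ++ [j])[w.length]? = some j := fun j => List.getElem?_concat_length
  -- The `j`-th child is a reflect node, except below the last inner split layer, where it is a
  -- leaf.
  let c : ℕ → Str := fun j =>
    if w.length + 1 < Δ then refl (w.length + 2) (w ++ [j]) else leaf (w ++ [j])
  have hlen : ∀ j, (w ++ [j]).length = w.length + 1 := fun j => by simp
  have hget : ∀ j, (c j)[w.length + 2]? = some (Sym.digit j) := fun j => by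
    simp only [c]
    split_ifs
    · rw [refl_getElem, hlast, Option.map_some]
    · rw [leaf_getElem, hlast, Option.map_some]
  have hc : ∀ u, InitialChild Δ v.1 u ↔ ∃ j, u = c j := fun u => by
    rw [hv, child_iff]
    simp only [c]
    by_cases h : w.length + 1 < Δ
    · simp only [if_pos h]
      simp [h, root_ne_spl.symm]
      omega
    · obtain rfl : Δ = w.length + 1 := by omega
      simp only [lt_irrefl, if_false]
      simp [root_ne_spl.symm]
  have hlab : ∀ j, InitialLabel Δ (c j) ↔ 1 ≤ j ∧ j ≤ Δ := fun j => by
    rw [label_iff]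
    simp only [c]
    by_cases h : w.length + 1 < Δ
    · simp only [if_pos h]
      constructor
      · rintro (h | ⟨w', hw', hl', h⟩ | ⟨w', hw', hl', h⟩ | ⟨w', hw', hl', h⟩)
        · exact absurd h.symm root_ne_refl
        · rw [← (refl_inj.1 h).2] at hw'
          exact (isWord_concat.1 hw').2
        · simp at h
        · simp at h
      · exact fun hj => Or.inr (Or.inl ⟨_, isWord_concat.2 ⟨hw, hj⟩, by rw [hlen]; exact h,
          by rw [hlen]⟩)
    · simp only [if_neg h]
      constructor
      · rintro (h | ⟨w', hw', hl', h⟩ | ⟨w', hw', hl', h⟩ | ⟨w', hw', hl', h⟩)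
        · exact absurd h.symm root_ne_leaf
        · simp at h
        · simp at h
        · rw [← leaf_inj.1 h] at hw'
          exact (isWord_concat.1 hw').2
      · exact fun hj => Or.inr (Or.inr (Or.inr ⟨_, isWord_concat.2 ⟨hw, hj⟩, by rw [hlen]; omega,
          rfl⟩))
  have hd : ∀ u : (initialTree Δ).V, ∃ j, (initialTree Δ).Child v u →
      u.1 = c j ∧ 1 ≤ j ∧ j ≤ Δ := fun u => by
    by_cases h : (initialTree Δ).Child v u
    · obtain ⟨j, hj⟩ := (hc u.1).1 h
      exact ⟨j, fun _ => ⟨hj, (hlab j).1 (hj ▸ u.2)⟩⟩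
    · exact ⟨0, fun h' => absurd h' h⟩
  choose ρ hρ using hd
  refine ⟨ρ, ⟨fun u hu => (hρ u hu).2, fun u hu u' hu' h => Subtype.ext ?_, fun j hj => ?_⟩,
    fun u hu x hx => desc_getElem hx ?_⟩
  · rw [(hρ u hu).1, (hρ u' hu').1, h]
  · have hch : (initialTree Δ).Child v ⟨c j, (hlab j).2 hj⟩ := (hc _).2 ⟨j, rfl⟩
    refine ⟨_, hch, ?_⟩
    have h1 := hget j
    have h2 : c j = _ := (hρ _ hch).1
    rw [h2, hget] at h1
    simpa using h1
  · rw [(hρ u hu).1, hget]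

theorem finite (Δ : ℕ) : Finite (initialTree Δ).V := by
  have hA : (insert Sym.star (Sym.digit '' Set.Iic (Δ + 2))).Finite :=
    ((Set.finite_Iic _).image _).insert _
  refine ((finite_lists_of_forall_mem hA (Δ + 2)).subset fun t (ht : InitialLabel Δ t) => ?_).to_subtype
  have hX := mem_XStr ht
  refine ⟨?_, fun c hc => ?_⟩
  · rcases label_iff.1 ht with rfl | ⟨w, hw, hl, rfl⟩ | ⟨w, hw, hl, rfl⟩ | ⟨w, hw, hl, rfl⟩
    · simp
    · rw [length_refl]; omega
    · rw [length_spl]; omega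
    · rw [length_leaf]; omega
  · rcases t with _ | ⟨a, t⟩
    · cases hc
    rcases List.mem_cons.1 hc with rfl | hc
    · rcases hX.1 with h | h
      · exact Or.inr ⟨1, by simp, (Option.some.inj h).symm⟩
      · exact Or.inr ⟨2, by simp, (Option.some.inj h).symm⟩
    · rcases hX.2 c hc with rfl | ⟨d, h1, h2, rfl⟩
      · exact Or.inl rfl
      · exact Or.inr ⟨d, by simp; omega, rfl⟩

theorem R_cases {Δ i : ℕ} (hi : R Δ i) : (i = 1 ∧ φ Δ i = 2 * Δ + 2 ∧ Nat.count (R Δ) i + 1 = 1) ∨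
    ∃ k < Δ, i = 2 * k + 2 ∧ φ Δ i = 2 * k + 3 ∧ Nat.count (R Δ) i + 1 = k + 2 := by
  rcases hi with rfl | ⟨k, hk, rfl⟩
  · exact Or.inl ⟨rfl, rfl, by rw [count_one]⟩
  · exact Or.inr ⟨k, hk, rfl, φ_even Δ k, by rw [count_even hk.le]⟩

theorem exists_layering {Δ : ℕ} (hΔ : 3 ≤ Δ) : Nonempty (Layering (initialTree Δ) Δ) := by
  have h0 : 0 < Δ := by omega
  have hdep : ∀ {t}, InitialLabel Δ t → 1 ≤ dep Δ t ∧ dep Δ t ≤ 2 * Δ + 2 := fun {t} ht => by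
    rcases label_iff.1 ht with rfl | ⟨w, hw, hl, rfl⟩ | ⟨w, hw, hl, rfl⟩ | ⟨w, hw, hl, rfl⟩ <;>
      simp <;> omega
  exact ⟨
    { M := 2 * Δ + 2
      dep := fun v => dep Δ v.1
      root := ⟨_, .root⟩
      R := R Δ
      φ := φ Δ
      rk := Nat.count (R Δ)
      rk_eq := fun _ => rfl
      three_le := hΔ
      fin := finite Δ
      dep_root := dep_root Δ
      eq_root := fun v hv => Subtype.ext (by
        rcases label_iff.1 v.2 with h | ⟨w, hw, hl, h⟩ | ⟨w, hw, hl, h⟩ | ⟨w, hw, hl, h⟩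
        · exact h
        all_goals rw [h] at hv; simp at hv; try omega)
      dep_pos := fun v => (hdep v.2).1
      dep_le := fun v => (hdep v.2).2
      dep_child := fun v w h => dep_child v.2 h
      parent := fun w hw => by
        obtain ⟨s, hs, h⟩ := exists_parent h0 w.2 hw
        exact ⟨⟨s, hs⟩, h⟩
      parent_unique := fun u v w hu hv => Subtype.ext (parent_unique hu hv)
      reflect_child := fun v hv => by
        obtain ⟨s, hs, h⟩ := exists_child_refl v.2 h0 hv
        exact ⟨⟨s, hs⟩, fun u =>
          ⟨fun hu => Subtype.ext ((h u.1).1 hu), fun hu => (h u.1).2 (by rw [hu])⟩⟩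
      R_pos := fun i hi => by
        rcases R_cases hi with ⟨rfl, -, -⟩ | ⟨k, hk, rfl, -, -⟩ <;> omega
      R_lt := fun i hi => by
        rcases R_cases hi with ⟨rfl, -, -⟩ | ⟨k, hk, rfl, -, -⟩ <;> omega
      R_one := Or.inl rfl
      φ_not := fun i hi => by
        rcases R_cases hi with ⟨rfl, h, -⟩ | ⟨k, hk, rfl, h, -⟩
        · rw [h, R_even]
          omega
        · rw [h]
          exact not_R_odd
      φ_le := fun i hi => by
        rcases R_cases hi with ⟨rfl, h, -⟩ | ⟨k, hk, rfl, h, -⟩ <;> omega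
      φ_inj := fun i j hi hj hij => by
        rcases R_cases hi with ⟨rfl, h, -⟩ | ⟨k, hk, rfl, h, -⟩ <;>
          rcases R_cases hj with ⟨rfl, h', -⟩ | ⟨k', hk', rfl, h', -⟩ <;> omega
      φ_surj := fun s hs hs' hsR => by
        obtain ⟨k, h⟩ | ⟨k, h⟩ : (∃ k, s = 2 * k + 2) ∨ ∃ k, s = 2 * k + 1 := by
          rcases Nat.even_or_odd' s with ⟨k, h | h⟩
          · exact Or.inl ⟨k - 1, by omega⟩
          · exact Or.inr ⟨k, h⟩
        · rw [h, R_even] at hsR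
          exact ⟨1, Or.inl rfl, by rw [φ_one]; omega⟩
        · rcases k with _ | k
          · exact absurd (Or.inl (by omega)) hsR
          · exact ⟨2 * k + 2, R_even.2 (by omega), by rw [φ_even]; omega⟩
      φ_one := φ_one Δ
      φ_lt := fun i hi => by
        rcases R_cases hi with ⟨rfl, h, -⟩ | ⟨k, hk, rfl, h, -⟩ <;> omega
      nested := fun i j hi hj hij hji => by
        rcases R_cases hi with ⟨rfl, h, -⟩ | ⟨k, hk, rfl, h, -⟩ <;>
          rcases R_cases hj with ⟨rfl, h', -⟩ | ⟨k', hk', rfl, h', -⟩ <;> omega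
      mem_X := fun v => mem_XStr v.2
      label_root := rfl
      len_R := fun v _ => length_eq v.2
      inj_R := fun v w _ _ h => Subtype.ext h
      no_star := fun v hv => star_notMem v.2 hv
      indep := fun v w hv hw h => Subtype.ext (indep v.2 w.2 hv hw h)
      clear := fun x hx hl => by
        obtain ⟨y, hy, hyR, hyx⟩ := clear h0 hx fun y hy hyR => hl ⟨y, hy⟩ hyR
        exact ⟨⟨y, hy⟩, hyR, hyx⟩
      len_S := fun v _ => length_eq v.2
      star_S := fun v u i hi hv hu h => by
        show v.1[_]? = _ ∧ ∀ k < _, v.1[k]? = u.1[k]?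
        rcases R_cases hi with ⟨rfl, h1, h2⟩ | ⟨k, hk, rfl, h1, h2⟩ <;> rw [h2] <;> rw [h1] at hv
        · rcases label_iff.1 u.2 with hu' | ⟨w, hw, hl, hu'⟩ | ⟨w, hw, hl, hu'⟩ | ⟨w, hw, hl, hu'⟩
          swap; · rw [hu', dep_refl] at hu; omega
          swap; · rw [hu', dep_spl] at hu; omega
          swap; · rw [hu', dep_leaf] at hu; omega
          have hvR : ¬ R Δ (dep Δ v.1) := by
            rw [hv, R_even]
            omega
          rcases split_cases v.2 hvR with ⟨w, hw, hl, hv'⟩ | ⟨w, hw, hl, hv'⟩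
          · rw [hv', dep_spl] at hv
            omega
          rw [hv', hu']
          refine ⟨rfl, fun j hj => ?_⟩
          obtain rfl : j = 0 := by omega
          rfl
        · have hvR : ¬ R Δ (dep Δ v.1) := by
            rw [hv]
            exact not_R_odd
          rcases split_cases v.2 hvR with ⟨w, hw, hl, hv'⟩ | ⟨w, hw, hl, hv'⟩
          swap
          · rw [hv', dep_leaf] at hv
            omega
          have hu' := star_S h hv' (by omega)
          rw [hv', dep_spl] at hv
          obtain rfl : k = w.length := by omega
          rw [hv', hu']
          refine ⟨spl_getElem_length _ w, fun j hj => ?_⟩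
          rw [spl, ← refl]
          exact List.getElem?_append_left (by rw [length_refl]; omega)
      star_unique := fun v hv => star_unique v.2 hv
      split_child := fun v i hi hv hlt => by
        rcases R_cases hi with ⟨rfl, h1, h2⟩ | ⟨k, hk, rfl, h1, h2⟩
        · omega
        · rw [h2]
          rw [h1] at hv
          have hvR : ¬ R Δ (dep Δ v.1) := by
            rw [hv]
            exact not_R_odd
          rcases split_cases v.2 hvR with ⟨w, hw, hl, hv'⟩ | ⟨w, hw, hl, hv'⟩
          swap
          · rw [hv', dep_leaf] at hv
            omega
          rw [hv', dep_spl] at hv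
          obtain rfl : k = w.length := by omega
          exact split_child hw hl hv' }⟩

end Initial

end CTree

/-! ### The three claims assembled. -/

theorem mainTheorem3 (Δ : ℕ) (hΔ : 3 ≤ Δ) :
    (∀ T : CTree.LTree, T.IsConstructionTree Δ → T.ProcessWellDefined Δ) ∧
    (∀ (T : CTree.LTree) (D : ℕ), 0 < D → T.IsConstructionTree Δ → T.DistanceCorrect Δ D →
      (T.F Δ).IsConstructionTree Δ ∧ (T.F Δ).DistanceCorrect Δ (2 * D)) ∧
    (∀ i : ℕ, 2 ≤ i →
      (CTree.treeSeq Δ (i - 2)).IsConstructionTree Δ ∧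
      (CTree.treeSeq Δ (i - 2)).DistanceCorrect Δ (2 ^ (i - 1))) := by
  have hF : ∀ (T : CTree.LTree) (D : ℕ), T.IsConstructionTree Δ → T.DistanceCorrect Δ D →
      (T.F Δ).IsConstructionTree Δ ∧ (T.F Δ).DistanceCorrect Δ (2 * D) := fun T D hT hD => by
    obtain ⟨L⟩ := hT.exists_layering
    obtain ⟨L', -, hdep, hR, hφ⟩ := L.exists_layering_F
    exact ⟨L'.isConstructionTree, (L'.distanceCorrect_iff _).2
      (L.splitFar_F hdep hR hφ ((L.distanceCorrect_iff D).1 hD))⟩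
  refine ⟨fun T hT => ?_, fun T D _ => hF T D, fun i hi => ?_⟩
  · obtain ⟨L⟩ := hT.exists_layering
    exact L.processWellDefined
  · induction i, hi using Nat.le_induction with
    -- The required distance `2 ^ (2 - 1) = 2` holds in every construction tree.
    | base =>
      obtain ⟨L⟩ := CTree.Initial.exists_layering hΔ
      exact ⟨L.isConstructionTree, (L.distanceCorrect_iff _).2 L.splitFar_two⟩
    | succ i hi ih =>
      have h := hF _ _ ih.1 ih.2
      rw [← pow_succ', show i - 1 + 1 = i + 1 - 1 by omega] at h
      rwa [show i + 1 - 2 = i - 2 + 1 by omega]
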